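/- **Setting.** Let $M$ be a smooth $d$-dimensional manifold ($d\ge 1$), $G$ a Lie group with Lie algebra $\mathfrak g$, $\pi:P\to M$ a smooth principal $G$-bundle, $\lambda:G\to O(d-1,1)$ a smooth homomorphism to the Lorentz group (for $G=O(d-1,1)\times G'$, the projection), and $\rho$ a smooth representation of $G$ on a finite-dimensional real vector space $V$. For a representation $R$ of $G$ on $W$ let $\Omega^k_{hor}P(W,R)$ be the smooth $W$-valued $k$-forms $\sigma$ on $P$ that are horizontal and satisfy $R_g^*\sigma=R(g^{-1})\sigma$ for all $g \in G$; $\Omega^k_{hor}P$ denotes the case of the trivial representation on $\mathbb R$. A *dynamical field* $\psi=(\psi^\alpha)=(e^a,A^I,\varphi^A)$ consists of a coframe $e\in\Omega^1_{hor}P(\mathbb R^d,\lambda)$ that is non-degenerate ($X\cdot e=0$ iff $X$ is vertical), a connection $A\in\Omega^1P(\mathfrak g,\mathrm{Ad})$, and an equivariant function $\varphi\in\Omega^0P(V,\rho)$; the form degrees are $|\alpha|=1,1,0$. Variations $\delta\psi$ are triples of horizontal equivariant forms of the same degrees. A *Lagrangian* is a functional $L[\psi]\in\Omega^d_{hor}P$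 of the dynamical fields that takes smooth one-parameter families of fields to smooth families of forms, is local (its value at a point depends only on the derivatives of $\psi$ at that point up to some fixed finite order), and is covariant: $f^*L[\psi]=L[f^*\psi]$ for every automorphism $f$ of the bundle $P$. The *equations of motion* $\mathcal E_\alpha(\psi)\in\Omega^{d-|\alpha|}_{hor}P$, with values in the dual representations, and a *symplectic potential* $\theta(\psi;\delta\psi)$, a smooth $(d-1)$-form depending locally (through finitely many derivatives) on $\psi$ and $\delta\psi$ and linearly on $\delta\psi$, are such that $$\delta L=\mathcal E_\alpha(\psi)\wedge\delta\psi^\alpha+d\theta(\psi;\delta\psi)$$ for the first variation of every smooth one-parameter family of dynamical fields. An infinitesimal automorphism $X\in\mathfrak{aut}(P)$ is a smooth $G$-invariant vector field on $P$; $X\cdot$ is the interior product and $\mathcal L_X\sigma=X\cdot d\sigma+d(X\cdot\sigma)$. Put $$J_X=\theta(\psi;\mathcal L_X\psi)-X\cdot L[\psi],\qquad C(X)=(-1)^{d-|\alpha|+1}\,\mathcal E_\alpha\wedge X\cdot\psi^\alpha,$$ $$B(X)=-\mathcal E_\alpha\wedge X\cdot d\psi^\alpha+(-1)^{d-|\alpha|}\,d\mathcal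 E_\alpha\wedge X\cdot\psi^\alpha ,$$ with summation over $\alpha$, and $X\cdot\varphi=0$. **Proposition (Bianchi identities).** Let $L$ be a Lagrangian with equations of motion $\mathcal E_\alpha$. For every dynamical field $\psi$ (whether or not it satisfies $\mathcal E_\alpha(\psi)=0$) and every $X\in\mathfrak{aut}(P)$, $$B(X)=0 .$$ Consequently, for every symplectic potential $\theta$, $$d\left[J_X-C(X)\right]=0 .$$ -/

import Mathlib

open scoped Manifold ContDiff

noncomputable section

namespace GaugeBianchi

/-! ## Differential forms on a manifold

All manifolds are real, smooth, finite dimensional and without boundary; a manifold `P` is modelled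
on a normed space `EP`.  In Mathlib the tangent space at `p` *is* the model space `EP`
(identified through the preferred chart at `p`), and the forms below are written accordingly. -/

section Forms

variable {EP : Type*} [NormedAddCommGroup EP] [NormedSpace ℝ EP]
  {P : Type*} [TopologicalSpace P] [ChartedSpace EP P]
  {EN : Type*} [NormedAddCommGroup EN] [NormedSpace ℝ EN]
  {N : Type*} [TopologicalSpace N] [ChartedSpace EN N]
  {F : Type*} [NormedAddCommGroup F] [NormedSpace ℝ F]
  {F' : Type*} [NormedAddCommGroup F'] [NormedSpace ℝ F']

/-- The tangent map `T_p P → T_{f p} N` of a map between manifolds. -/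
def tanMap (f : P → N) (p : P) : EP →L[ℝ] EN :=
  mfderiv 𝓘(ℝ, EP) 𝓘(ℝ, EN) f p

variable (EP P F) in
/-- `F`-valued `k`-forms (not necessarily smooth) on `P`. -/
abbrev Form (k : ℕ) : Type _ := P → EP [⋀^Fin k]→L[ℝ] F

/-- The expression of a form in the preferred chart around `x`, i.e. its pullback by the inverse
chart. -/
def chartRep {k : ℕ} (x : P) (α : Form EP P F k) (y : EP) : EP [⋀^Fin k]→L[ℝ] F :=
  (α ((extChartAt 𝓘(ℝ, EP) x).symm y)).compContinuousLinearMap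
    (tanMap (extChartAt 𝓘(ℝ, EP) x).symm y)

/-- Smooth differential forms. -/
def IsSmoothForm {k : ℕ} (α : Form EP P F k) : Prop :=
  ∀ x : P, ContDiffOn ℝ ∞ (chartRep x α) (extChartAt 𝓘(ℝ, EP) x).target

/-- One-parameter families of forms which are jointly smooth in the parameter and the point. -/
def IsSmoothFormFamily {k : ℕ} (α : ℝ → Form EP P F k) : Prop :=
  ∀ x : P, ContDiffOn ℝ ∞ (fun q : ℝ × EP => chartRep x (α q.1) q.2)
    (Set.univ ×ˢ (extChartAt 𝓘(ℝ, EP) x).target)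

/-- Two forms have the same derivatives up to order `r` at `p`. -/
def SameFormJet {k : ℕ} (r : ℕ) (p : P) (α₁ α₂ : Form EP P F k) : Prop :=
  ∀ i ≤ r, iteratedFDeriv ℝ i (chartRep p α₁) (extChartAt 𝓘(ℝ, EP) p p) =
    iteratedFDeriv ℝ i (chartRep p α₂) (extChartAt 𝓘(ℝ, EP) p p)

/-- The exterior derivative, computed at `x` in the preferred chart around `x`. -/
def extD {k : ℕ} (α : Form EP P F k) : Form EP P F (k + 1) := fun x =>
  (extDeriv (chartRep x α) (extChartAt 𝓘(ℝ, EP) x x)).compContinuousLinearMap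
    (tanMap (extChartAt 𝓘(ℝ, EP) x) x)

/-- The pullback `f^* α` of a form. -/
def pullForm {k : ℕ} (f : P → P) (α : Form EP P F k) : Form EP P F k := fun p =>
  (α (f p)).compContinuousLinearMap (tanMap f p)

/-- The interior product `X · α`. -/
def iprod {k : ℕ} (X : P → EP) (α : Form EP P F (k + 1)) : Form EP P F k := fun p =>
  (α p).curryLeft (X p)

/-- The Lie derivative of a form of positive degree, `L_X α = X · dα + d (X · α)`. -/
def lieD {k : ℕ} (X : P → EP) (α : Form EP P F (k + 1)) : Form EP P F (k + 1) :=
  iprod X (extD α) + extD (iprod X α)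

/-- The Lie derivative of a function, `L_X φ = X · dφ`. -/
def lieDZero (X : P → EP) (φ : Form EP P F 0) : Form EP P F 0 :=
  iprod X (extD φ)

/-- The composition of a form with linear endomorphisms of the space of values. -/
def mapForm {k : ℕ} (T : F →L[ℝ] F') (α : Form EP P F k) : Form EP P F' k := fun p =>
  T.compContinuousAlternatingMap (α p)

/-- The product `α ∧ f` of an `F^*`-valued form and an `F`-valued function (a `0`-form), with the
values contracted. -/
def wedgeZero {k : ℕ} (α : Form EP P (F →L[ℝ] ℝ) k) (f : Form EP P F 0) : Form EP P ℝ k :=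
  fun p => (ContinuousLinearMap.apply ℝ ℝ (f p ![])).compContinuousAlternatingMap (α p)

/-- The wedge product `α ∧ μ` of an `F^*`-valued `k`-form and an `F`-valued `1`-form, with the
values contracted; see `wedgeOne_apply` for the explicit formula. -/
def wedgeOne [FiniteDimensional ℝ EP] {k : ℕ} (α : Form EP P (F →L[ℝ] ℝ) k) (μ : Form EP P F 1) :
    Form EP P ℝ (k + 1) := fun p =>
  (-1 : ℝ) ^ k • ContinuousAlternatingMap.alternatizeUncurryFin
    (LinearMap.toContinuousLinearMap
      { toFun := fun v : EP =>
          (ContinuousLinearMap.apply ℝ ℝ ((μ p).curryLeft v ![])).compContinuousAlternatingMap (α p)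
        map_add' := fun v w => by ext u; simp
        map_smul' := fun c v => by ext u; simp })

/-- `(α ∧ μ)(v₀, …, v_k) = ∑ᵢ (-1)^(k - i) α(v₀, …, v̂ᵢ, …, v_k) (μ(vᵢ))`. -/
theorem wedgeOne_apply [FiniteDimensional ℝ EP] {k : ℕ} (α : Form EP P (F →L[ℝ] ℝ) k)
    (μ : Form EP P F 1) (p : P) (v : Fin (k + 1) → EP) :
    wedgeOne α μ p v =
      ∑ i : Fin (k + 1), (-1 : ℝ) ^ (k + (i : ℕ)) * α p (i.removeNth v) (μ p ![v i]) := by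
  simp [wedgeOne, ContinuousAlternatingMap.alternatizeUncurryFin_apply, Finset.mul_sum, pow_add,
    mul_assoc, zsmul_eq_mul]

end Forms

/-! ## Principal bundles -/

section Bundle

/-- A smooth principal `G`-bundle `π : P → M`: a smooth right action `act` of the Lie group `G` on
`P` and a smooth projection `proj`, locally trivial over `M`.  A local trivialization over `U` is
given by the local section `σ` and the `G`-component `τ`, the two mutually inverse smooth maps
between `π⁻¹ U` and `U × G` being `p ↦ (π p, τ p)` and `(x, g) ↦ σ x · g`. -/
structure PrincipalBundle (EM EG EP M G P : Type*)
    [NormedAddCommGroup EM] [NormedSpace ℝ EM] [NormedAddCommGroup EG] [NormedSpace ℝ EG]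
    [NormedAddCommGroup EP] [NormedSpace ℝ EP]
    [TopologicalSpace M] [ChartedSpace EM M] [TopologicalSpace G] [ChartedSpace EG G] [Group G]
    [TopologicalSpace P] [ChartedSpace EP P] where
  proj : P → M
  act : P → G → P
  act_one : ∀ p, act p 1 = p
  act_mul : ∀ p g h, act p (g * h) = act (act p g) h
  proj_act : ∀ p g, proj (act p g) = proj p
  contMDiff_proj : ContMDiff 𝓘(ℝ, EP) 𝓘(ℝ, EM) ∞ proj
  contMDiff_act : ContMDiff (𝓘(ℝ, EP).prod 𝓘(ℝ, EG)) 𝓘(ℝ, EP) ∞ (fun q : P × G => act q.1 q.2)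
  exists_trivialization : ∀ x : M, ∃ (U : Set M) (σ : M → P) (τ : P → G),
    IsOpen U ∧ x ∈ U ∧
    ContMDiffOn 𝓘(ℝ, EM) 𝓘(ℝ, EP) ∞ σ U ∧
    ContMDiffOn 𝓘(ℝ, EP) 𝓘(ℝ, EG) ∞ τ (proj ⁻¹' U) ∧
    (∀ y ∈ U, proj (σ y) = y ∧ τ (σ y) = 1) ∧
    (∀ p ∈ proj ⁻¹' U, ∀ g, τ (act p g) = τ p * g) ∧
    (∀ p ∈ proj ⁻¹' U, act (σ (proj p)) (τ p) = p)

variable {EM EG EP M G P : Type*}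
  [NormedAddCommGroup EM] [NormedSpace ℝ EM] [NormedAddCommGroup EG] [NormedSpace ℝ EG]
  [NormedAddCommGroup EP] [NormedSpace ℝ EP]
  [TopologicalSpace M] [ChartedSpace EM M] [TopologicalSpace G] [ChartedSpace EG G] [Group G]
  [TopologicalSpace P] [ChartedSpace EP P]
  {F : Type*} [NormedAddCommGroup F] [NormedSpace ℝ F]

/-- The adjoint representation of `G` on its Lie algebra `T_1 G = EG`. -/
def adRep (g : G) : EG →L[ℝ] EG :=
  tanMap (fun h : G => g * h * g⁻¹) (1 : G)

/-- The representation dual to `R`. -/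
def dualRep (R : G → F →L[ℝ] F) (g : G) : (F →L[ℝ] ℝ) →L[ℝ] (F →L[ℝ] ℝ) :=
  ContinuousLinearMap.precomp ℝ (R g⁻¹)

/-- The trivial representation on `ℝ`. -/
def trivialRep (_ : G) : ℝ →L[ℝ] ℝ := ContinuousLinearMap.id ℝ ℝ

namespace PrincipalBundle

variable (B : PrincipalBundle EM EG EP M G P)

/-- `v ∈ T_p P` is vertical if it projects to zero. -/
def IsVertical (p : P) (v : EP) : Prop :=
  tanMap (EP := EP) (EN := EM) B.proj p v = 0

/-- The fundamental (vertical) vector at `p` generated by `ξ ∈ 𝔤`. -/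
def fundamental (ξ : EG) (p : P) : EP := tanMap (fun g : G => B.act p g) (1 : G) ξ

/-- Horizontal forms: they vanish as soon as one argument is vertical. -/
def IsHorizontal {k : ℕ} (α : Form EP P F k) : Prop :=
  ∀ (p : P) (v : Fin k → EP), (∃ i, B.IsVertical p (v i)) → α p v = 0

/-- Equivariant forms of type `R`: `R_g^* α = R(g⁻¹) α`. -/
def IsEquivariant {k : ℕ} (R : G → F →L[ℝ] F) (α : Form EP P F k) : Prop :=
  ∀ g : G, pullForm (fun p => B.act p g) α = mapForm (R g⁻¹) α

/-- `α ∈ Ω^k_hor P(F, R)`: smooth horizontal equivariant forms. -/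
structure IsTensorial {k : ℕ} (R : G → F →L[ℝ] F) (α : Form EP P F k) : Prop where
  smooth : IsSmoothForm α
  horizontal : B.IsHorizontal α
  equivariant : B.IsEquivariant R α

/-- Automorphisms of the bundle: `G`-equivariant diffeomorphisms of `P`. -/
def IsAutomorphism (f : P ≃ₘ⟮𝓘(ℝ, EP), 𝓘(ℝ, EP)⟯ P) : Prop :=
  ∀ p g, f (B.act p g) = B.act (f p) g

/-- Infinitesimal automorphisms `X ∈ 𝔞𝔲𝔱(P)`: smooth `G`-invariant vector fields on `P`. -/
structure IsInfAutomorphism [IsManifold 𝓘(ℝ, EP) ∞ P] (X : P → EP) : Prop where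
  smooth : ContMDiff 𝓘(ℝ, EP) 𝓘(ℝ, EP).tangent ∞
    (fun p => (⟨p, X p⟩ : TangentBundle 𝓘(ℝ, EP) P))
  invariant : ∀ p g, tanMap (fun q => B.act q g) p (X p) = X (B.act p g)

/-- Connection `1`-forms on `P`. -/
structure IsConnection (A : Form EP P EG 1) : Prop where
  smooth : IsSmoothForm A
  fundamental : ∀ p ξ, A p ![B.fundamental ξ p] = ξ
  equivariant : B.IsEquivariant adRep A

end PrincipalBundle

end Bundle

/-! ## Dynamical fields and Lagrangians

The base `M` has dimension `d = n + 1`. -/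

/-- The Lorentzian metric `diag(-1, 1, …, 1)` on `ℝ^(n+1)`. -/
def minkowski {n : ℕ} (x y : Fin (n + 1) → ℝ) : ℝ :=
  -(x 0 * y 0) + ∑ i : Fin n, x i.succ * y i.succ

section Theory

variable {EM EG EP M G P : Type*}
  [NormedAddCommGroup EM] [NormedSpace ℝ EM] [NormedAddCommGroup EG] [NormedSpace ℝ EG]
  [NormedAddCommGroup EP] [NormedSpace ℝ EP]
  [TopologicalSpace M] [ChartedSpace EM M] [TopologicalSpace G] [ChartedSpace EG G] [Group G]
  [TopologicalSpace P] [ChartedSpace EP P]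
  {V : Type*} [NormedAddCommGroup V] [NormedSpace ℝ V] {n : ℕ}

/-- The representations under which the fields of a theory transform: a smooth homomorphism
`lorentz` from the structure group `G` to the Lorentz group `O(n, 1)`, acting on the coframe index
(for `G = O(n, 1) × G'` it is the projection to the first factor), and a smooth representation
`charge` on the space `V` in which the charged fields take their values. -/
structure FieldReps (EG G V : Type*) [NormedAddCommGroup EG] [NormedSpace ℝ EG]
    [TopologicalSpace G] [ChartedSpace EG G] [Group G]
    [NormedAddCommGroup V] [NormedSpace ℝ V] (n : ℕ) where
  lorentz : G →* ((Fin (n + 1) → ℝ) →L[ℝ] (Fin (n + 1) → ℝ))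
  lorentz_isometry : ∀ g x y, minkowski (lorentz g x) (lorentz g y) = minkowski x y
  contMDiff_lorentz : ContMDiff 𝓘(ℝ, EG)
    𝓘(ℝ, (Fin (n + 1) → ℝ) →L[ℝ] (Fin (n + 1) → ℝ)) ∞ lorentz
  charge : G →* (V →L[ℝ] V)
  contMDiff_charge : ContMDiff 𝓘(ℝ, EG) 𝓘(ℝ, V →L[ℝ] V) ∞ charge

/-- Triples `(e, A, φ)` of an `ℝ^d`-valued `1`-form, a `𝔤`-valued `1`-form and a `V`-valued
function.  Both the dynamical fields `ψ` and their variations `δψ` are of this kind; the conditions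
on them are `IsDynamical` and `IsVariation`. -/
structure Fields (EG EP P V : Type*) [NormedAddCommGroup EG] [NormedSpace ℝ EG]
    [NormedAddCommGroup EP] [NormedSpace ℝ EP]
    [NormedAddCommGroup V] [NormedSpace ℝ V] (n : ℕ) where
  e : Form EP P (Fin (n + 1) → ℝ) 1
  A : Form EP P EG 1
  φ : Form EP P V 0

/-- Triples `(𝓔_a, 𝓔_I, 𝓔_A)` of forms of degrees `d - 1`, `d - 1`, `d` with values in the dual
spaces of the values of `e`, `A`, `φ`. -/
structure DualFields (EG EP P V : Type*) [NormedAddCommGroup EG] [NormedSpace ℝ EG]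
    [NormedAddCommGroup EP] [NormedSpace ℝ EP]
    [NormedAddCommGroup V] [NormedSpace ℝ V] (n : ℕ) where
  e : Form EP P ((Fin (n + 1) → ℝ) →L[ℝ] ℝ) n
  A : Form EP P (EG →L[ℝ] ℝ) n
  φ : Form EP P (V →L[ℝ] ℝ) (n + 1)

namespace Fields

/-- The linear combination `a χ₁ + b χ₂`. -/
def comb (a : ℝ) (χ₁ : Fields EG EP P V n) (b : ℝ) (χ₂ : Fields EG EP P V n) :
    Fields EG EP P V n :=
  ⟨a • χ₁.e + b • χ₂.e, a • χ₁.A + b • χ₂.A, a • χ₁.φ + b • χ₂.φ⟩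

/-- The pullback of the fields by a map `f : P → P`. -/
def pull (f : P → P) (ψ : Fields EG EP P V n) : Fields EG EP P V n :=
  ⟨pullForm f ψ.e, pullForm f ψ.A, pullForm f ψ.φ⟩

/-- The variation `δ_X ψ = L_X ψ`. -/
def lie (X : P → EP) (ψ : Fields EG EP P V n) : Fields EG EP P V n :=
  ⟨lieD X ψ.e, lieD X ψ.A, lieDZero X ψ.φ⟩

/-- Equality of the derivatives up to order `r` at `p`. -/
def SameJet (r : ℕ) (p : P) (ψ₁ ψ₂ : Fields EG EP P V n) : Prop :=
  SameFormJet r p ψ₁.e ψ₂.e ∧ SameFormJet r p ψ₁.A ψ₂.A ∧ SameFormJet r p ψ₁.φ ψ₂.φ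

/-- The dynamical fields `ψ = (e, A, φ)` of the theory: non-degenerate coframes `e`, a connection
`A` and equivariant (charged) functions `φ`. -/
structure IsDynamical (B : PrincipalBundle EM EG EP M G P) (R : FieldReps EG G V n)
    (ψ : Fields EG EP P V n) : Prop where
  coframe : B.IsTensorial (fun g => R.lorentz g) ψ.e
  coframe_nondegenerate : ∀ p v, ψ.e p ![v] = 0 → B.IsVertical p v
  connection : B.IsConnection ψ.A
  charged : B.IsTensorial (fun g => R.charge g) ψ.φ

/-- The variations `δψ = (δe, δA, δφ)`: equivariant horizontal forms. -/
structure IsVariation (B : PrincipalBundle EM EG EP M G P) (R : FieldReps EG G V n)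
    (χ : Fields EG EP P V n) : Prop where
  coframe : B.IsTensorial (fun g => R.lorentz g) χ.e
  connection : B.IsTensorial adRep χ.A
  charged : B.IsTensorial (fun g => R.charge g) χ.φ

/-- Smooth one-parameter families `t ↦ Ψ t` of dynamical fields. -/
structure IsDynamicalFamily (B : PrincipalBundle EM EG EP M G P) (R : FieldReps EG G V n)
    (Ψ : ℝ → Fields EG EP P V n) : Prop where
  dynamical : ∀ t, (Ψ t).IsDynamical B R
  smooth_e : IsSmoothFormFamily fun t => (Ψ t).e
  smooth_A : IsSmoothFormFamily fun t => (Ψ t).A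
  smooth_φ : IsSmoothFormFamily fun t => (Ψ t).φ

/-- `χ = dΨ/dt` at `t = 0`. -/
structure IsFirstVariation (Ψ : ℝ → Fields EG EP P V n) (χ : Fields EG EP P V n) : Prop where
  e : ∀ p v, HasDerivAt (fun t => (Ψ t).e p v) (χ.e p v) 0
  A : ∀ p v, HasDerivAt (fun t => (Ψ t).A p v) (χ.A p v) 0
  φ : ∀ p v, HasDerivAt (fun t => (Ψ t).φ p v) (χ.φ p v) 0

end Fields

/-- Gauge-invariant, local and covariant Lagrangians: smooth functionals `ψ ↦ L[ψ] ∈ Ω^d_hor P`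
(real-valued, horizontal and invariant) of the dynamical fields, such that `L[ψ]` at `p` depends
only on the derivatives of `ψ` at `p` up to some fixed finite order, and
`f^* L[ψ] = L[f^* ψ]` for every automorphism `f` of the bundle. -/
structure IsLagrangian (B : PrincipalBundle EM EG EP M G P) (R : FieldReps EG G V n)
    (L : Fields EG EP P V n → Form EP P ℝ (n + 1)) : Prop where
  smooth : ∀ Ψ, Fields.IsDynamicalFamily B R Ψ → IsSmoothFormFamily fun t => L (Ψ t)
  horizontal : ∀ ψ, ψ.IsDynamical B R → B.IsHorizontal (L ψ)
  invariant : ∀ ψ, ψ.IsDynamical B R → B.IsEquivariant trivialRep (L ψ)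
  finite_order : ∃ r : ℕ, ∀ ψ₁ ψ₂ : Fields EG EP P V n, ψ₁.IsDynamical B R → ψ₂.IsDynamical B R →
    ∀ p, Fields.SameJet r p ψ₁ ψ₂ → L ψ₁ p = L ψ₂ p
  covariant : ∀ f, B.IsAutomorphism f → ∀ ψ, ψ.IsDynamical B R →
    pullForm f (L ψ) = L (ψ.pull f)

/-- The summed product `𝓔_α ∧ χ^α = 𝓔_a ∧ χ^a + 𝓔_I ∧ χ^I + 𝓔_A χ^A`. -/
def DualFields.wedge [FiniteDimensional ℝ EP] (E : DualFields EG EP P V n)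
    (χ : Fields EG EP P V n) : Form EP P ℝ (n + 1) :=
  wedgeOne E.e χ.e + wedgeOne E.A χ.A + wedgeZero E.φ χ.φ

/-- Horizontal equivariant forms with values in the dual representations. -/
structure DualFields.IsTensorial (B : PrincipalBundle EM EG EP M G P) (R : FieldReps EG G V n)
    (E : DualFields EG EP P V n) : Prop where
  coframe : B.IsTensorial (dualRep fun g => R.lorentz g) E.e
  connection : B.IsTensorial (dualRep adRep) E.A
  charged : B.IsTensorial (dualRep fun g => R.charge g) E.φ

/-- `θ(ψ; δψ)` is a symplectic potential for the Lagrangian `L` and the source forms `𝓔`: it is a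
smooth `(d-1)`-form which depends locally on the dynamical fields `ψ` and locally and linearly on
the variation `δψ`, and
`δL = 𝓔_α(ψ) ∧ δψ^α + dθ(ψ; δψ)`
for every smooth one-parameter family of dynamical fields through `ψ` with first variation `δψ`.
(The choice of `θ` is not unique, and it is not required to be horizontal here.) -/
structure IsSymplecticPotential [FiniteDimensional ℝ EP]
    (B : PrincipalBundle EM EG EP M G P) (R : FieldReps EG G V n)
    (L : Fields EG EP P V n → Form EP P ℝ (n + 1))
    (E : Fields EG EP P V n → DualFields EG EP P V n)
    (θ : Fields EG EP P V n → Fields EG EP P V n → Form EP P ℝ n) : Prop where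
  smooth : ∀ ψ χ, ψ.IsDynamical B R → χ.IsVariation B R → IsSmoothForm (θ ψ χ)
  linear : ∀ ψ χ₁ χ₂, ψ.IsDynamical B R → χ₁.IsVariation B R → χ₂.IsVariation B R →
    ∀ a b : ℝ, θ ψ (Fields.comb a χ₁ b χ₂) = a • θ ψ χ₁ + b • θ ψ χ₂
  finite_order : ∃ r : ℕ, ∀ ψ₁ ψ₂ χ₁ χ₂, ψ₁.IsDynamical B R → ψ₂.IsDynamical B R →
    χ₁.IsVariation B R → χ₂.IsVariation B R →
    ∀ p, Fields.SameJet r p ψ₁ ψ₂ → Fields.SameJet r p χ₁ χ₂ → θ ψ₁ χ₁ p = θ ψ₂ χ₂ p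
  variation : ∀ Ψ χ, Fields.IsDynamicalFamily B R Ψ → Fields.IsFirstVariation Ψ χ →
    ∀ p v, HasDerivAt (fun t => L (Ψ t) p v)
      (((E (Ψ 0)).wedge χ + extD (θ (Ψ 0) χ)) p v) 0

/-- `𝓔` are the equations of motion (the Euler-Lagrange forms, i.e. the functional derivatives
`δL/δψ^α`) of `L`: horizontal equivariant forms such that `δL - 𝓔_α(ψ) ∧ δψ^α` is the exterior
derivative of a local form linear in `δψ`. -/
structure IsEquationsOfMotion [FiniteDimensional ℝ EP]
    (B : PrincipalBundle EM EG EP M G P) (R : FieldReps EG G V n)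
    (L : Fields EG EP P V n → Form EP P ℝ (n + 1))
    (E : Fields EG EP P V n → DualFields EG EP P V n) : Prop where
  tensorial : ∀ ψ, ψ.IsDynamical B R → (E ψ).IsTensorial B R
  variational : ∃ θ, IsSymplecticPotential B R L E θ

/-! ## Noether current, constraints and Bianchi identities -/

/-- The Noether current `J_X = θ(ψ; L_X ψ) - X · L[ψ]`. -/
def noetherCurrent (L : Fields EG EP P V n → Form EP P ℝ (n + 1))
    (θ : Fields EG EP P V n → Fields EG EP P V n → Form EP P ℝ n)
    (ψ : Fields EG EP P V n) (X : P → EP) : Form EP P ℝ n :=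
  θ ψ (ψ.lie X) - iprod X (L ψ)

/-- The constraints
`C(X) = (-1)^(d - |α| + 1) 𝓔_α ∧ X·ψ^α = (-1)^d [𝓔_a (X·e^a) + 𝓔_I (X·A^I)]`
(the term of the function `φ`, of degree `|α| = 0`, is absent). -/
def constraints (E : DualFields EG EP P V n) (ψ : Fields EG EP P V n) (X : P → EP) :
    Form EP P ℝ n :=
  (-1 : ℝ) ^ (n + 1) • (wedgeZero E.e (iprod X ψ.e) + wedgeZero E.A (iprod X ψ.A))

/-- The Bianchi identities
`B(X) = - 𝓔_α ∧ X·dψ^α + (-1)^(d - |α|) d𝓔_α ∧ X·ψ^α`. -/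
def bianchi [FiniteDimensional ℝ EP] (E : DualFields EG EP P V n) (ψ : Fields EG EP P V n)
    (X : P → EP) : Form EP P ℝ (n + 1) :=
  -(wedgeOne E.e (iprod X (extD ψ.e)) + wedgeOne E.A (iprod X (extD ψ.A)) +
      wedgeZero E.φ (iprod X (extD ψ.φ))) +
    (-1 : ℝ) ^ n • (wedgeZero (extD E.e) (iprod X ψ.e) + wedgeZero (extD E.A) (iprod X ψ.A))

end Theory

end GaugeBianchi

end

/-!
The Bianchi identities follow from the covariance of the Lagrangian by a localized form of Noether's
second theorem.

Let `X` be the velocity of a smooth family of automorphisms `f t` with `f 0 = id`.  By covariance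
`L[f t ^* ψ] = f t ^* L[ψ]`; differentiating at `t = 0`, the variational formula on the left and
Cartan's formula on the right (`IsDeformation.hasDerivAt_pullForm`) give
`𝓔_α ∧ L_X ψ^α + dθ(ψ; L_X ψ) = X · dL + d (X · L) = d (X · L)`,
as `L[ψ]` comes from a form of top degree on the base and so is closed
(`IsLagrangian.extD_eq_zero`).  The Leibniz rule rewrites the first term as `-B(X) - dC(X)`
(`wedge_lie`), so that `d (J_X - C(X)) = B(X)` without any field equations
(`IsGenerator.extD_noetherCurrent_sub`).

Flows are not needed: only the first derivative at `t = 0` of the family `f t` enters.  In a bundle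
chart over an open set `W` of the model space, an infinitesimal automorphism multiplied by a
function `h` of the base point with compact support in `W` is the velocity of the automorphisms
`(y, g) ↦ (y + s(t) w(y), a(s(t) ξ(y)) g)`.  Here `w` and `ξ` are the components of the cut off
field along the base and along `G`, `a : 𝔤 → G` is a smooth map tangent to the identity at `0`, and
`s` is a bounded reparametrization of time which keeps the base map close to the identity, hence
invertible (`BundleChart.exists_isGenerator`).  Since `θ` is local, `J_X - C(X)` depends only on the
germ of `X`, and the identity `d (J_X - C(X)) = B(X)` extends to all infinitesimal automorphisms
(`IsSymplecticPotential.extD_noetherCurrent_sub`).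

Finally `B(X)` is pointwise linear in `X`.  Applied to the cut off field, whose current
`J - C` has compact support on the local section, Stokes' theorem shows that the integral of
`h B(X)` over the section vanishes for every test function `h`
(`IsSymplecticPotential.integral_smul_bianchi`); so `B(X)` pulls back to zero on every local
section.  Because `B(X)` is horizontal (`isHorizontal_bianchi`: both `𝓔_α ∧ L_X ψ^α` and the
differential of the invariant horizontal form `C(X)` are), it is determined by these pullbacks and
vanishes.
-/

noncomputable section

set_option linter.unusedSectionVars false

namespace GaugeBianchi

open ContinuousAlternatingMap Filter Topology MeasureTheory

/-! ### Differential forms on a vector space -/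

section Euclid

variable {E : Type*} [NormedAddCommGroup E] [NormedSpace ℝ E]
  {E' : Type*} [NormedAddCommGroup E'] [NormedSpace ℝ E']
  {D : Type*} [NormedAddCommGroup D] [NormedSpace ℝ D]
  {F : Type*} [NormedAddCommGroup F] [NormedSpace ℝ F]

variable (E F) in
/-- Currying of the first argument, as a continuous linear map. -/
def curryLeftCLM (k : ℕ) :
    (E [⋀^Fin (k + 1)]→L[ℝ] F) →L[ℝ] (E →L[ℝ] (E [⋀^Fin k]→L[ℝ] F)) :=
  (curryLeftLI (𝕜 := ℝ) (E := E) (F := F) (n := k)).toContinuousLinearMap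

@[simp]
theorem curryLeftCLM_apply {k : ℕ} (f : E [⋀^Fin (k + 1)]→L[ℝ] F) :
    curryLeftCLM E F k f = f.curryLeft := rfl

theorem _root_.ContDiffWithinAt.continuousAlternatingMap_apply {k : ℕ} {m : WithTop ℕ∞} {s : Set D}
    {x : D} {f : D → E [⋀^Fin k]→L[ℝ] F} {g : D → Fin k → E} (hf : ContDiffWithinAt ℝ m f s x)
    (hg : ∀ i, ContDiffWithinAt ℝ m (g · i) s x) :
    ContDiffWithinAt ℝ m (fun y => f y (g y)) s x := by
  induction k with
  | zero =>
    have h : (fun y => f y (g y)) = fun y => ContinuousAlternatingMap.apply ℝ E F ![] (f y) := by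
      ext y
      simp [Subsingleton.elim (g y) ![]]
    rw [h]
    exact (ContinuousAlternatingMap.apply ℝ E F ![]).contDiff.comp_contDiffWithinAt hf
  | succ k ih =>
    have h : (fun y => f y (g y)) =
        fun y => (f y).curryLeft (g y 0) (fun i => g y i.succ) := by
      ext y
      rw [curryLeft_apply_apply]
      congr 1
      ext i
      refine Fin.cases rfl (fun j => rfl) i
    rw [h]
    refine ih ?_ fun i => hg i.succ
    exact ((curryLeftCLM E F k).contDiff.comp_contDiffWithinAt hf).clm_apply (hg 0)

/-- In finite dimension, a family of alternating maps is smooth if its values on constant vectors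
are: a linear left inverse of the map to the coefficients in a basis recovers the family. -/
theorem contDiffWithinAt_alternating_iff [FiniteDimensional ℝ E] [FiniteDimensional ℝ F] {k : ℕ}
    {m : WithTop ℕ∞} {s : Set D} {x : D} {f : D → E [⋀^Fin k]→L[ℝ] F} :
    ContDiffWithinAt ℝ m f s x ↔ ∀ v, ContDiffWithinAt ℝ m (fun y => f y v) s x := by
  refine ⟨fun h v => h.continuousAlternatingMap_apply fun i => contDiffWithinAt_const, fun h => ?_⟩
  let b := Module.finBasis ℝ E
  let T : (E [⋀^Fin k]→L[ℝ] F) →ₗ[ℝ] ((Fin k → Fin (Module.finrank ℝ E)) → F) :=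
    { toFun := fun f c => f fun i => b (c i)
      map_add' := fun f g => rfl
      map_smul' := fun c f => rfl }
  have hT : Function.Injective T := fun f g h => by
    apply ContinuousAlternatingMap.toAlternatingMap_injective
    apply AlternatingMap.coe_multilinearMap_injective
    exact Module.Basis.ext_multilinear (fun _ => b) fun c => congrFun h c
  obtain ⟨S, hS⟩ := T.exists_leftInverse_of_injective (LinearMap.ker_eq_bot.2 hT)
  have h' : f = fun y => LinearMap.toContinuousLinearMap S (T (f y)) := by
    ext1 y
    exact (LinearMap.congr_fun hS (f y)).symm
  rw [h']
  refine (LinearMap.toContinuousLinearMap S).contDiff.comp_contDiffWithinAt ?_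
  rw [contDiffWithinAt_pi]
  intro c
  exact h _

theorem contDiffAt_alternating_iff [FiniteDimensional ℝ E] [FiniteDimensional ℝ F] {k : ℕ}
    {m : WithTop ℕ∞} {x : D} {f : D → E [⋀^Fin k]→L[ℝ] F} :
    ContDiffAt ℝ m f x ↔ ∀ v, ContDiffAt ℝ m (fun y => f y v) x := by
  simp only [← contDiffWithinAt_univ]
  exact contDiffWithinAt_alternating_iff

theorem _root_.ContDiffAt.continuousAlternatingMap_apply {k : ℕ} {m : WithTop ℕ∞}
    {x : D} {f : D → E [⋀^Fin k]→L[ℝ] F} {g : D → Fin k → E} (hf : ContDiffAt ℝ m f x)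
    (hg : ∀ i, ContDiffAt ℝ m (g · i) x) :
    ContDiffAt ℝ m (fun y => f y (g y)) x :=
  ContDiffWithinAt.continuousAlternatingMap_apply hf hg

theorem _root_.ContDiffAt.compContinuousLinearMap [FiniteDimensional ℝ E] [FiniteDimensional ℝ F]
    {k : ℕ} {m : WithTop ℕ∞} {x : D} {f : D → E' [⋀^Fin k]→L[ℝ] F} {A : D → E →L[ℝ] E'}
    (hf : ContDiffAt ℝ m f x) (hA : ContDiffAt ℝ m A x) :
    ContDiffAt ℝ m (fun y => (f y).compContinuousLinearMap (A y)) x := by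
  rw [contDiffAt_alternating_iff]
  intro v
  exact hf.continuousAlternatingMap_apply fun i => hA.clm_apply contDiffAt_const

theorem _root_.ContDiffAt.curryLeft_apply {k : ℕ} {m : WithTop ℕ∞} {x : D}
    {f : D → E [⋀^Fin (k + 1)]→L[ℝ] F} {X : D → E}
    (hf : ContDiffAt ℝ m f x) (hX : ContDiffAt ℝ m X x) :
    ContDiffAt ℝ m (fun y => (f y).curryLeft (X y)) x := by
  have h := ContDiffAt.comp (G := E →L[ℝ] E [⋀^Fin k]→L[ℝ] F) x
    (curryLeftCLM E F k).contDiff.contDiffAt hf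
  exact h.clm_apply hX

theorem _root_.ContDiffAt.extDeriv {k : ℕ} {x : E} {f : E → E [⋀^Fin k]→L[ℝ] F}
    (hf : ContDiffAt ℝ ∞ f x) : ContDiffAt ℝ ∞ (_root_.extDeriv f) x := by
  have h := ContDiffAt.comp x (alternatizeUncurryFinCLM (n := k) ℝ E F).contDiff.contDiffAt
    (hf.fderiv_right (m := ∞) (by simp))
  exact h

theorem extDeriv_apply_fderiv {k : ℕ} (f : E → E [⋀^Fin k]→L[ℝ] F) (x : E) (v : Fin (k + 1) → E) :
    extDeriv f x v =
      ∑ i : Fin (k + 1), (-1 : ℝ) ^ (i : ℕ) • fderiv ℝ f x (v i) (i.removeNth v) := by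
  simp [extDeriv, alternatizeUncurryFin_apply, ← Int.cast_smul_eq_zsmul ℝ]

theorem update_eq_neg_one_pow_cons {k : ℕ} (f : E [⋀^Fin (k + 1)]→L[ℝ] F) (v : Fin (k + 1) → E)
    (i : Fin (k + 1)) (w : E) :
    f (Function.update v i w) = (-1 : ℝ) ^ (i : ℕ) • f (Matrix.vecCons w (i.removeNth v)) := by
  have h := map_insertNth f i w (i.removeNth v)
  rw [Fin.insertNth_removeNth] at h
  rw [h, ← Int.cast_smul_eq_zsmul ℝ]
  simp

theorem fderiv_partial_right {g : ℝ × E → E'} {t : ℝ} {y : E} (hg : DifferentiableAt ℝ g (t, y))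
    (w : E) : fderiv ℝ (fun z => g (t, z)) y w = fderiv ℝ g (t, y) (0, w) := by
  have h : HasFDerivAt (fun z : E => ((t, z) : ℝ × E)) (ContinuousLinearMap.inr ℝ ℝ E) y :=
    (hasFDerivAt_prodMk_right t y)
  have h2 := HasFDerivAt.comp y hg.hasFDerivAt h
  rw [show (fun z => g (t, z)) = g ∘ fun z : E => ((t, z) : ℝ × E) from rfl, h2.fderiv]
  simp

theorem hasDerivAt_partial_left {g : ℝ × E → E'} {t : ℝ} {y : E}
    (hg : DifferentiableAt ℝ g (t, y)) :
    HasDerivAt (fun s => g (s, y)) (fderiv ℝ g (t, y) (1, 0)) t := by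
  have h : HasFDerivAt (fun s : ℝ => ((s, y) : ℝ × E)) (ContinuousLinearMap.inl ℝ ℝ E) t :=
    (hasFDerivAt_prodMk_left t y)
  have h2 := HasFDerivAt.comp t hg.hasFDerivAt h
  have h3 := h2.hasDerivAt
  simpa [Function.comp_def] using h3

/-- The derivative at `t = 0` of the pullback of a form by a smooth family of maps
`g t` with `g 0 = id` and velocity `X`, in terms of the derivatives of the coefficients. -/
theorem hasDerivAt_pullback_family {k : ℕ} {β : E → E [⋀^Fin k]→L[ℝ] F} {g : ℝ × E → E}
    {X : E → E} {y : E} (hβ : DifferentiableAt ℝ β y) (hg : ContDiffAt ℝ ∞ g (0, y))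
    (h0 : ∀ᶠ z in 𝓝 y, g (0, z) = z) (hX : ∀ᶠ z in 𝓝 y, X z = fderiv ℝ g (0, z) (1, 0))
    (v : Fin k → E) :
    HasDerivAt (fun t => β (g (t, y)) fun i => fderiv ℝ (fun z => g (t, z)) y (v i))
      (fderiv ℝ β y (X y) v + ∑ i, β y (Function.update v i (fderiv ℝ X y (v i)))) 0 := by
  have hg0 : g (0, y) = y := h0.self_of_nhds
  have hgd : DifferentiableAt ℝ g (0, y) := hg.differentiableAt (by simp)
  have hgd' : ∀ᶠ q in 𝓝 ((0 : ℝ), y), DifferentiableAt ℝ g q := by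
    have := hg.of_le (m := 1) (by exact_mod_cast le_top)
    filter_upwards [this.eventually (by simp)] with q hq
    exact hq.differentiableAt (by simp)
  have hDg : DifferentiableAt ℝ (fderiv ℝ g) (0, y) :=
    (hg.fderiv_right (m := ∞) (by simp)).differentiableAt (by simp)
  have hsym : ∀ a b, fderiv ℝ (fderiv ℝ g) (0, y) a b = fderiv ℝ (fderiv ℝ g) (0, y) b a :=
    fun a b => (hg.isSymmSndFDerivAt (by
      rw [minSmoothness_of_isRCLikeNormedField]; exact WithTop.coe_le_coe.2 le_top)).eq a b
  have ht : Tendsto (fun t : ℝ => (t, y)) (𝓝 0) (𝓝 ((0 : ℝ), y)) :=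
    Continuous.tendsto' (by fun_prop) _ _ rfl
  have hz : Tendsto (fun z : E => ((0 : ℝ), z)) (𝓝 y) (𝓝 ((0 : ℝ), y)) :=
    Continuous.tendsto' (by fun_prop) _ _ rfl
  -- the derivative of the velocity field is a mixed second derivative of the family
  have hXd : ∀ w, fderiv ℝ X y w = fderiv ℝ (fderiv ℝ g) (0, y) (1, 0) (0, w) := by
    intro w
    have h1 : HasFDerivAt (fun z : E => fderiv ℝ g (0, z))
        ((fderiv ℝ (fderiv ℝ g) (0, y)).comp (ContinuousLinearMap.inr ℝ ℝ E)) y :=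
      HasFDerivAt.comp y hDg.hasFDerivAt (hasFDerivAt_prodMk_right 0 y)
    have h2 := h1.clm_apply (hasFDerivAt_const ((1 : ℝ), (0 : E)) y)
    rw [Filter.EventuallyEq.fderiv_eq hX, h2.fderiv]
    simp [hsym (0, w) (1, 0)]
  have hβg : HasDerivAt (fun t => β (g (t, y))) (fderiv ℝ β y (X y)) 0 := by
    rw [hX.self_of_nhds]
    have h1 := hasDerivAt_partial_left hgd
    have h2 : HasFDerivAt β (fderiv ℝ β y) (g (0, y)) := by rw [hg0]; exact hβ.hasFDerivAt
    exact h2.comp_hasDerivAt (0 : ℝ) h1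
  have hA : ∀ i, HasDerivAt (fun t => fderiv ℝ (fun z => g (t, z)) y (v i))
      (fderiv ℝ X y (v i)) 0 := by
    intro i
    have h1 : HasDerivAt (fun t : ℝ => fderiv ℝ g (t, y))
        (fderiv ℝ (fderiv ℝ g) (0, y) (1, 0)) 0 := hasDerivAt_partial_left hDg
    have h2 := h1.clm_apply (hasDerivAt_const (0 : ℝ) ((0 : ℝ), v i))
    rw [hXd]
    simp only [_root_.map_zero, add_zero] at h2
    refine h2.congr_of_eventuallyEq ?_
    filter_upwards [ht.eventually hgd'] with t h
    exact fderiv_partial_right h _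
  have hA0 : ∀ w, fderiv ℝ (fun z => g (0, z)) y w = w := by
    intro w
    have : (fun z => g (0, z)) =ᶠ[𝓝 y] id := h0
    rw [this.fderiv_eq]
    simp
  have h := HasFDerivAt.continuousAlternatingMap_apply
    (g := fun i t => fderiv ℝ (fun z => g (t, z)) y (v i))
    hβg.hasFDerivAt fun i => (hA i).hasFDerivAt
  have h' := h.hasDerivAt
  refine h'.congr_deriv ?_
  simp [hA0, hg0]

/-- **Cartan's formula** on a vector space: the derivative at `t = 0` of the pullback of a form by
a smooth family of maps `g t` with `g 0 = id` and velocity `X`. -/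
theorem hasDerivAt_pullback_family_cartan {k : ℕ} {β : E → E [⋀^Fin (k + 1)]→L[ℝ] F}
    {g : ℝ × E → E} {X : E → E} {y : E} (hβ : DifferentiableAt ℝ β y)
    (hg : ContDiffAt ℝ ∞ g (0, y)) (h0 : ∀ᶠ z in 𝓝 y, g (0, z) = z)
    (hXd : DifferentiableAt ℝ X y)
    (hX : ∀ᶠ z in 𝓝 y, X z = fderiv ℝ g (0, z) (1, 0)) (v : Fin (k + 1) → E) :
    HasDerivAt (fun t => β (g (t, y)) fun i => fderiv ℝ (fun z => g (t, z)) y (v i))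
      ((extDeriv β y).curryLeft (X y) v + extDeriv (fun z => (β z).curryLeft (X z)) y v) 0 := by
  refine (hasDerivAt_pullback_family hβ hg h0 hX v).congr_deriv ?_
  have hc : HasFDerivAt (fun z => (β z).curryLeft)
      ((curryLeftCLM E F k).comp (fderiv ℝ β y)) y := by
    have h := HasFDerivAt.comp (G := E →L[ℝ] E [⋀^Fin k]→L[ℝ] F) y
      (curryLeftCLM E F k).hasFDerivAt hβ.hasFDerivAt
    exact h
  have hd := hc.clm_apply hXd.hasFDerivAt
  rw [curryLeft_apply_apply, extDeriv_apply_fderiv, extDeriv_apply_fderiv, hd.fderiv,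
    Fin.sum_univ_succ (n := k + 1)]
  have h1 : ∀ i : Fin (k + 1), (i.succ.removeNth (Matrix.vecCons (X y) v) : Fin (k + 1) → E) =
      Matrix.vecCons (X y) (i.removeNth v) := by
    intro i
    ext j
    refine Fin.cases ?_ (fun j => ?_) j
    · simp [Fin.removeNth]
    · simp [Fin.removeNth]
  have h2 : (Fin.removeNth 0 (Matrix.vecCons (X y) v) : Fin (k + 1) → E) = v := by
    ext j
    simp [Fin.removeNth]
  simp only [h1, h2]
  simp [update_eq_neg_one_pow_cons, Finset.sum_add_distrib, pow_succ]
  abel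

/-- **Stokes' theorem** for compactly supported forms on a vector space: the exterior derivative of
a form of any degree integrates to zero, coefficient by coefficient. -/
theorem integral_extDeriv_eq_zero [FiniteDimensional ℝ E] [MeasurableSpace E] [BorelSpace E]
    {μ : Measure E} [μ.IsAddHaarMeasure] {k : ℕ} {β : E → E [⋀^Fin k]→L[ℝ] ℝ}
    (hβ : ContDiff ℝ ∞ β) (hc : HasCompactSupport β) (v : Fin (k + 1) → E) :
    ∫ y, extDeriv β y v ∂μ = 0 := by
  have hcd : HasCompactSupport (fderiv ℝ β) := hc.fderiv ℝ
  have hcont : Continuous (fderiv ℝ β) := hβ.continuous_fderiv (by simp)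
  have hint : ∀ i : Fin (k + 1), Integrable (fun y => fderiv ℝ β y (v i) (i.removeNth v)) μ := by
    intro i
    refine Continuous.integrable_of_hasCompactSupport ?_ ?_
    · exact (ContinuousAlternatingMap.apply ℝ E ℝ (i.removeNth v)).continuous.comp
        (hcont.clm_apply continuous_const)
    · refine hcd.mono fun y hy => ?_
      contrapose! hy
      simp only [Function.mem_support, not_not] at hy ⊢
      simp [hy]
  simp only [extDeriv_apply_fderiv, smul_eq_mul]
  rw [integral_finsetSum _ fun i _ => (hint i).const_mul _]
  refine Finset.sum_eq_zero fun i _ => ?_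
  rw [integral_const_mul]
  -- integration by parts against the constant function `1`
  have key := integral_bilinear_hasLineDerivAt_right_eq_neg_left_of_integrable (μ := μ)
    (f := fun _ : E => (1 : ℝ)) (f' := fun _ => 0) (g := fun y => β y (i.removeNth v))
    (g' := fun y => fderiv ℝ β y (v i) (i.removeNth v)) (v := v i)
    (B := ContinuousLinearMap.mul ℝ ℝ) (by simp) (by simpa using hint i) ?_ ?_ ?_
  · simp only [ContinuousLinearMap.mul_apply', one_mul, zero_mul, integral_zero, neg_zero] at key
    rw [key, mul_zero]
  · simp only [ContinuousLinearMap.mul_apply', one_mul]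
    refine Continuous.integrable_of_hasCompactSupport ?_ ?_
    · exact (ContinuousAlternatingMap.apply ℝ E ℝ (i.removeNth v)).continuous.comp hβ.continuous
    · refine hc.mono fun y hy => ?_
      contrapose! hy
      simp only [Function.mem_support, not_not] at hy ⊢
      simp [hy]
  · intro x _
    exact (hasFDerivAt_const (1 : ℝ) x).hasLineDerivAt (v i)
  · intro x _
    have h1 := (hβ.differentiable (by simp) x).hasFDerivAt.continuousAlternatingMap_apply_const
      (i.removeNth v)
    exact h1.hasLineDerivAt (v i)

end Euclid

/-! ### Forms on a manifold in charts -/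

section TangentMaps

variable {EP : Type*} [NormedAddCommGroup EP] [NormedSpace ℝ EP]
  {P : Type*} [TopologicalSpace P] [ChartedSpace EP P]
  {EN : Type*} [NormedAddCommGroup EN] [NormedSpace ℝ EN]
  {N : Type*} [TopologicalSpace N] [ChartedSpace EN N]
  {EQ : Type*} [NormedAddCommGroup EQ] [NormedSpace ℝ EQ]
  {Q : Type*} [TopologicalSpace Q] [ChartedSpace EQ Q]
  {E E' : Type*} [NormedAddCommGroup E] [NormedSpace ℝ E]
  [NormedAddCommGroup E'] [NormedSpace ℝ E']

theorem tanMap_comp {g : N → Q} {f : P → N} {p : P}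
    (hg : MDifferentiableAt 𝓘(ℝ, EN) 𝓘(ℝ, EQ) g (f p))
    (hf : MDifferentiableAt 𝓘(ℝ, EP) 𝓘(ℝ, EN) f p) :
    tanMap (EP := EP) (EN := EQ) (g ∘ f) p =
      (tanMap (EP := EN) (EN := EQ) g (f p)).comp (tanMap f p) :=
  mfderiv_comp p hg hf

theorem tanMap_comp_apply {g : N → Q} {f : P → N} {p : P}
    (hg : MDifferentiableAt 𝓘(ℝ, EN) 𝓘(ℝ, EQ) g (f p))
    (hf : MDifferentiableAt 𝓘(ℝ, EP) 𝓘(ℝ, EN) f p) (v : EP) :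
    tanMap (EP := EP) (EN := EQ) (fun q => g (f q)) p v =
      tanMap (EP := EN) (EN := EQ) g (f p) (tanMap (EP := EP) (EN := EN) f p v) :=
  congrArg (fun A : EP →L[ℝ] EQ => A v) (tanMap_comp hg hf)

theorem tanMap_congr {f g : P → N} {p : P} (h : f =ᶠ[𝓝 p] g) :
    (tanMap f p : EP →L[ℝ] EN) = tanMap g p :=
  h.mfderiv_eq

theorem tanMap_eq_fderiv (f : E → E') (x : E) : (tanMap f x : E →L[ℝ] E') = fderiv ℝ f x :=
  mfderiv_eq_fderiv

theorem tanMap_id (p : P) : (tanMap (fun q : P => q) p : EP →L[ℝ] EP) = .id ℝ EP :=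
  mfderiv_id

theorem tanMap_const (p : P) (y : N) : (tanMap (fun _ : P => y) p : EP →L[ℝ] EN) = 0 :=
  mfderiv_const

theorem tanMap_extChartAt_self [IsManifold 𝓘(ℝ, EP) ∞ P] (p : P) :
    (tanMap (extChartAt 𝓘(ℝ, EP) p) p : EP →L[ℝ] EP) = .id ℝ EP := by
  have h := mfderiv_extChartAt_self (I := 𝓘(ℝ, EP)) (x := p)
  exact h

variable [IsManifold 𝓘(ℝ, EP) ∞ P]

theorem mdifferentiableAt_extChartAt' {x p : P} (h : p ∈ (chartAt EP x).source) :
    MDifferentiableAt 𝓘(ℝ, EP) 𝓘(ℝ, EP) (extChartAt 𝓘(ℝ, EP) x) p :=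
  (contMDiffAt_extChartAt' (n := ∞) h).mdifferentiableAt (by simp)

theorem contMDiffAt_extChartAt_symm {x : P} {y : EP} (h : y ∈ (extChartAt 𝓘(ℝ, EP) x).target) :
    ContMDiffAt 𝓘(ℝ, EP) 𝓘(ℝ, EP) ∞ (extChartAt 𝓘(ℝ, EP) x).symm y :=
  (contMDiffOn_extChartAt_symm x).contMDiffAt ((isOpen_extChartAt_target x).mem_nhds h)

theorem mdifferentiableAt_extChartAt_symm {x : P} {y : EP}
    (h : y ∈ (extChartAt 𝓘(ℝ, EP) x).target) :
    MDifferentiableAt 𝓘(ℝ, EP) 𝓘(ℝ, EP) (extChartAt 𝓘(ℝ, EP) x).symm y :=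
  (contMDiffAt_extChartAt_symm h).mdifferentiableAt (by simp)

theorem extChartAt_symm_mem_source {x : P} {y : EP} (h : y ∈ (extChartAt 𝓘(ℝ, EP) x).target) :
    (extChartAt 𝓘(ℝ, EP) x).symm y ∈ (chartAt EP x).source := by
  have := (extChartAt 𝓘(ℝ, EP) x).map_target h
  rwa [extChartAt_source] at this

theorem extChartAt_mem_target {x p : P} (h : p ∈ (chartAt EP x).source) :
    extChartAt 𝓘(ℝ, EP) x p ∈ (extChartAt 𝓘(ℝ, EP) x).target :=
  (extChartAt 𝓘(ℝ, EP) x).map_source (by rwa [extChartAt_source])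

theorem extChartAt_symm_apply_apply {x p : P} (h : p ∈ (chartAt EP x).source) :
    (extChartAt 𝓘(ℝ, EP) x).symm (extChartAt 𝓘(ℝ, EP) x p) = p :=
  (extChartAt 𝓘(ℝ, EP) x).left_inv (by rwa [extChartAt_source])

theorem tanMap_extChartAt_symm_comp {x p : P} (h : p ∈ (chartAt EP x).source) (v : EP) :
    tanMap (EP := EP) (EN := EP) (extChartAt 𝓘(ℝ, EP) x).symm (extChartAt 𝓘(ℝ, EP) x p)
      (tanMap (EP := EP) (EN := EP) (extChartAt 𝓘(ℝ, EP) x) p v) = v := by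
  rw [← tanMap_comp_apply (mdifferentiableAt_extChartAt_symm (extChartAt_mem_target h))
    (mdifferentiableAt_extChartAt' h)]
  have : (fun q => (extChartAt 𝓘(ℝ, EP) x).symm (extChartAt 𝓘(ℝ, EP) x q)) =ᶠ[𝓝 p] fun q => q := by
    filter_upwards [(chartAt EP x).open_source.mem_nhds h] with q hq
    exact extChartAt_symm_apply_apply hq
  rw [tanMap_congr this, tanMap_id]
  rfl

end TangentMaps

section Pullback

variable {EP : Type*} [NormedAddCommGroup EP] [NormedSpace ℝ EP]
  {P : Type*} [TopologicalSpace P] [ChartedSpace EP P] [IsManifold 𝓘(ℝ, EP) ∞ P]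
  {E : Type*} [NormedAddCommGroup E] [NormedSpace ℝ E]
  {D : Type*} [NormedAddCommGroup D] [NormedSpace ℝ D]
  {F : Type*} [NormedAddCommGroup F] [NormedSpace ℝ F]

/-- The pullback of a form on a manifold by a map from a normed space. -/
def pullE {k : ℕ} (S : E → P) (α : Form EP P F k) (y : E) : E [⋀^Fin k]→L[ℝ] F :=
  (α (S y)).compContinuousLinearMap (tanMap S y)

theorem pullE_apply {k : ℕ} (S : E → P) (α : Form EP P F k) (y : E) (v : Fin k → E) :
    pullE S α y v = α (S y) (fun i => tanMap (EP := E) (EN := EP) S y (v i)) := rfl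

theorem chartRep_eq_pullE {k : ℕ} (x : P) (α : Form EP P F k) :
    chartRep x α = pullE (extChartAt 𝓘(ℝ, EP) x).symm α := rfl

theorem pullE_eq_chartRep {k : ℕ} (α : Form EP P F k) {x : P} {S : E → P} {y : E}
    (hS : MDifferentiableAt 𝓘(ℝ, E) 𝓘(ℝ, EP) S y) (hy : S y ∈ (chartAt EP x).source) :
    pullE S α y = (chartRep x α (extChartAt 𝓘(ℝ, EP) x (S y))).compContinuousLinearMap
      (fderiv ℝ (fun z => extChartAt 𝓘(ℝ, EP) x (S z)) y) := by
  ext v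
  rw [compContinuousLinearMap_apply, chartRep_eq_pullE, pullE_apply, pullE_apply,
    extChartAt_symm_apply_apply hy]
  congr 1
  ext i
  rw [← tanMap_eq_fderiv, Function.comp_apply,
    tanMap_comp_apply (mdifferentiableAt_extChartAt' hy) hS, tanMap_extChartAt_symm_comp hy]

theorem IsSmoothForm.contDiffAt {k : ℕ} {α : Form EP P F k} (hα : IsSmoothForm α) {x : P} {y : EP}
    (hy : y ∈ (extChartAt 𝓘(ℝ, EP) x).target) : ContDiffAt ℝ ∞ (chartRep x α) y :=
  (hα x).contDiffAt ((isOpen_extChartAt_target x).mem_nhds hy)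

theorem isSmoothForm_iff {k : ℕ} {α : Form EP P F k} :
    IsSmoothForm α ↔ ∀ x : P, ∀ y ∈ (extChartAt 𝓘(ℝ, EP) x).target,
      ContDiffAt ℝ ∞ (chartRep x α) y :=
  ⟨fun h _ _ hy => h.contDiffAt hy, fun h x y hy => (h x y hy).contDiffWithinAt⟩

theorem eventually_mdifferentiableAt {S : E → P} {y : E}
    (hS : ContMDiffAt 𝓘(ℝ, E) 𝓘(ℝ, EP) ∞ S y) :
    ∀ᶠ z in 𝓝 y, MDifferentiableAt 𝓘(ℝ, E) 𝓘(ℝ, EP) S z := by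
  have h1 : ContMDiffAt 𝓘(ℝ, E) 𝓘(ℝ, EP) 1 S y := hS.of_le (by exact_mod_cast le_top)
  filter_upwards [contMDiffAt_iff_contMDiffAt_nhds (by simp) |>.1 h1] with z hz
  exact hz.mdifferentiableAt (by simp)

theorem contDiffAt_extChartAt_comp {S : E → P} {y : E} {x : P}
    (hS : ContMDiffAt 𝓘(ℝ, E) 𝓘(ℝ, EP) ∞ S y) (hy : S y ∈ (chartAt EP x).source) :
    ContDiffAt ℝ ∞ (fun z => extChartAt 𝓘(ℝ, EP) x (S z)) y :=
  ((contMDiffAt_extChartAt' hy).comp y hS).contDiffAt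

/-- Near `y`, the pullback of a form by a smooth map is the Euclidean pullback of its expression
in any chart around the image of `y`. -/
theorem pullE_eventuallyEq {k : ℕ} (α : Form EP P F k) {x : P} {S : E → P} {y : E}
    (hS : ContMDiffAt 𝓘(ℝ, E) 𝓘(ℝ, EP) ∞ S y) (hy : S y ∈ (chartAt EP x).source) :
    pullE S α =ᶠ[𝓝 y] fun z =>
      (chartRep x α (extChartAt 𝓘(ℝ, EP) x (S z))).compContinuousLinearMap
        (fderiv ℝ (fun z => extChartAt 𝓘(ℝ, EP) x (S z)) z) := by
  filter_upwards [eventually_mdifferentiableAt hS,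
    hS.continuousAt.preimage_mem_nhds ((chartAt EP x).open_source.mem_nhds hy)] with z h1 h2
  exact pullE_eq_chartRep α h1 h2

/-- The exterior derivative commutes with pullback. -/
theorem extDeriv_pullE {k : ℕ} {α : Form EP P F k} (hα : IsSmoothForm α) {S : E → P} {y : E}
    (hS : ContMDiffAt 𝓘(ℝ, E) 𝓘(ℝ, EP) ∞ S y) :
    extDeriv (pullE S α) y = pullE S (extD α) y := by
  have hy : S y ∈ (chartAt EP (S y)).source := mem_chart_source EP (S y)
  have hc := contDiffAt_extChartAt_comp hS hy
  rw [(pullE_eventuallyEq α hS hy).extDeriv_eq,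
    extDeriv_pullback (f := fun z => extChartAt 𝓘(ℝ, EP) (S y) (S z))
      ((hα.contDiffAt (extChartAt_mem_target hy)).differentiableAt (by simp)) hc
      (by rw [minSmoothness_of_isRCLikeNormedField]; exact WithTop.coe_le_coe.2 le_top)]
  ext v
  rw [compContinuousLinearMap_apply, pullE_apply]
  unfold extD
  rw [compContinuousLinearMap_apply]
  congr 1
  ext i
  rw [← tanMap_eq_fderiv, Function.comp_apply, Function.comp_apply,
    tanMap_comp_apply (mdifferentiableAt_extChartAt' hy) (hS.mdifferentiableAt (by simp))]

theorem chartRep_extD {k : ℕ} {α : Form EP P F k} (hα : IsSmoothForm α) {x : P} {y : EP}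
    (hy : y ∈ (extChartAt 𝓘(ℝ, EP) x).target) :
    chartRep x (extD α) y = extDeriv (chartRep x α) y := by
  rw [chartRep_eq_pullE, chartRep_eq_pullE, extDeriv_pullE hα (contMDiffAt_extChartAt_symm hy)]

theorem IsSmoothForm.extD {k : ℕ} {α : Form EP P F k} (hα : IsSmoothForm α) :
    IsSmoothForm (extD α) := by
  rw [isSmoothForm_iff]
  intro x y hy
  refine (hα.contDiffAt hy).extDeriv.congr_of_eventuallyEq ?_
  filter_upwards [(isOpen_extChartAt_target x).mem_nhds hy] with z hz
  exact chartRep_extD hα hz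

/-- The exterior derivative at `x` in the preferred chart around `x`, whose tangent map at `x` is
the identity. -/
theorem extD_apply {k : ℕ} (α : Form EP P F k) (x : P) :
    extD α x = extDeriv (chartRep x α) (extChartAt 𝓘(ℝ, EP) x x) := by
  ext v
  unfold extD
  rw [tanMap_extChartAt_self]
  rfl

theorem chartRep_self {k : ℕ} (α : Form EP P F k) (x : P) :
    chartRep x α (extChartAt 𝓘(ℝ, EP) x x) = α x := by
  have hx := mem_chart_source EP x
  ext v
  have h := fun w => tanMap_extChartAt_symm_comp hx w
  rw [tanMap_extChartAt_self] at h
  rw [chartRep_eq_pullE, pullE_apply, extChartAt_symm_apply_apply hx]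
  congr 1
  ext i
  exact h (v i)

theorem chartRep_congr {k : ℕ} {α α' : Form EP P F k} {x : P} (h : α =ᶠ[𝓝 x] α') :
    chartRep x α =ᶠ[𝓝 (extChartAt 𝓘(ℝ, EP) x x)] chartRep x α' := by
  have hc : ContinuousAt (extChartAt 𝓘(ℝ, EP) x).symm (extChartAt 𝓘(ℝ, EP) x x) :=
    continuousAt_extChartAt_symm x
  have h' : ∀ᶠ q in 𝓝 ((extChartAt 𝓘(ℝ, EP) x).symm (extChartAt 𝓘(ℝ, EP) x x)), α q = α' q := by
    rwa [extChartAt_to_inv]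
  filter_upwards [hc.eventually h'] with y hy
  unfold chartRep
  rw [hy]

theorem extD_congr {k : ℕ} {α α' : Form EP P F k} {x : P} (h : α =ᶠ[𝓝 x] α') :
    extD α x = extD α' x := by
  unfold extD
  rw [(chartRep_congr h).extDeriv_eq]

theorem sameFormJet_of_eventuallyEq {k : ℕ} {α α' : Form EP P F k} {x : P} (h : α =ᶠ[𝓝 x] α')
    (r : ℕ) : SameFormJet r x α α' :=
  fun i _ => ((chartRep_congr h).iteratedFDeriv ℝ i).self_of_nhds

section Param

variable [FiniteDimensional ℝ E] [FiniteDimensional ℝ F]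

/-- Pullbacks of a smooth form by a smooth family of maps depend smoothly on the parameter. -/
theorem contDiffAt_pullE_family {k : ℕ} {α : Form EP P F k} (hα : IsSmoothForm α)
    {S : ℝ × E → P} {q : ℝ × E} (hS : ContMDiffAt 𝓘(ℝ, ℝ × E) 𝓘(ℝ, EP) ∞ S q) :
    ContDiffAt ℝ ∞ (fun q : ℝ × E => pullE (fun z => S (q.1, z)) α q.2) q := by
  have hy : S q ∈ (chartAt EP (S q)).source := mem_chart_source EP (S q)
  have hc := contDiffAt_extChartAt_comp hS hy
  have h1 : ContDiffAt ℝ ∞ (fun r : ℝ × E =>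
      (chartRep (S q) α (extChartAt 𝓘(ℝ, EP) (S q) (S r))).compContinuousLinearMap
        ((fderiv ℝ (fun z => extChartAt 𝓘(ℝ, EP) (S q) (S z)) r).comp
          (ContinuousLinearMap.inr ℝ ℝ E))) q := by
    refine ContDiffAt.compContinuousLinearMap ?_ ?_
    · exact (hα.contDiffAt (extChartAt_mem_target hy)).comp q hc
    · exact (hc.fderiv_right (m := ∞) (by simp)).clm_comp contDiffAt_const
  refine h1.congr_of_eventuallyEq ?_
  filter_upwards [eventually_mdifferentiableAt hS,
    hS.continuousAt.preimage_mem_nhds ((chartAt EP (S q)).open_source.mem_nhds hy)] with r h2 h3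
  have hi : MDifferentiableAt 𝓘(ℝ, E) 𝓘(ℝ, ℝ × E) (fun z : E => (r.1, z)) r.2 :=
    DifferentiableAt.mdifferentiableAt (by fun_prop)
  have h4 : MDifferentiableAt 𝓘(ℝ, E) 𝓘(ℝ, EP) (fun z => S (r.1, z)) r.2 :=
    MDifferentiableAt.comp (I' := 𝓘(ℝ, ℝ × E)) r.2 h2 hi
  rw [pullE_eq_chartRep (x := S q) α h4 h3]
  congr 1
  ext w
  have h5 : DifferentiableAt ℝ (fun z => extChartAt 𝓘(ℝ, EP) (S q) (S z)) (r.1, r.2) :=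
    ((mdifferentiableAt_extChartAt' h3).comp r h2).differentiableAt
  exact fderiv_partial_right h5 w

theorem contDiffAt_pullE {k : ℕ} {α : Form EP P F k} (hα : IsSmoothForm α)
    {S : E → P} {y : E} (hS : ContMDiffAt 𝓘(ℝ, E) 𝓘(ℝ, EP) ∞ S y) :
    ContDiffAt ℝ ∞ (pullE S α) y := by
  have h1 : ContMDiffAt 𝓘(ℝ, ℝ × E) 𝓘(ℝ, EP) ∞ (fun q : ℝ × E => S q.2) ((0 : ℝ), y) :=
    ContMDiffAt.comp (I' := 𝓘(ℝ, E)) ((0 : ℝ), y) (g := S) hS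
      contDiff_snd.contDiffAt.contMDiffAt
  exact (contDiffAt_pullE_family hα h1).comp y (contDiffAt_const.prodMk contDiffAt_id)

end Param

end Pullback

/-! ### Vector fields, interior products and the Leibniz rule -/

section VectorFields

variable {EP : Type*} [NormedAddCommGroup EP] [NormedSpace ℝ EP]
  {P : Type*} [TopologicalSpace P] [ChartedSpace EP P] [IsManifold 𝓘(ℝ, EP) ∞ P]
  {E : Type*} [NormedAddCommGroup E] [NormedSpace ℝ E]
  {E' : Type*} [NormedAddCommGroup E'] [NormedSpace ℝ E']
  {F : Type*} [NormedAddCommGroup F] [NormedSpace ℝ F]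

/-- The expression of a vector field in the preferred chart around `x`. -/
def chartVec (x : P) (X : P → EP) (y : EP) : EP :=
  tanMap (EP := EP) (EN := EP) (extChartAt 𝓘(ℝ, EP) x) ((extChartAt 𝓘(ℝ, EP) x).symm y)
    (X ((extChartAt 𝓘(ℝ, EP) x).symm y))

/-- Smoothness of a vector field, in terms of its expressions in charts. -/
def IsSmoothVec (X : P → EP) : Prop :=
  ∀ (x : P), ∀ y ∈ (extChartAt 𝓘(ℝ, EP) x).target, ContDiffAt ℝ ∞ (chartVec x X) y

theorem isSmoothVec_of_contMDiff {X : P → EP}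
    (hX : ContMDiff 𝓘(ℝ, EP) 𝓘(ℝ, EP).tangent ∞
      (fun p => (⟨p, X p⟩ : TangentBundle 𝓘(ℝ, EP) P))) : IsSmoothVec X := by
  intro x y hy
  set q := (extChartAt 𝓘(ℝ, EP) x).symm y with hq
  have hqs : q ∈ (chartAt EP x).source := extChartAt_symm_mem_source hy
  let e : Bundle.Trivialization EP (Bundle.TotalSpace.proj (F := EP)
    (E := (TangentSpace 𝓘(ℝ, EP) : P → Type _))) := trivializationAt EP _ x
  have hqe : q ∈ e.baseSet := by simpa [e] using hqs
  have h1 := (Bundle.Trivialization.contMDiffAt_section_iff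
    (E := (TangentSpace 𝓘(ℝ, EP) : P → Type _)) (IB := 𝓘(ℝ, EP)) (n := ∞) (e := e)
    (s := fun p => (X p : TangentSpace 𝓘(ℝ, EP) p)) hqe).1 (hX q)
  have h2 : ContMDiffAt 𝓘(ℝ, EP) 𝓘(ℝ, EP) ∞ (fun z =>
      (e ⟨(extChartAt 𝓘(ℝ, EP) x).symm z, X ((extChartAt 𝓘(ℝ, EP) x).symm z)⟩).2) y :=
    ContMDiffAt.comp (g := fun q => (e ⟨q, X q⟩).2) y h1 (contMDiffAt_extChartAt_symm hy)
  refine h2.contDiffAt.congr_of_eventuallyEq ?_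
  filter_upwards [(isOpen_extChartAt_target x).mem_nhds hy] with z hz
  have hz' := extChartAt_symm_mem_source hz
  -- the trivialization of the tangent bundle over a chart domain is the tangent map of the chart
  have h3 := TangentBundle.continuousLinearMapAt_trivializationAt (I := 𝓘(ℝ, EP)) hz'
  have hze : (extChartAt 𝓘(ℝ, EP) x).symm z ∈ e.baseSet := by simpa [e] using hz'
  unfold chartVec tanMap
  rw [← h3]
  exact e.continuousLinearMapAt_apply_of_mem ℝ hze _

theorem chartVec_apply {X : P → EP} {x p : P} (hp : p ∈ (chartAt EP x).source) :
    chartVec x X (extChartAt 𝓘(ℝ, EP) x p) =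
      tanMap (EP := EP) (EN := EP) (extChartAt 𝓘(ℝ, EP) x) p (X p) := by
  unfold chartVec
  rw [extChartAt_symm_apply_apply hp]

theorem chartVec_self (X : P → EP) (x : P) : chartVec x X (extChartAt 𝓘(ℝ, EP) x x) = X x := by
  rw [chartVec_apply (mem_chart_source EP x), tanMap_extChartAt_self]
  rfl

/-- The derivative of a smooth map along a smooth vector field is smooth. -/
theorem contDiffAt_tanMap_vec {X : P → EP} (hX : IsSmoothVec X) {u : P → E'} {S : E → P} {y : E}
    (hS : ContMDiffAt 𝓘(ℝ, E) 𝓘(ℝ, EP) ∞ S y) (hu : ContMDiffAt 𝓘(ℝ, EP) 𝓘(ℝ, E') ∞ u (S y)) :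
    ContDiffAt ℝ ∞ (fun z => tanMap (EP := EP) (EN := E') u (S z) (X (S z))) y := by
  set x := S y with hx
  have hxs : S y ∈ (chartAt EP x).source := mem_chart_source EP x
  have hc := contDiffAt_extChartAt_comp hS hxs
  have hu' : ContDiffAt ℝ ∞ (fun z => u ((extChartAt 𝓘(ℝ, EP) x).symm z))
      (extChartAt 𝓘(ℝ, EP) x (S y)) := by
    refine ContMDiffAt.contDiffAt (ContMDiffAt.comp (I' := 𝓘(ℝ, EP)) _ ?_
      (contMDiffAt_extChartAt_symm (extChartAt_mem_target hxs)))
    rwa [extChartAt_symm_apply_apply hxs]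
  have h1 : ContDiffAt ℝ ∞ (fun z => fderiv ℝ (fun z => u ((extChartAt 𝓘(ℝ, EP) x).symm z))
      (extChartAt 𝓘(ℝ, EP) x (S z)) (chartVec x X (extChartAt 𝓘(ℝ, EP) x (S z)))) y := by
    refine ContDiffAt.clm_apply ?_ ?_
    · exact ContDiffAt.comp y (hu'.fderiv_right (m := ∞) (by simp)) hc
    · exact ContDiffAt.comp y (hX x _ (extChartAt_mem_target hxs)) hc
  refine h1.congr_of_eventuallyEq ?_
  have hu1 : ContMDiffAt 𝓘(ℝ, EP) 𝓘(ℝ, E') 1 u (S y) := hu.of_le (by exact_mod_cast le_top)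
  filter_upwards [hS.continuousAt.preimage_mem_nhds ((chartAt EP x).open_source.mem_nhds hxs),
    hS.continuousAt.eventually (contMDiffAt_iff_contMDiffAt_nhds (by simp) |>.1 hu1)] with z h2 h3
  rw [chartVec_apply h2, ← tanMap_eq_fderiv,
    tanMap_comp_apply (g := u) (by
      rw [extChartAt_symm_apply_apply h2]; exact h3.mdifferentiableAt (by simp))
      (mdifferentiableAt_extChartAt_symm (extChartAt_mem_target h2)),
    tanMap_extChartAt_symm_comp h2, extChartAt_symm_apply_apply h2]

theorem chartRep_iprod {k : ℕ} (X : P → EP) (α : Form EP P F (k + 1)) {x : P} {y : EP}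
    (hy : y ∈ (extChartAt 𝓘(ℝ, EP) x).target) :
    chartRep x (iprod X α) y = (chartRep x α y).curryLeft (chartVec x X y) := by
  ext v
  have h := tanMap_extChartAt_symm_comp (extChartAt_symm_mem_source hy)
    (X ((extChartAt 𝓘(ℝ, EP) x).symm y))
  rw [(extChartAt 𝓘(ℝ, EP) x).right_inv hy] at h
  rw [curryLeft_apply_apply, chartRep_eq_pullE, chartRep_eq_pullE, pullE_apply, pullE_apply]
  unfold iprod
  rw [curryLeft_apply_apply]
  congr 1
  ext i
  refine Fin.cases ?_ (fun j => ?_) i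
  · exact h.symm
  · rfl

theorem chartRep_iprod_eventuallyEq {k : ℕ} (X : P → EP) (α : Form EP P F (k + 1)) {x : P} {y : EP}
    (hy : y ∈ (extChartAt 𝓘(ℝ, EP) x).target) :
    chartRep x (iprod X α) =ᶠ[𝓝 y] fun y => (chartRep x α y).curryLeft (chartVec x X y) := by
  filter_upwards [(isOpen_extChartAt_target x).mem_nhds hy] with z hz
  exact chartRep_iprod X α hz

section Algebra

variable {k : ℕ} {α α' : Form EP P F k}

theorem chartRep_add (x : P) : chartRep x (α + α') = chartRep x α + chartRep x α' := rfl

theorem chartRep_smul (c : ℝ) (x : P) : chartRep x (c • α) = c • chartRep x α := rfl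

theorem IsSmoothForm.add (h : IsSmoothForm α) (h' : IsSmoothForm α') : IsSmoothForm (α + α') :=
  fun x => (h x).add (h' x)

theorem IsSmoothForm.smul (c : ℝ) (h : IsSmoothForm α) : IsSmoothForm (c • α) :=
  fun x => (h x).const_smul c

theorem IsSmoothForm.sub (h : IsSmoothForm α) (h' : IsSmoothForm α') : IsSmoothForm (α - α') :=
  fun x => (h x).sub (h' x)

theorem IsSmoothForm.differentiableAt (h : IsSmoothForm α) (x : P) :
    DifferentiableAt ℝ (chartRep x α) (extChartAt 𝓘(ℝ, EP) x x) :=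
  (h.contDiffAt (extChartAt_mem_target (mem_chart_source EP x))).differentiableAt (by simp)

theorem extD_add (h : IsSmoothForm α) (h' : IsSmoothForm α') :
    extD (α + α') = extD α + extD α' := by
  ext1 x
  rw [Pi.add_apply, extD_apply, extD_apply, extD_apply, chartRep_add,
    extDeriv_add (h.differentiableAt x) (h'.differentiableAt x)]

theorem extD_smul (c : ℝ) : extD (c • α) = c • extD α := by
  ext1 x
  rw [Pi.smul_apply, extD_apply, extD_apply, chartRep_smul, extDeriv_smul]

theorem extD_zero : extD (0 : Form EP P F k) = 0 := by
  simpa using extD_smul (α := (0 : Form EP P F k)) 0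

theorem extD_sub (h : IsSmoothForm α) (h' : IsSmoothForm α') :
    extD (α - α') = extD α - extD α' := by
  have h1 : α - α' = α + (-1 : ℝ) • α' := by rw [neg_one_smul, sub_eq_add_neg]
  rw [h1, extD_add h (h'.smul _), extD_smul, neg_one_smul, sub_eq_add_neg]

end Algebra

theorem IsSmoothForm.iprod [FiniteDimensional ℝ EP] [FiniteDimensional ℝ F] {k : ℕ} {X : P → EP}
    (hX : IsSmoothVec X) {α : Form EP P F (k + 1)} (hα : IsSmoothForm α) :
    IsSmoothForm (iprod X α) := by
  rw [isSmoothForm_iff]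
  intro x y hy
  exact ((hα.contDiffAt hy).curryLeft_apply (hX x y hy)).congr_of_eventuallyEq
    (chartRep_iprod_eventuallyEq X α hy)

theorem chartRep_wedgeZero_apply {k : ℕ} (α : Form EP P (F →L[ℝ] ℝ) k) (f : Form EP P F 0) (x : P)
    (z : EP) (v : Fin k → EP) :
    chartRep x (wedgeZero α f) z v = chartRep x α z v (chartRep x f z ![]) := by
  rw [chartRep_eq_pullE, chartRep_eq_pullE, chartRep_eq_pullE, pullE_apply,
    pullE_apply, pullE_apply]
  unfold wedgeZero
  simp only [ContinuousLinearMap.compContinuousAlternatingMap_coe, Function.comp_apply,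
    ContinuousLinearMap.apply_apply]
  congr 3
  exact Subsingleton.elim _ _

theorem IsSmoothForm.wedgeZero [FiniteDimensional ℝ EP] {k : ℕ} {α : Form EP P (F →L[ℝ] ℝ) k}
    {f : Form EP P F 0} (hα : IsSmoothForm α) (hf : IsSmoothForm f) :
    IsSmoothForm (wedgeZero α f) := by
  rw [isSmoothForm_iff]
  intro x y hy
  rw [contDiffAt_alternating_iff]
  intro v
  have h1 : ContDiffAt ℝ ∞ (fun z => chartRep x α z v (chartRep x f z ![])) y :=
    ((hα.contDiffAt hy).continuousAlternatingMap_apply (g := fun _ => v)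
      fun i => contDiffAt_const).clm_apply
      ((hf.contDiffAt hy).continuousAlternatingMap_apply (g := fun _ => ![])
        fun i => contDiffAt_const)
  simpa only [chartRep_wedgeZero_apply] using h1

/-- The Leibniz rule for the product of a dual valued form and a vector valued function. -/
theorem extD_wedgeZero [FiniteDimensional ℝ EP] {k : ℕ} {α : Form EP P (F →L[ℝ] ℝ) k}
    {f : Form EP P F 0} (hα : IsSmoothForm α) (hf : IsSmoothForm f) :
    extD (wedgeZero α f) = wedgeZero (extD α) f + (-1 : ℝ) ^ k • wedgeOne α (extD f) := by
  ext x v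
  set y := extChartAt 𝓘(ℝ, EP) x x with hy
  have hyt : y ∈ (extChartAt 𝓘(ℝ, EP) x).target := extChartAt_mem_target (mem_chart_source EP x)
  have hαd := hα.differentiableAt x
  have hfd := hf.differentiableAt x
  have hd := (hα.wedgeZero hf).differentiableAt x
  rw [← hy] at hαd hfd hd
  clear_value y
  have h1 : ∀ u w, fderiv ℝ (chartRep x (wedgeZero α f)) y w u =
      fderiv ℝ (chartRep x α) y w u (f x ![]) + α x u (fderiv ℝ (chartRep x f) y w ![]) := by
    intro u w
    have h2 := hd.hasFDerivAt.continuousAlternatingMap_apply_const u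
    have h3 := (hαd.hasFDerivAt.continuousAlternatingMap_apply_const u).clm_apply
      (hfd.hasFDerivAt.continuousAlternatingMap_apply_const ![])
    simp only [chartRep_wedgeZero_apply] at h2
    have h5 := congrArg (fun A : EP →L[ℝ] ℝ => A w) (h2.unique h3)
    simp only [hy, chartRep_self] at h5
    simp only [hy]
    simpa [add_comm] using h5
  have h6 : ∀ w, extD f x ![w] = fderiv ℝ (chartRep x f) y w ![] := by
    intro w
    rw [extD_apply, extDeriv_apply_fderiv, ← hy]
    simp [Subsingleton.elim (Fin.removeNth 0 ![w] : Fin 0 → EP) ![]]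
  have h7 : (wedgeZero (extD α) f + (-1 : ℝ) ^ k • wedgeOne α (extD f)) x v =
      extD α x v (f x ![]) + (-1 : ℝ) ^ k * wedgeOne α (extD f) x v := rfl
  rw [h7, wedgeOne_apply, extD_apply, extD_apply, extDeriv_apply_fderiv, extDeriv_apply_fderiv,
    ← hy, Finset.mul_sum, _root_.sum_apply, ← Finset.sum_add_distrib]
  refine Finset.sum_congr rfl fun i _ => ?_
  rw [h1, h6, _root_.smul_apply, pow_add, ← mul_assoc, ← mul_assoc, ← mul_pow]
  simp [mul_add]

end VectorFields

/-! ### Cartan's formula for deformations -/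

section Families

variable {EP : Type*} [NormedAddCommGroup EP] [NormedSpace ℝ EP]
  {P : Type*} [TopologicalSpace P] [ChartedSpace EP P]
  {F : Type*} [NormedAddCommGroup F] [NormedSpace ℝ F]

/-- A smooth one-parameter family of maps `Φ t : P → P` through `Φ 0 = id` with initial velocity
`X`.  The family need not be a flow. -/
structure IsDeformation (Φ : ℝ × P → P) (X : P → EP) : Prop where
  smooth : ContMDiff (𝓘(ℝ, ℝ).prod 𝓘(ℝ, EP)) 𝓘(ℝ, EP) ∞ Φ
  zero : ∀ p, Φ (0, p) = p
  velocity : ∀ p, tanMap (EP := ℝ) (EN := EP) (fun t : ℝ => Φ (t, p)) 0 1 = X p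

namespace IsDeformation

variable [IsManifold 𝓘(ℝ, EP) ∞ P]
variable {Φ : ℝ × P → P} {X : P → EP} (h : IsDeformation Φ X)

include h

theorem smooth_apply (t : ℝ) : ContMDiff 𝓘(ℝ, EP) 𝓘(ℝ, EP) ∞ (fun q => Φ (t, q)) :=
  h.smooth.comp (contMDiff_const.prodMk contMDiff_id)

theorem mdifferentiableAt_apply (t : ℝ) (p : P) :
    MDifferentiableAt 𝓘(ℝ, EP) 𝓘(ℝ, EP) (fun q => Φ (t, q)) p :=
  (h.smooth_apply t).mdifferentiableAt (by simp)

theorem contMDiffAt_comp_symm {x : P} {t : ℝ} {z : EP}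
    (hz : z ∈ (extChartAt 𝓘(ℝ, EP) x).target) :
    ContMDiffAt 𝓘(ℝ, ℝ × EP) 𝓘(ℝ, EP) ∞
      (fun q : ℝ × EP => Φ (q.1, (extChartAt 𝓘(ℝ, EP) x).symm q.2)) (t, z) := by
  refine ContMDiffAt.comp (I' := 𝓘(ℝ, ℝ).prod 𝓘(ℝ, EP)) (t, z) (h.smooth _)
    (ContMDiffAt.prodMk contDiff_fst.contDiffAt.contMDiffAt ?_)
  exact ContMDiffAt.comp (I' := 𝓘(ℝ, EP)) (t, z) (g := (extChartAt 𝓘(ℝ, EP) x).symm)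
    (contMDiffAt_extChartAt_symm hz) contDiff_snd.contDiffAt.contMDiffAt

theorem contDiffAt_chart {x : P} {z : EP} (hz : z ∈ (extChartAt 𝓘(ℝ, EP) x).target) :
    ContDiffAt ℝ ∞ (fun q : ℝ × EP =>
      extChartAt 𝓘(ℝ, EP) x (Φ (q.1, (extChartAt 𝓘(ℝ, EP) x).symm q.2))) (0, z) := by
  refine contDiffAt_extChartAt_comp (h.contMDiffAt_comp_symm hz) ?_
  simp only [h.zero]
  exact extChartAt_symm_mem_source hz

theorem chartVec_eq {x : P} {z : EP} (hz : z ∈ (extChartAt 𝓘(ℝ, EP) x).target) :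
    chartVec x X z = fderiv ℝ (fun q : ℝ × EP =>
      extChartAt 𝓘(ℝ, EP) x (Φ (q.1, (extChartAt 𝓘(ℝ, EP) x).symm q.2))) (0, z) (1, 0) := by
  have h1 := (hasDerivAt_partial_left ((h.contDiffAt_chart hz).differentiableAt (by simp))).deriv
  rw [← h1]
  unfold chartVec
  rw [← h.velocity, ← fderiv_apply_one_eq_deriv, ← tanMap_eq_fderiv]
  have h2 : MDifferentiableAt 𝓘(ℝ, ℝ) 𝓘(ℝ, EP)
      (fun t : ℝ => Φ (t, (extChartAt 𝓘(ℝ, EP) x).symm z)) 0 :=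
    (h.smooth.comp (contMDiff_id.prodMk contMDiff_const)).mdifferentiableAt (by simp)
  have h3 := tanMap_comp_apply (g := extChartAt 𝓘(ℝ, EP) x)
    (f := fun t : ℝ => Φ (t, (extChartAt 𝓘(ℝ, EP) x).symm z)) (p := 0)
    (by rw [h.zero]; exact mdifferentiableAt_extChartAt' (extChartAt_symm_mem_source hz)) h2 1
  rw [h.zero] at h3
  exact h3.symm

theorem isSmoothVec : IsSmoothVec X := by
  intro x y hy
  have h1 := ((h.contDiffAt_chart hy).fderiv_right (m := ∞) (by simp)).clm_apply
    (contDiffAt_const (c := ((1 : ℝ), (0 : EP))))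
  have h2 : ContDiffAt ℝ ∞ (fun z : EP => ((0 : ℝ), z)) y := contDiffAt_const.prodMk contDiffAt_id
  refine (ContDiffAt.comp y h1 h2).congr_of_eventuallyEq ?_
  filter_upwards [(isOpen_extChartAt_target x).mem_nhds hy] with z hz
  exact h.chartVec_eq hz

theorem pullForm_apply_eq {k : ℕ} (α : Form EP P F k) (p : P) (v : Fin k → EP) :
    ∀ᶠ t in 𝓝 (0 : ℝ), pullForm (fun q => Φ (t, q)) α p v =
      chartRep p α (extChartAt 𝓘(ℝ, EP) p
        (Φ (t, (extChartAt 𝓘(ℝ, EP) p).symm (extChartAt 𝓘(ℝ, EP) p p)))) fun i =>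
          fderiv ℝ (fun z => extChartAt 𝓘(ℝ, EP) p (Φ (t, (extChartAt 𝓘(ℝ, EP) p).symm z)))
            (extChartAt 𝓘(ℝ, EP) p p) (v i) := by
  have hp := mem_chart_source EP p
  have hc : ContinuousAt (fun t : ℝ => Φ (t, p)) 0 :=
    (h.smooth.continuous.comp (by fun_prop : Continuous fun t : ℝ => (t, p))).continuousAt
  have hev : ∀ᶠ t in 𝓝 (0 : ℝ), Φ (t, p) ∈ (chartAt EP p).source := by
    refine hc.preimage_mem_nhds ((chartAt EP p).open_source.mem_nhds ?_)
    rw [h.zero]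
    exact hp
  filter_upwards [hev] with t ht
  have ht' : Φ (t, (extChartAt 𝓘(ℝ, EP) p).symm (extChartAt 𝓘(ℝ, EP) p p)) ∈
      (chartAt EP p).source := by rwa [extChartAt_symm_apply_apply hp]
  have hS : MDifferentiableAt 𝓘(ℝ, EP) 𝓘(ℝ, EP)
      (fun z => Φ (t, (extChartAt 𝓘(ℝ, EP) p).symm z)) (extChartAt 𝓘(ℝ, EP) p p) :=
    MDifferentiableAt.comp (I' := 𝓘(ℝ, EP)) _ (g := fun q => Φ (t, q))
      (h.mdifferentiableAt_apply t _)
      (mdifferentiableAt_extChartAt_symm (extChartAt_mem_target hp))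
  have h1 := congrArg (fun A => A v) (pullE_eq_chartRep α hS ht')
  simp only [compContinuousLinearMap_apply] at h1
  refine Eq.trans ?_ h1
  rw [pullE_apply, extChartAt_symm_apply_apply hp]
  change α (Φ (t, p)) _ = _
  congr 1
  ext i
  rw [tanMap_comp_apply (g := fun q => Φ (t, q)) (h.mdifferentiableAt_apply t _)
    (mdifferentiableAt_extChartAt_symm (extChartAt_mem_target hp)), extChartAt_symm_apply_apply hp]
  have h2 := tanMap_extChartAt_symm_comp hp (v i)
  rw [tanMap_extChartAt_self] at h2
  exact congrArg _ h2.symm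

/-- **Cartan's formula**: the derivative of the pullbacks of a form of positive degree along a
deformation is its Lie derivative along the velocity. -/
theorem hasDerivAt_pullForm {k : ℕ} {α : Form EP P F (k + 1)} (hα : IsSmoothForm α) (p : P)
    (v : Fin (k + 1) → EP) :
    HasDerivAt (fun t => pullForm (fun q => Φ (t, q)) α p v) (lieD X α p v) 0 := by
  have hp := mem_chart_source EP p
  have ht := extChartAt_mem_target hp
  have h1 := hasDerivAt_pullback_family_cartan (hα.differentiableAt p) (h.contDiffAt_chart ht)
    (X := chartVec p X) (by
      filter_upwards [(isOpen_extChartAt_target p).mem_nhds ht] with z hz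
      simp only [h.zero]
      exact (extChartAt 𝓘(ℝ, EP) p).right_inv hz)
    ((h.isSmoothVec p _ ht).differentiableAt (by simp)) (by
      filter_upwards [(isOpen_extChartAt_target p).mem_nhds ht] with z hz
      exact h.chartVec_eq hz) v
  refine (h1.congr_of_eventuallyEq (h.pullForm_apply_eq α p v)).congr_deriv ?_
  have h2 : lieD X α p v = (extD α p).curryLeft (X p) v + extD (iprod X α) p v := rfl
  rw [h2, extD_apply, extD_apply, chartVec_self, (chartRep_iprod_eventuallyEq X α ht).extDeriv_eq]

theorem hasDerivAt_pullForm_zero {α : Form EP P F 0} (hα : IsSmoothForm α) (p : P)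
    (v : Fin 0 → EP) :
    HasDerivAt (fun t => pullForm (fun q => Φ (t, q)) α p v) (lieDZero X α p v) 0 := by
  have hp := mem_chart_source EP p
  have ht := extChartAt_mem_target hp
  have h1 := hasDerivAt_pullback_family (hα.differentiableAt p) (h.contDiffAt_chart ht)
    (X := chartVec p X) (by
      filter_upwards [(isOpen_extChartAt_target p).mem_nhds ht] with z hz
      simp only [h.zero]
      exact (extChartAt 𝓘(ℝ, EP) p).right_inv hz) (by
      filter_upwards [(isOpen_extChartAt_target p).mem_nhds ht] with z hz
      exact h.chartVec_eq hz) v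
  refine (h1.congr_of_eventuallyEq (h.pullForm_apply_eq α p v)).congr_deriv ?_
  have h2 : lieDZero X α p v = (extD α p).curryLeft (X p) v := rfl
  rw [h2, extD_apply, chartVec_self, curryLeft_apply_apply, extDeriv_apply_fderiv]
  simp [Subsingleton.elim (Fin.removeNth 0 (Matrix.vecCons (X p) v) : Fin 0 → EP) v]

theorem isSmoothFormFamily [FiniteDimensional ℝ EP] [FiniteDimensional ℝ F] {k : ℕ}
    {α : Form EP P F k} (hα : IsSmoothForm α) :
    IsSmoothFormFamily fun t => pullForm (fun q => Φ (t, q)) α := by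
  intro x q hq
  have hz : q.2 ∈ (extChartAt 𝓘(ℝ, EP) x).target := hq.2
  have h1 := contDiffAt_pullE_family hα (h.contMDiffAt_comp_symm (t := q.1) hz)
  refine (h1.congr_of_eventuallyEq ?_).contDiffWithinAt
  filter_upwards [continuousAt_snd.preimage_mem_nhds ((isOpen_extChartAt_target x).mem_nhds hz)]
    with r hr
  ext v
  rw [chartRep_eq_pullE, pullE_apply, pullE_apply]
  change α (Φ (r.1, (extChartAt 𝓘(ℝ, EP) x).symm r.2)) _ = _
  congr 1
  ext i
  exact (tanMap_comp_apply (g := fun q => Φ (r.1, q)) (h.mdifferentiableAt_apply _ _)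
    (mdifferentiableAt_extChartAt_symm hr) (v i)).symm

end IsDeformation

theorem IsSmoothFormFamily.isSmoothForm {k : ℕ} {α : ℝ → Form EP P F k}
    (h : IsSmoothFormFamily α) (t : ℝ) : IsSmoothForm (α t) := fun x =>
  (h x).comp (contDiffOn_const.prodMk contDiffOn_id) fun _ hy => ⟨Set.mem_univ _, hy⟩

theorem IsSmoothForm.isSmoothFormFamily_const {k : ℕ} {α : Form EP P F k} (h : IsSmoothForm α) :
    IsSmoothFormFamily fun _ => α := fun x =>
  (h x).comp contDiffOn_snd fun _ hy => hy.2

/-- Smooth forms pull back to smooth forms under smooth maps. -/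
theorem IsSmoothForm.pullForm [IsManifold 𝓘(ℝ, EP) ∞ P] [FiniteDimensional ℝ EP]
    [FiniteDimensional ℝ F] {k : ℕ}
    {α : Form EP P F k} (hα : IsSmoothForm α) {f : P → P}
    (hf : ContMDiff 𝓘(ℝ, EP) 𝓘(ℝ, EP) ∞ f) : IsSmoothForm (pullForm f α) := by
  rw [isSmoothForm_iff]
  intro x y hy
  have h1 : ContMDiffAt 𝓘(ℝ, EP) 𝓘(ℝ, EP) ∞ (fun z => f ((extChartAt 𝓘(ℝ, EP) x).symm z)) y :=
    ContMDiffAt.comp (I' := 𝓘(ℝ, EP)) y (hf _) (contMDiffAt_extChartAt_symm hy)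
  refine (contDiffAt_pullE hα h1).congr_of_eventuallyEq ?_
  filter_upwards [(isOpen_extChartAt_target x).mem_nhds hy] with z hz
  ext v
  rw [chartRep_eq_pullE, pullE_apply, pullE_apply]
  change α (f ((extChartAt 𝓘(ℝ, EP) x).symm z)) _ = _
  congr 1
  ext i
  exact (tanMap_comp_apply (g := f) (hf.mdifferentiableAt (by simp))
    (mdifferentiableAt_extChartAt_symm hz) (v i)).symm

end Families

/-! ### Curves in Lie groups and fundamental vector fields -/

section LieGroups

variable {EG : Type*} [NormedAddCommGroup EG] [NormedSpace ℝ EG] [FiniteDimensional ℝ EG]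
  {G : Type*} [TopologicalSpace G] [ChartedSpace EG G]

/-- A globally defined smooth map `κ`, tangent to the identity at `0`, such that `x + κ η` stays in
a given neighbourhood of `x`: the identity cut off by a bump function. -/
theorem exists_tangent_to_id {U : Set EG} {x : EG} (hU : U ∈ 𝓝 x) :
    ∃ κ : EG → EG, ContDiff ℝ ∞ κ ∧ κ 0 = 0 ∧ HasFDerivAt κ (.id ℝ EG) 0 ∧ ∀ η, x + κ η ∈ U := by
  obtain ⟨ε, hε, hU⟩ := Metric.mem_nhds_iff.1 hU
  let b : ContDiffBump (0 : EG) := ⟨ε / 2, ε, by positivity, by linarith⟩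
  refine ⟨fun η => b η • η, b.contDiff.smul contDiff_id, by simp, ?_, fun η => hU ?_⟩
  · have h : (fun η => b η • η) =ᶠ[𝓝 0] id := by
      filter_upwards [b.eventuallyEq_one] with η hη
      simp [hη]
    exact (hasFDerivAt_id (0 : EG)).congr_of_eventuallyEq h
  · rw [Metric.mem_ball, dist_eq_norm, add_sub_cancel_left, norm_smul, Real.norm_of_nonneg b.nonneg]
    by_cases hη : ‖η‖ < ε
    · exact (mul_le_of_le_one_left (norm_nonneg _) b.le_one).trans_lt hη
    · have h0 : b η = 0 := b.zero_of_le_dist (by simpa [b, dist_eq_norm] using hη)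
      simpa [h0] using hε

variable (EG G) in
/-- A globally defined smooth map `𝔤 → G` sending `0` to `1` and tangent to the identity there; it
serves as a substitute for the exponential map. -/
theorem exists_localExp [Group G] [IsManifold 𝓘(ℝ, EG) ∞ G] :
    ∃ a : EG → G, ContMDiff 𝓘(ℝ, EG) 𝓘(ℝ, EG) ∞ a ∧ a 0 = 1 ∧
      (tanMap a (0 : EG) : EG →L[ℝ] EG) = .id ℝ EG := by
  let c := extChartAt 𝓘(ℝ, EG) (1 : G)
  obtain ⟨κ, hκ, hκ0, hκd, hκt⟩ := exists_tangent_to_id (extChartAt_target_mem_nhds (1 : G))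
    (U := c.target) (x := c 1)
  have hin : ContDiff ℝ ∞ fun η => c 1 + κ η := contDiff_const.add hκ
  refine ⟨fun η => c.symm (c 1 + κ η), ?_, ?_, ?_⟩
  · intro t
    exact ContMDiffAt.comp (I' := 𝓘(ℝ, EG)) (g := c.symm) t (contMDiffAt_extChartAt_symm (hκt _))
      hin.contDiffAt.contMDiffAt
  · simp only [hκ0, add_zero]
    exact extChartAt_symm_apply_apply (mem_chart_source EG 1)
  · ext ξ
    rw [tanMap_comp_apply (p := (0 : EG)) (g := c.symm) (f := fun η => c 1 + κ η)
      (mdifferentiableAt_extChartAt_symm (hκt _))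
      (hin.contDiffAt.contMDiffAt.mdifferentiableAt (by simp)) ξ, tanMap_eq_fderiv,
      (hκd.const_add _).fderiv]
    simp only [hκ0, add_zero]
    have h5 := tanMap_extChartAt_symm_comp (mem_chart_source EG (1 : G)) ξ
    rw [tanMap_extChartAt_self] at h5
    exact h5

/-- Composing a curve `ζ` in `𝔤` through `0` with a map `𝔤 → G` tangent to the identity does not
change its velocity. -/
theorem tanMap_comp_localExp [Group G] {a : EG → G} (ha : ContMDiff 𝓘(ℝ, EG) 𝓘(ℝ, EG) ∞ a)
    (had : (tanMap a (0 : EG) : EG →L[ℝ] EG) = .id ℝ EG) {ζ : ℝ → EG} {ξ : EG}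
    (hζ : HasDerivAt ζ ξ 0) (hζ0 : ζ 0 = 0) :
    tanMap (EP := ℝ) (EN := EG) (fun t => a (ζ t)) 0 1 = ξ := by
  rw [tanMap_comp_apply (p := (0 : ℝ)) (g := a) (f := ζ) (ha.mdifferentiableAt (by simp))
    hζ.differentiableAt.mdifferentiableAt, hζ0, had, tanMap_eq_fderiv, fderiv_apply_one_eq_deriv,
    hζ.deriv]
  rfl

variable (G) in
/-- A smooth curve in `G` through `1` with a given velocity. -/
theorem exists_curve [Group G] [IsManifold 𝓘(ℝ, EG) ∞ G] (ξ : EG) :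
    ∃ a : ℝ → G, ContMDiff 𝓘(ℝ, ℝ) 𝓘(ℝ, EG) ∞ a ∧ a 0 = 1 ∧
      tanMap (EP := ℝ) (EN := EG) a 0 1 = ξ := by
  obtain ⟨a, ha, ha0, had⟩ := exists_localExp EG G
  have hin : ContDiff ℝ ∞ fun t : ℝ => t • ξ := contDiff_id.smul contDiff_const
  refine ⟨fun t => a (t • ξ), ha.comp hin.contMDiff, by simp [ha0], ?_⟩
  exact tanMap_comp_localExp ha had (by simpa using (hasDerivAt_id (0 : ℝ)).smul_const ξ) (by simp)

end LieGroups

section Horizontal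

variable {EM EG EP M G P : Type*}
  [NormedAddCommGroup EM] [NormedSpace ℝ EM] [NormedAddCommGroup EG] [NormedSpace ℝ EG]
  [NormedAddCommGroup EP] [NormedSpace ℝ EP]
  [TopologicalSpace M] [ChartedSpace EM M] [TopologicalSpace G] [ChartedSpace EG G] [Group G]
  [TopologicalSpace P] [ChartedSpace EP P]
  {F : Type*} [NormedAddCommGroup F] [NormedSpace ℝ F]
  (B : PrincipalBundle EM EG EP M G P)

namespace PrincipalBundle

theorem contMDiff_act_right (g : G) : ContMDiff 𝓘(ℝ, EP) 𝓘(ℝ, EP) ∞ (fun p => B.act p g) :=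
  B.contMDiff_act.comp (contMDiff_id.prodMk contMDiff_const)

theorem contMDiff_act_left (p : P) : ContMDiff 𝓘(ℝ, EG) 𝓘(ℝ, EP) ∞ (fun g => B.act p g) :=
  B.contMDiff_act.comp (contMDiff_const.prodMk contMDiff_id)

theorem mdifferentiableAt_act_right (g : G) (p : P) :
    MDifferentiableAt 𝓘(ℝ, EP) 𝓘(ℝ, EP) (fun p => B.act p g) p :=
  (B.contMDiff_act_right g).mdifferentiableAt (by simp)

theorem mdifferentiableAt_act_left (p : P) (g : G) :
    MDifferentiableAt 𝓘(ℝ, EG) 𝓘(ℝ, EP) (fun g => B.act p g) g :=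
  (B.contMDiff_act_left p).mdifferentiableAt (by simp)

theorem mdifferentiableAt_proj (p : P) : MDifferentiableAt 𝓘(ℝ, EP) 𝓘(ℝ, EM) B.proj p :=
  B.contMDiff_proj.mdifferentiableAt (by simp)

theorem isVertical_fundamental (ξ : EG) (p : P) : B.IsVertical p (B.fundamental ξ p) := by
  have h1 := tanMap_comp_apply (p := (1 : G)) (g := B.proj) (f := fun g => B.act p g)
    (B.mdifferentiableAt_proj _) (B.mdifferentiableAt_act_left p 1) ξ
  simp only [B.proj_act, B.act_one] at h1
  rw [tanMap_const] at h1
  exact h1.symm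

theorem act_act_inv (p : P) (g : G) : B.act (B.act p g) g⁻¹ = p := by
  rw [← B.act_mul, mul_inv_cancel, B.act_one]

/-- The product rule for `q ↦ s q · τ q`. -/
theorem tanMap_act {EQ Q : Type*} [NormedAddCommGroup EQ] [NormedSpace ℝ EQ] [TopologicalSpace Q]
    [ChartedSpace EQ Q] {s : Q → P} {τ : Q → G} {q : Q}
    (hs : MDifferentiableAt 𝓘(ℝ, EQ) 𝓘(ℝ, EP) s q)
    (hτ : MDifferentiableAt 𝓘(ℝ, EQ) 𝓘(ℝ, EG) τ q) (v : EQ) :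
    tanMap (EP := EQ) (EN := EP) (fun q => B.act (s q) (τ q)) q v =
      tanMap (EP := EP) (EN := EP) (fun p => B.act p (τ q)) (s q)
        (tanMap (EP := EQ) (EN := EP) s q v) +
      tanMap (EP := EG) (EN := EP) (fun g => B.act (s q) g) (τ q)
        (tanMap (EP := EQ) (EN := EG) τ q v) := by
  have hprod : MDifferentiableAt (𝓘(ℝ, EP).prod 𝓘(ℝ, EG)) 𝓘(ℝ, EP)
      (fun q : P × G => B.act q.1 q.2) (s q, τ q) :=
    B.contMDiff_act.mdifferentiableAt (by simp)
  have h2 := (hprod.hasMFDerivAt.comp q (hs.hasMFDerivAt.prodMk hτ.hasMFDerivAt)).mfderiv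
  have h3 := congrArg (fun A : EQ →L[ℝ] EP => A v) h2
  have h4 := mfderiv_prod_eq_add_apply hprod
    (v := (tanMap (EP := EQ) (EN := EP) s q v, tanMap (EP := EQ) (EN := EG) τ q v))
  exact h3.trans h4

theorem mdifferentiableAt_act {EQ Q : Type*} [NormedAddCommGroup EQ] [NormedSpace ℝ EQ]
    [TopologicalSpace Q] [ChartedSpace EQ Q] {s : Q → P} {τ : Q → G} {q : Q}
    (hs : MDifferentiableAt 𝓘(ℝ, EQ) 𝓘(ℝ, EP) s q)
    (hτ : MDifferentiableAt 𝓘(ℝ, EQ) 𝓘(ℝ, EG) τ q) :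
    MDifferentiableAt 𝓘(ℝ, EQ) 𝓘(ℝ, EP) (fun q => B.act (s q) (τ q)) q :=
  MDifferentiableAt.comp (I' := 𝓘(ℝ, EP).prod 𝓘(ℝ, EG)) q
    (g := fun q : P × G => B.act q.1 q.2) (B.contMDiff_act.mdifferentiableAt (by simp))
    (hs.prodMk hτ)

/-- The vertical vectors are the values of the fundamental vector fields. -/
theorem exists_fundamental [LieGroup 𝓘(ℝ, EG) ∞ G] {p : P} {v : EP} (hv : B.IsVertical p v) :
    ∃ ξ : EG, B.fundamental ξ p = v := by
  obtain ⟨U, σ, τ, hU, hxU, hσ, hτ, hστ, hτg, hact⟩ := B.exists_trivialization (B.proj p)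
  have hpU : p ∈ B.proj ⁻¹' U := hxU
  have hopen : B.proj ⁻¹' U ∈ 𝓝 p := (hU.preimage B.contMDiff_proj.continuous).mem_nhds hpU
  have hσd : MDifferentiableAt 𝓘(ℝ, EM) 𝓘(ℝ, EP) σ (B.proj p) :=
    (hσ.contMDiffAt (hU.mem_nhds hxU)).mdifferentiableAt (by simp)
  have hτd : MDifferentiableAt 𝓘(ℝ, EP) 𝓘(ℝ, EG) τ p :=
    (hτ.contMDiffAt hopen).mdifferentiableAt (by simp)
  set q := σ (B.proj p) with hq
  have hqp : B.act q (τ p) = p := hact p hpU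
  -- `p' ↦ q · τ p'` and the identity differ by the motion of the base point only
  let m : G → G := fun g => (τ p)⁻¹ * g
  have hm : ContMDiff 𝓘(ℝ, EG) 𝓘(ℝ, EG) ∞ m := contMDiff_mul_left
  have hfun : ∀ g, B.act q g = B.act p (m g) := by
    intro g
    rw [← hqp, ← B.act_mul]
    congr 1
    simp [m]
  have hs : MDifferentiableAt 𝓘(ℝ, EP) 𝓘(ℝ, EP) (fun p' => σ (B.proj p')) p :=
    MDifferentiableAt.comp (I' := 𝓘(ℝ, EM)) p hσd (B.mdifferentiableAt_proj p)
  have h1 : tanMap (EP := EP) (EN := EP) (fun p' => B.act (σ (B.proj p')) (τ p')) p v = v := by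
    have h2 : (fun p' => B.act (σ (B.proj p')) (τ p')) =ᶠ[𝓝 p] fun p' => p' := by
      filter_upwards [hopen] with p' hp'
      exact hact p' hp'
    rw [tanMap_congr h2, tanMap_id]
    rfl
  have hsv : tanMap (EP := EP) (EN := EP) (fun p' => σ (B.proj p')) p v = 0 := by
    rw [tanMap_comp_apply hσd (B.mdifferentiableAt_proj p),
      show tanMap (EP := EP) (EN := EM) B.proj p v = 0 from hv, _root_.map_zero]
  rw [B.tanMap_act hs hτd, hsv, _root_.map_zero, zero_add] at h1
  refine ⟨tanMap (EP := EG) (EN := EG) m (τ p) (tanMap (EP := EP) (EN := EG) τ p v), ?_⟩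
  have hm1 : m (τ p) = 1 := by simp [m]
  have h5 := tanMap_comp_apply (p := τ p) (g := fun g => B.act p g) (f := m)
    (B.mdifferentiableAt_act_left p _) (hm.mdifferentiableAt (by simp))
    (tanMap (EP := EP) (EN := EG) τ p v)
  rw [hm1] at h5
  unfold fundamental
  rw [← h5]
  simp only [← hfun]
  exact h1

end PrincipalBundle

end Horizontal

/-! ### Tensorial forms and automorphisms -/

section Tensorial

variable {EM EG EP M G P : Type*}
  [NormedAddCommGroup EM] [NormedSpace ℝ EM] [NormedAddCommGroup EG] [NormedSpace ℝ EG]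
  [NormedAddCommGroup EP] [NormedSpace ℝ EP]
  [TopologicalSpace M] [ChartedSpace EM M] [TopologicalSpace G] [ChartedSpace EG G] [Group G]
  [TopologicalSpace P] [ChartedSpace EP P]
  {F : Type*} [NormedAddCommGroup F] [NormedSpace ℝ F]
  {B : PrincipalBundle EM EG EP M G P}

namespace PrincipalBundle

theorem IsHorizontal.iprod_eq_zero {k : ℕ} {α : Form EP P F (k + 1)} (hα : B.IsHorizontal α)
    {X : P → EP} (hX : ∀ p, B.IsVertical p (X p)) : iprod X α = 0 := by
  ext p v
  exact hα p _ ⟨0, hX p⟩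

/-- A form is horizontal if it vanishes whenever its first argument is vertical. -/
theorem isHorizontal_of_cons {k : ℕ} {α : Form EP P F (k + 1)}
    (h : ∀ p w v, B.IsVertical p w → α p (Matrix.vecCons w v) = 0) : B.IsHorizontal α := by
  rintro p v ⟨i, hi⟩
  have h1 := update_eq_neg_one_pow_cons (α p) v i (v i)
  rw [Function.update_eq_self] at h1
  rw [h1, h p _ _ hi, smul_zero]

/-- A horizontal form only depends on its arguments modulo vertical vectors. -/
theorem IsHorizontal.apply_congr {k : ℕ} {α : Form EP P F k} (hα : B.IsHorizontal α) {p : P}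
    {v w : Fin k → EP} (h : ∀ i, B.IsVertical p (v i - w i)) : α p v = α p w := by
  suffices hs : ∀ s : Finset (Fin k), α p (s.piecewise v w) = α p w by
    simpa using hs Finset.univ
  intro s
  induction s using Finset.induction_on with
  | empty => simp
  | insert i s his ih =>
    rw [Finset.piecewise_insert, ← ih]
    have h1 : Function.update (s.piecewise v w) i (w i) = s.piecewise v w := by
      ext1 j
      by_cases hj : j = i
      · subst hj
        simp [his]
      · simp [hj]
    conv_rhs => rw [← h1]
    rw [← sub_eq_zero, ← (α p).map_update_sub]
    exact hα p _ ⟨i, by simpa using h i⟩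

/-- Horizontal forms of degree greater than the dimension of the base vanish. -/
theorem IsHorizontal.eq_zero_of_finrank_lt [FiniteDimensional ℝ EM] {k : ℕ} {α : Form EP P F k}
    (hα : B.IsHorizontal α) (hk : Module.finrank ℝ EM < k) : α = 0 := by
  ext p v
  let T : EP →L[ℝ] EM := tanMap B.proj p
  have hdep : ¬ LinearIndependent ℝ fun i => T (v i) := by
    intro hli
    have := hli.fintype_card_le_finrank
    simp at this
    omega
  obtain ⟨c, hc, j, hj⟩ := Fintype.not_linearIndependent_iff.1 hdep
  have h0 : α p (Function.update v j (∑ i, c i • v i)) = 0 := by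
    refine hα p _ ⟨j, ?_⟩
    rw [Function.update_self]
    change T _ = 0
    simpa using hc
  have h1 : α p (Function.update v j (∑ i, c i • v i)) = c j • α p v := by
    have hs := (α p).toAlternatingMap.map_update_sum Finset.univ j (fun i => c i • v i) v
    refine hs.trans ?_
    change ∑ i, α p (Function.update v j (c i • v i)) = _
    rw [Finset.sum_eq_single j]
    · rw [(α p).map_update_smul, Function.update_eq_self]
    · intro i _ hij
      rw [(α p).map_update_smul]
      have : α p (Function.update v j (v i)) = 0 := (α p).map_update_self v hij.symm
      rw [this, smul_zero]
    · simp
  rw [h1] at h0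
  simpa [hj] using h0

theorem tanMap_fundamental_of_equivariant {f : P → P}
    (hf : MDifferentiable 𝓘(ℝ, EP) 𝓘(ℝ, EP) f) (hfa : ∀ p g, f (B.act p g) = B.act (f p) g)
    (ξ : EG) (p : P) :
    tanMap (EP := EP) (EN := EP) f p (B.fundamental ξ p) = B.fundamental ξ (f p) := by
  have h1 := tanMap_comp_apply (p := (1 : G)) (g := f) (f := fun g => B.act p g) (hf _)
    (B.mdifferentiableAt_act_left p 1) ξ
  simp only [hfa, B.act_one] at h1
  exact h1.symm

variable (B) in
/-- The fundamental vector fields are the velocities of families of right translations. -/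
theorem exists_isDeformation_fundamental [FiniteDimensional ℝ EG] [LieGroup 𝓘(ℝ, EG) ∞ G] (ξ : EG) :
    ∃ a : ℝ → G, IsDeformation (fun q : ℝ × P => B.act q.2 (a q.1)) (B.fundamental ξ) := by
  obtain ⟨a, ha, ha0, hav⟩ := exists_curve G ξ
  refine ⟨a, ?_, ?_, ?_⟩
  · exact B.contMDiff_act.comp (contMDiff_snd.prodMk (ha.comp contMDiff_fst))
  · intro p
    simp only [ha0, B.act_one]
  · intro p
    have h1 := tanMap_comp_apply (p := (0 : ℝ)) (g := fun g => B.act p g) (f := a)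
      (B.mdifferentiableAt_act_left p _) (ha.mdifferentiableAt (by simp)) 1
    rw [hav, ha0] at h1
    exact h1

variable [IsManifold 𝓘(ℝ, EP) ∞ P]

/-- The exterior derivative of a horizontal invariant form is horizontal: contracting it with a
fundamental field yields, by Cartan's formula, the derivative of a constant. -/
theorem IsTensorial.isHorizontal_extD [FiniteDimensional ℝ EG] [LieGroup 𝓘(ℝ, EG) ∞ G] {k : ℕ}
    {α : Form EP P ℝ k} (hα : B.IsTensorial trivialRep α) : B.IsHorizontal (extD α) := by
  refine isHorizontal_of_cons fun p w v hw => ?_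
  obtain ⟨ξ, rfl⟩ := B.exists_fundamental hw
  obtain ⟨a, ha⟩ := B.exists_isDeformation_fundamental ξ
  have hconst : ∀ t v, pullForm (fun q => B.act q (a t)) α p v = α p v := by
    intro t v
    rw [hα.equivariant]
    rfl
  cases k with
  | zero =>
    have h1 := ha.hasDerivAt_pullForm_zero hα.smooth p v
    simp only [hconst] at h1
    exact h1.unique (hasDerivAt_const _ _)
  | succ k =>
    have h1 := ha.hasDerivAt_pullForm hα.smooth p v
    simp only [hconst] at h1
    have h2 := h1.unique (hasDerivAt_const _ _)
    have h3 : iprod (B.fundamental ξ) α = 0 :=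
      hα.horizontal.iprod_eq_zero (B.isVertical_fundamental ξ)
    unfold lieD at h2
    rw [h3] at h2
    rw [extD_zero, add_zero] at h2
    exact h2

theorem isHorizontal_of_hasDerivAt {k : ℕ} {α : ℝ → Form EP P F k} {β : Form EP P F k}
    (hα : ∀ t, B.IsHorizontal (α t)) (h : ∀ p v, HasDerivAt (fun t => α t p v) (β p v) 0) :
    B.IsHorizontal β := by
  intro p v hv
  have h1 := h p v
  simp only [hα _ p v hv] at h1
  exact h1.unique (hasDerivAt_const _ _)

theorem isEquivariant_of_hasDerivAt {k : ℕ} {R : G → F →L[ℝ] F} {α : ℝ → Form EP P F k}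
    {β : Form EP P F k} (hα : ∀ t, B.IsEquivariant R (α t))
    (h : ∀ p v, HasDerivAt (fun t => α t p v) (β p v) 0) : B.IsEquivariant R β := by
  intro g
  ext p v
  have h1 := h (B.act p g) (fun i => tanMap (EP := EP) (EN := EP) (fun q => B.act q g) p (v i))
  have h2 := (R g⁻¹).hasFDerivAt.comp_hasDerivAt (0 : ℝ) (h p v)
  have h3 : ∀ t, α t (B.act p g)
      (fun i => tanMap (EP := EP) (EN := EP) (fun q => B.act q g) p (v i)) = R g⁻¹ (α t p v) := by
    intro t
    exact congrArg (fun A => A v) (congrFun (hα t g) p)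
  simp only [h3] at h1
  exact h1.unique h2

end PrincipalBundle

end Tensorial

section Automorphisms

variable {EM EG EP M G P V : Type*}
  [NormedAddCommGroup EM] [NormedSpace ℝ EM] [NormedAddCommGroup EG] [NormedSpace ℝ EG]
  [NormedAddCommGroup EP] [NormedSpace ℝ EP] [NormedAddCommGroup V] [NormedSpace ℝ V]
  [TopologicalSpace M] [ChartedSpace EM M] [TopologicalSpace G] [ChartedSpace EG G] [Group G]
  [TopologicalSpace P] [ChartedSpace EP P]
  {F : Type*} [NormedAddCommGroup F] [NormedSpace ℝ F] {n : ℕ}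
  {B : PrincipalBundle EM EG EP M G P}

namespace PrincipalBundle.IsAutomorphism

variable {f : P ≃ₘ⟮𝓘(ℝ, EP), 𝓘(ℝ, EP)⟯ P} (hf : B.IsAutomorphism f)

include hf

theorem symm : B.IsAutomorphism f.symm := by
  intro p g
  apply f.injective
  change f (f.symm (B.act p g)) = f (B.act (f.symm p) g)
  rw [hf, f.apply_symm_apply, f.apply_symm_apply]

theorem isVertical_tanMap [LieGroup 𝓘(ℝ, EG) ∞ G] {p : P} {v : EP} (hv : B.IsVertical p v) :
    B.IsVertical (f p) (tanMap (EP := EP) (EN := EP) f p v) := by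
  obtain ⟨ξ, rfl⟩ := B.exists_fundamental hv
  rw [B.tanMap_fundamental_of_equivariant (f.mdifferentiable (by simp)) hf]
  exact B.isVertical_fundamental _ _

theorem isVertical_of_tanMap [LieGroup 𝓘(ℝ, EG) ∞ G] {p : P} {v : EP}
    (hv : B.IsVertical (f p) (tanMap (EP := EP) (EN := EP) f p v)) : B.IsVertical p v := by
  have h1 := hf.symm.isVertical_tanMap hv
  have h2 := tanMap_comp_apply (p := p) (g := f.symm) (f := f) (f.symm.mdifferentiable (by simp) _)
    (f.mdifferentiable (by simp) _) v
  rw [← h2] at h1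
  simp only [f.symm_apply_apply] at h1
  rwa [tanMap_id] at h1

theorem isHorizontal_pullForm [LieGroup 𝓘(ℝ, EG) ∞ G] {k : ℕ} {α : Form EP P F k}
    (hα : B.IsHorizontal α) : B.IsHorizontal (pullForm f α) := by
  rintro p v ⟨i, hi⟩
  exact hα _ _ ⟨i, hf.isVertical_tanMap hi⟩

theorem isEquivariant_pullForm {k : ℕ} {R : G → F →L[ℝ] F} {α : Form EP P F k}
    (hα : B.IsEquivariant R α) : B.IsEquivariant R (pullForm f α) := by
  intro g
  ext p v
  have h1 := congrArg (fun A => A fun i => tanMap (EP := EP) (EN := EP) f p (v i))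
    (congrFun (hα g) (f p))
  refine Eq.trans ?_ h1
  change α (f (B.act p g)) _ = α (B.act (f p) g) _
  rw [hf]
  congr 1
  ext i
  have h2 := tanMap_comp_apply (p := p) (g := f) (f := fun q => B.act q g)
    (f.mdifferentiable (by simp) _) (B.mdifferentiableAt_act_right g p) (v i)
  have h3 := tanMap_comp_apply (p := p) (g := fun q => B.act q g) (f := f)
    (B.mdifferentiableAt_act_right g _) (f.mdifferentiable (by simp) _) (v i)
  simp only [hf _ g] at h2
  exact h2.symm.trans h3

variable [IsManifold 𝓘(ℝ, EP) ∞ P] [LieGroup 𝓘(ℝ, EG) ∞ G] [FiniteDimensional ℝ EP]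

theorem isTensorial_pullForm [FiniteDimensional ℝ F] {k : ℕ} {R : G → F →L[ℝ] F}
    {α : Form EP P F k} (hα : B.IsTensorial R α) : B.IsTensorial R (pullForm f α) :=
  ⟨hα.smooth.pullForm f.contMDiff, hf.isHorizontal_pullForm hα.horizontal,
    hf.isEquivariant_pullForm hα.equivariant⟩

theorem isConnection_pullForm [FiniteDimensional ℝ EG] {A : Form EP P EG 1}
    (hA : B.IsConnection A) : B.IsConnection (pullForm f A) := by
  refine ⟨hA.smooth.pullForm f.contMDiff, fun p ξ => ?_, hf.isEquivariant_pullForm hA.equivariant⟩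
  have h1 := hA.fundamental (f p) ξ
  rw [← B.tanMap_fundamental_of_equivariant (f.mdifferentiable (by simp)) hf] at h1
  refine Eq.trans ?_ h1
  change A (f p) _ = _
  congr 1
  ext i
  fin_cases i
  rfl

theorem isDynamical_pull [FiniteDimensional ℝ EG] [FiniteDimensional ℝ V] {R : FieldReps EG G V n}
    {ψ : Fields EG EP P V n} (hψ : ψ.IsDynamical B R) : (ψ.pull f).IsDynamical B R := by
  refine ⟨hf.isTensorial_pullForm hψ.coframe, fun p v hv => ?_,
    hf.isConnection_pullForm hψ.connection, hf.isTensorial_pullForm hψ.charged⟩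
  refine hf.isVertical_of_tanMap (hψ.coframe_nondegenerate _ _ ?_)
  rw [← hv]
  change ψ.e (f p) _ = ψ.e (f p) _
  congr 1
  ext i
  fin_cases i
  rfl

end PrincipalBundle.IsAutomorphism

end Automorphisms

/-! ### The Noether identity for generated vector fields -/

section Noether

variable {EM EG EP M G P V : Type*}
  [NormedAddCommGroup EM] [NormedSpace ℝ EM] [NormedAddCommGroup EG] [NormedSpace ℝ EG]
  [NormedAddCommGroup EP] [NormedSpace ℝ EP] [NormedAddCommGroup V] [NormedSpace ℝ V]
  [TopologicalSpace M] [ChartedSpace EM M] [TopologicalSpace G] [ChartedSpace EG G] [Group G]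
  [TopologicalSpace P] [ChartedSpace EP P]
  {F : Type*} [NormedAddCommGroup F] [NormedSpace ℝ F] {n : ℕ}

theorem wedgeOne_add [FiniteDimensional ℝ EP] {k : ℕ} (α : Form EP P (F →L[ℝ] ℝ) k)
    (μ ν : Form EP P F 1) : wedgeOne α (μ + ν) = wedgeOne α μ + wedgeOne α ν := by
  ext p v
  have h : (wedgeOne α μ + wedgeOne α ν) p v = wedgeOne α μ p v + wedgeOne α ν p v := rfl
  rw [h, wedgeOne_apply, wedgeOne_apply, wedgeOne_apply, ← Finset.sum_add_distrib]
  refine Finset.sum_congr rfl fun i _ => ?_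
  have h2 : (μ + ν) p ![v i] = μ p ![v i] + ν p ![v i] := rfl
  rw [h2, _root_.map_add, mul_add]

section Smooth

variable [IsManifold 𝓘(ℝ, EP) ∞ P] [FiniteDimensional ℝ EP]

theorem IsSmoothForm.lieD [FiniteDimensional ℝ F] {k : ℕ} {α : Form EP P F (k + 1)}
    (hα : IsSmoothForm α) {X : P → EP} (hX : IsSmoothVec X) : IsSmoothForm (lieD X α) :=
  (hα.extD.iprod hX).add (hα.iprod hX).extD

theorem IsSmoothForm.lieDZero [FiniteDimensional ℝ F] {α : Form EP P F 0}
    (hα : IsSmoothForm α) {X : P → EP} (hX : IsSmoothVec X) : IsSmoothForm (lieDZero X α) :=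
  hα.extD.iprod hX

variable {B : PrincipalBundle EM EG EP M G P} {R : FieldReps EG G V n}

theorem constraints_smooth [FiniteDimensional ℝ EG] {E : DualFields EG EP P V n}
    (hE : E.IsTensorial B R)
    {ψ : Fields EG EP P V n} (hψ : ψ.IsDynamical B R) {X : P → EP} (hX : IsSmoothVec X) :
    IsSmoothForm (constraints E ψ X) :=
  ((hE.coframe.smooth.wedgeZero (hψ.coframe.smooth.iprod hX)).add
    (hE.connection.smooth.wedgeZero (hψ.connection.smooth.iprod hX))).smul _

/-- The Leibniz rule for the pairing of the equations of motion with the variation generated by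
a vector field: `𝓔_α ∧ L_X ψ^α = -B(X) - dC(X)`. -/
theorem wedge_lie [FiniteDimensional ℝ EG] {E : DualFields EG EP P V n} (hE : E.IsTensorial B R)
    {ψ : Fields EG EP P V n} (hψ : ψ.IsDynamical B R) {X : P → EP} (hX : IsSmoothVec X) :
    E.wedge (ψ.lie X) = -bianchi E ψ X - extD (constraints E ψ X) := by
  have h1 := hψ.coframe.smooth.iprod hX
  have h2 := hψ.connection.smooth.iprod hX
  unfold DualFields.wedge Fields.lie bianchi constraints lieD lieDZero
  rw [extD_smul, extD_add (hE.coframe.smooth.wedgeZero h1) (hE.connection.smooth.wedgeZero h2),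
    extD_wedgeZero hE.coframe.smooth h1, extD_wedgeZero hE.connection.smooth h2, wedgeOne_add,
    wedgeOne_add]
  have hs : (-1 : ℝ) ^ n * (-1) ^ n = 1 := by rw [← mul_pow]; simp
  simp only [smul_add, smul_smul, pow_succ, mul_neg_one, neg_smul, neg_mul, hs, one_smul]
  abel

end Smooth

variable {B : PrincipalBundle EM EG EP M G P} {R : FieldReps EG G V n}

/-- `X` is the initial velocity of a smooth family of automorphisms of the bundle. -/
structure IsGenerator (B : PrincipalBundle EM EG EP M G P)
    (f : ℝ → P ≃ₘ⟮𝓘(ℝ, EP), 𝓘(ℝ, EP)⟯ P) (X : P → EP) : Prop where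
  automorphism : ∀ t, B.IsAutomorphism (f t)
  deformation : IsDeformation (fun q : ℝ × P => f q.1 q.2) X

theorem pullForm_id {k : ℕ} (α : Form EP P F k) {f : P → P} (hf : ∀ p, f p = p) :
    pullForm f α = α := by
  obtain rfl : f = fun p => p := funext hf
  ext p v
  unfold pullForm
  rw [tanMap_id]
  rfl

variable [IsManifold 𝓘(ℝ, EP) ∞ P] [LieGroup 𝓘(ℝ, EG) ∞ G] [FiniteDimensional ℝ EP]
  [FiniteDimensional ℝ EG] [FiniteDimensional ℝ V]

namespace IsGenerator

variable {f : ℝ → P ≃ₘ⟮𝓘(ℝ, EP), 𝓘(ℝ, EP)⟯ P} {X : P → EP} (h : IsGenerator B f X)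
  {ψ : Fields EG EP P V n} (hψ : ψ.IsDynamical B R)

include h

theorem pull_zero : ψ.pull (f 0) = ψ := by
  have h0 : ∀ p, f 0 p = p := h.deformation.zero
  unfold Fields.pull
  rw [pullForm_id ψ.e h0, pullForm_id ψ.A h0, pullForm_id ψ.φ h0]

include hψ

theorem isDynamicalFamily : Fields.IsDynamicalFamily B R fun t => ψ.pull (f t) :=
  ⟨fun t => (h.automorphism t).isDynamical_pull hψ,
    h.deformation.isSmoothFormFamily hψ.coframe.smooth,
    h.deformation.isSmoothFormFamily hψ.connection.smooth,
    h.deformation.isSmoothFormFamily hψ.charged.smooth⟩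

theorem isFirstVariation : Fields.IsFirstVariation (fun t => ψ.pull (f t)) (ψ.lie X) :=
  ⟨h.deformation.hasDerivAt_pullForm hψ.coframe.smooth,
    h.deformation.hasDerivAt_pullForm hψ.connection.smooth,
    h.deformation.hasDerivAt_pullForm_zero hψ.charged.smooth⟩

/-- The Lie derivative of dynamical fields along a generated vector field inherits horizontality
and equivariance from the pulled back fields whose derivative it is. -/
theorem isVariation_lie : (ψ.lie X).IsVariation B R := by
  have hX := h.deformation.isSmoothVec
  have hf := h.isFirstVariation hψ
  have hd := (h.isDynamicalFamily hψ).dynamical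
  refine ⟨⟨hψ.coframe.smooth.lieD hX, ?_, ?_⟩, ⟨hψ.connection.smooth.lieD hX, ?_, ?_⟩,
    ⟨hψ.charged.smooth.lieDZero hX, ?_, ?_⟩⟩
  · exact PrincipalBundle.isHorizontal_of_hasDerivAt (fun t => (hd t).coframe.horizontal) hf.e
  · exact PrincipalBundle.isEquivariant_of_hasDerivAt (fun t => (hd t).coframe.equivariant) hf.e
  · -- the value of a connection on a fundamental vector does not vary
    refine PrincipalBundle.isHorizontal_of_cons fun p w v hw => ?_
    obtain ⟨ξ, rfl⟩ := B.exists_fundamental hw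
    have h1 := hf.A p ![B.fundamental ξ p]
    simp only [(hd _).connection.fundamental] at h1
    rw [Subsingleton.elim v ![]]
    exact h1.unique (hasDerivAt_const _ _)
  · exact PrincipalBundle.isEquivariant_of_hasDerivAt (fun t => (hd t).connection.equivariant) hf.A
  · exact PrincipalBundle.isHorizontal_of_hasDerivAt (fun t => (hd t).charged.horizontal) hf.φ
  · exact PrincipalBundle.isEquivariant_of_hasDerivAt (fun t => (hd t).charged.equivariant) hf.φ

end IsGenerator

theorem IsLagrangian.isTensorial {L : Fields EG EP P V n → Form EP P ℝ (n + 1)}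
    (hL : IsLagrangian B R L) {ψ : Fields EG EP P V n} (hψ : ψ.IsDynamical B R) :
    B.IsTensorial trivialRep (L ψ) := by
  refine ⟨?_, hL.horizontal ψ hψ, hL.invariant ψ hψ⟩
  have h1 := hL.smooth (fun _ => ψ) ⟨fun _ => hψ, hψ.coframe.smooth.isSmoothFormFamily_const,
    hψ.connection.smooth.isSmoothFormFamily_const, hψ.charged.smooth.isSmoothFormFamily_const⟩
  exact h1.isSmoothForm 0

/-- The Lagrangian form is closed, being the lift of a form of top degree on the base. -/
theorem IsLagrangian.extD_eq_zero [FiniteDimensional ℝ EM] (hdim : Module.finrank ℝ EM = n + 1)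
    {L : Fields EG EP P V n → Form EP P ℝ (n + 1)}
    (hL : IsLagrangian B R L) {ψ : Fields EG EP P V n} (hψ : ψ.IsDynamical B R) :
    extD (L ψ) = 0 :=
  (hL.isTensorial hψ).isHorizontal_extD.eq_zero_of_finrank_lt (by omega)

/-- **Noether identity** for a vector field generated by automorphisms: `d (J_X - C(X)) = B(X)`
for all dynamical fields. -/
theorem IsGenerator.extD_noetherCurrent_sub [FiniteDimensional ℝ EM]
    (hdim : Module.finrank ℝ EM = n + 1)
    {L : Fields EG EP P V n → Form EP P ℝ (n + 1)} (hL : IsLagrangian B R L)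
    {E : Fields EG EP P V n → DualFields EG EP P V n}
    (hE : ∀ ψ, ψ.IsDynamical B R → (E ψ).IsTensorial B R)
    {θ : Fields EG EP P V n → Fields EG EP P V n → Form EP P ℝ n}
    (hθ : IsSymplecticPotential B R L E θ)
    {f : ℝ → P ≃ₘ⟮𝓘(ℝ, EP), 𝓘(ℝ, EP)⟯ P} {X : P → EP} (h : IsGenerator B f X)
    {ψ : Fields EG EP P V n} (hψ : ψ.IsDynamical B R) :
    extD (noetherCurrent L θ ψ X - constraints (E ψ) ψ X) = bianchi (E ψ) ψ X := by
  have hX := h.deformation.isSmoothVec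
  have hLs := (hL.isTensorial hψ).smooth
  have hθs := hθ.smooth ψ (ψ.lie X) hψ (h.isVariation_lie hψ)
  -- by covariance, the variation of the Lagrangian is its Lie derivative
  have h1 : (E ψ).wedge (ψ.lie X) + extD (θ ψ (ψ.lie X)) = lieD X (L ψ) := by
    ext p v
    have h2 := hθ.variation _ _ (h.isDynamicalFamily hψ) (h.isFirstVariation hψ) p v
    rw [h.pull_zero] at h2
    have h3 := h.deformation.hasDerivAt_pullForm hLs p v
    have h4 : ∀ t, L (ψ.pull (f t)) = pullForm (fun q => f t q) (L ψ) :=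
      fun t => (hL.covariant (f t) (h.automorphism t) ψ hψ).symm
    simp only [h4] at h2
    exact h2.unique h3
  have h5 : iprod X (0 : Form EP P ℝ (n + 2)) = 0 := by
    ext p v
    simp [iprod]
  rw [wedge_lie (hE ψ hψ) hψ hX] at h1
  unfold lieD at h1
  rw [hL.extD_eq_zero hdim hψ, h5, zero_add] at h1
  unfold noetherCurrent
  rw [extD_sub (hθs.sub (hLs.iprod hX)) (constraints_smooth (hE ψ hψ) hψ hX),
    extD_sub hθs (hLs.iprod hX), ← h1]
  abel

theorem isHorizontal_wedgeOne {k : ℕ} {α : Form EP P (F →L[ℝ] ℝ) k} {μ : Form EP P F 1}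
    (hα : B.IsHorizontal α) (hμ : B.IsHorizontal μ) : B.IsHorizontal (wedgeOne α μ) := by
  rintro p v ⟨i, hi⟩
  rw [wedgeOne_apply]
  refine Finset.sum_eq_zero fun j _ => ?_
  by_cases hij : i = j
  · rw [hμ p ![v j] ⟨0, by simpa [← hij] using hi⟩, _root_.map_zero, mul_zero]
  · obtain ⟨l, hl⟩ := Fin.exists_succAbove_eq hij
    rw [hα p (j.removeNth v) ⟨l, by simpa [Fin.removeNth, hl] using hi⟩, _root_.zero_apply,
      mul_zero]

theorem DualFields.IsTensorial.isHorizontal_wedge {E : DualFields EG EP P V n}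
    (hE : E.IsTensorial B R) {χ : Fields EG EP P V n} (hχ : χ.IsVariation B R) :
    B.IsHorizontal (E.wedge χ) := by
  intro p v hv
  have h1 : wedgeZero E.φ χ.φ p v = 0 := by
    unfold wedgeZero
    simp [hE.charged.horizontal p v hv]
  change wedgeOne E.e χ.e p v + wedgeOne E.A χ.A p v + wedgeZero E.φ χ.φ p v = 0
  rw [isHorizontal_wedgeOne hE.coframe.horizontal hχ.coframe.horizontal p v hv,
    isHorizontal_wedgeOne hE.connection.horizontal hχ.connection.horizontal p v hv, h1]
  simp

theorem adRep_comp_inv (g : G) (ξ : EG) : adRep g (adRep g⁻¹ ξ : EG) = ξ := by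
  have hd : ∀ g h : G, MDifferentiableAt 𝓘(ℝ, EG) 𝓘(ℝ, EG) (fun h : G => g * h * g⁻¹) h := by
    intro g h
    have : ContMDiff 𝓘(ℝ, EG) 𝓘(ℝ, EG) ∞ (fun h : G => g * h * g⁻¹) :=
      (contMDiff_const.mul contMDiff_id).mul contMDiff_const
    exact this.mdifferentiableAt (by simp)
  have h1 := tanMap_comp_apply (p := (1 : G)) (g := fun h : G => g * h * g⁻¹)
    (f := fun h : G => g⁻¹ * h * g⁻¹⁻¹) (hd g _) (hd g⁻¹ 1) ξ
  have h2 : (fun h : G => g * (g⁻¹ * h * g⁻¹⁻¹) * g⁻¹) = fun h => h := by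
    ext h
    group
  have h3 : g⁻¹ * 1 * g⁻¹⁻¹ = 1 := by group
  rw [h2, h3, tanMap_id] at h1
  exact h1.symm

/-- The contraction of a dual equivariant form with the value of an equivariant `1`-form on an
invariant vector field is invariant. -/
theorem wedgeZero_iprod_act {X : P → EP} (hX : B.IsInfAutomorphism X) {k : ℕ} {ρ : G → F →L[ℝ] F}
    {α : Form EP P (F →L[ℝ] ℝ) k} {μ : Form EP P F 1} (hρ : ∀ g w, ρ g (ρ g⁻¹ w) = w)
    (hα : B.IsEquivariant (dualRep ρ) α) (hμ : B.IsEquivariant ρ μ) (g : G) (p : P)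
    (v : Fin k → EP) :
    wedgeZero α (iprod X μ) (B.act p g)
      (fun i => tanMap (EP := EP) (EN := EP) (fun q => B.act q g) p (v i)) =
      wedgeZero α (iprod X μ) p v := by
  have h1 : α (B.act p g)
      (fun i => tanMap (EP := EP) (EN := EP) (fun q => B.act q g) p (v i)) =
      (α p v).comp (ρ g⁻¹⁻¹) := congrArg (fun A => A v) (congrFun (hα g) p)
  have h2 : μ (B.act p g) (Matrix.vecCons (X (B.act p g)) ![]) = ρ g⁻¹ (μ p ![X p]) := by
    refine Eq.trans ?_ (congrArg (fun A => A ![X p]) (congrFun (hμ g) p))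
    rw [← hX.invariant]
    change μ (B.act p g) _ = μ (B.act p g) _
    congr 1
    ext i
    fin_cases i
    rfl
  have h3 : ∀ (p : P) (v : Fin k → EP),
    wedgeZero α (iprod X μ) p v = α p v (μ p ![X p]) := fun p v => rfl
  rw [h3, h3, h1, h2, inv_inv, ContinuousLinearMap.comp_apply, hρ]

/-- The constraints form a horizontal invariant form. -/
theorem constraints_isTensorial {E : DualFields EG EP P V n} (hE : E.IsTensorial B R)
    {ψ : Fields EG EP P V n} (hψ : ψ.IsDynamical B R) {X : P → EP} (hX : B.IsInfAutomorphism X) :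
    B.IsTensorial trivialRep (constraints E ψ X) := by
  refine ⟨constraints_smooth hE hψ (isSmoothVec_of_contMDiff hX.smooth), fun p v hv => ?_,
    fun g => ?_⟩
  · have h1 := hE.coframe.horizontal p v hv
    have h2 := hE.connection.horizontal p v hv
    simp [constraints, wedgeZero, h1, h2]
  · ext p v
    have he := wedgeZero_iprod_act hX (ρ := fun g => R.lorentz g) (fun g w => by
      rw [← mul_apply_eq_comp, ← _root_.map_mul, mul_inv_cancel, map_one]; rfl)
      hE.coframe.equivariant hψ.coframe.equivariant g p v
    have hA := wedgeZero_iprod_act hX (ρ := adRep) adRep_comp_inv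
      hE.connection.equivariant hψ.connection.equivariant g p v
    exact congrArg (fun r : ℝ => (-1 : ℝ) ^ (n + 1) • r) (congrArg₂ (· + ·) he hA)

/-- The Bianchi expression is horizontal as soon as the Lie derivative of the fields is a
variation. -/
theorem isHorizontal_bianchi {E : DualFields EG EP P V n} (hE : E.IsTensorial B R)
    {ψ : Fields EG EP P V n} (hψ : ψ.IsDynamical B R) {X : P → EP} (hX : B.IsInfAutomorphism X)
    (hlie : (ψ.lie X).IsVariation B R) : B.IsHorizontal (bianchi E ψ X) := by
  have h1 := wedge_lie hE hψ (isSmoothVec_of_contMDiff hX.smooth)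
  have h2 : bianchi E ψ X = -(E.wedge (ψ.lie X) + extD (constraints E ψ X)) := by
    rw [h1]; abel
  rw [h2]
  intro p v hv
  change -(E.wedge (ψ.lie X) p v + extD (constraints E ψ X) p v) = 0
  rw [hE.isHorizontal_wedge hlie p v hv,
    (constraints_isTensorial hE hψ hX).isHorizontal_extD p v hv]
  simp

end Noether

/-! ### Diffeomorphisms near the identity and bundle charts -/

section EuclideanDiffeomorphisms

variable {E : Type*} [NormedAddCommGroup E] [NormedSpace ℝ E] [CompleteSpace E]

/-- A smooth perturbation of the identity with Lipschitz constant less than `1` is a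
diffeomorphism. -/
theorem exists_contDiff_inverse_id_add {u : E → E} (hu : ContDiff ℝ ∞ u) {c : NNReal} (hc : c < 1)
    (hlip : LipschitzWith c u) :
    ∃ b : E → E, ContDiff ℝ ∞ b ∧ (∀ y, b (y + u y) = y) ∧ ∀ y, b y + u (b y) = y := by
  rcases subsingleton_or_nontrivial E with hE | hE
  · exact ⟨id, contDiff_id, fun y => Subsingleton.elim _ _, fun y => Subsingleton.elim _ _⟩
  have hA : ApproximatesLinearOn (fun y => y + u y)
      ((ContinuousLinearEquiv.refl ℝ E : E ≃L[ℝ] E) : E →L[ℝ] E) Set.univ c := by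
    intro x _ y _
    have h1 := hlip.dist_le_mul x y
    rw [dist_eq_norm, dist_eq_norm] at h1
    have h2 : x + u x - (y + u y) - (x - y) = u x - u y := by abel
    simpa [h2] using h1
  have hN : c < ‖((ContinuousLinearEquiv.refl ℝ E).symm : E →L[ℝ] E)‖₊⁻¹ := by
    have h1 : ‖((ContinuousLinearEquiv.refl ℝ E).symm : E →L[ℝ] E)‖₊ = 1 := by
      simp [ContinuousLinearMap.nnnorm_id]
    rw [h1, inv_one]
    exact hc
  let g : E ≃ₜ E := hA.toHomeomorph _ (Or.inr hN)
  have hg : ∀ y, g y = y + u y := fun y => rfl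
  have hnorm : ∀ y, ‖-fderiv ℝ u y‖ < 1 := by
    intro y
    rw [norm_neg]
    exact (norm_fderiv_le_of_lipschitz ℝ hlip).trans_lt hc
  refine ⟨g.symm, ?_, fun y => g.symm_apply_apply y, fun y => g.apply_symm_apply y⟩
  refine g.contDiff_symm (f₀' := fun y => ContinuousLinearEquiv.ofUnit (Units.oneSub _ (hnorm y)))
    (fun y => ?_) (contDiff_id.add hu)
  have h1 := (hasFDerivAt_id y).add (hu.differentiable (by simp) y).hasFDerivAt
  refine h1.congr_fderiv ?_
  ext v
  have h2 : (ContinuousLinearEquiv.ofUnit (Units.oneSub _ (hnorm y)) : E →L[ℝ] E) v =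
    ((Units.oneSub _ (hnorm y) : (E →L[ℝ] E)ˣ) : E →L[ℝ] E) v := rfl
  rw [h2, Units.val_oneSub]
  simp

/-- The maps `y ↦ y + s t • w y` for a compactly supported field `w` are diffeomorphisms for all
`t`, after a reparametrization `s` of the time which keeps it small. -/
theorem exists_reparametrization {w : E → E} (hw : ContDiff ℝ ∞ w) (hc : HasCompactSupport w) :
    ∃ s : ℝ → ℝ, ContDiff ℝ ∞ s ∧ s 0 = 0 ∧ HasDerivAt s 1 0 ∧
      ∀ t, ∃ b : E → E, ContDiff ℝ ∞ b ∧ (∀ y, b (y + s t • w y) = y) ∧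
        ∀ y, b y + s t • w (b y) = y := by
  obtain ⟨K, hK⟩ := hw.lipschitzWith_of_hasCompactSupport hc (by simp)
  set ε : ℝ := (K + 1 : ℝ)⁻¹ with hε
  have hε0 : 0 < ε := by positivity
  -- `|s| ≤ ε < K⁻¹` makes `s t • w` a contraction, and `s` has derivative `1` at `0`
  refine ⟨fun t => ε * Real.sin (t / ε), ?_, by simp, ?_, fun t => ?_⟩
  · exact contDiff_const.mul (Real.contDiff_sin.comp (contDiff_id.div_const _))
  · have h1 : HasDerivAt (fun t : ℝ => t / ε) (1 / ε) 0 := (hasDerivAt_id 0).div_const ε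
    have h2 := (h1.sin).const_mul ε
    simpa [hε0.ne'] using h2
  · set c : ℝ := ε * Real.sin (t / ε)
    have hcε : ‖c‖ ≤ ε := by
      rw [norm_mul, Real.norm_of_nonneg hε0.le]
      exact mul_le_of_le_one_right hε0.le (Real.abs_sin_le_one _)
    refine exists_contDiff_inverse_id_add (u := fun y => c • w y) (c := ‖c‖₊ * K)
      (contDiff_const.smul hw) ?_ ?_
    · rw [← NNReal.coe_lt_coe]
      push_cast
      calc ‖c‖ * K ≤ ε * K := by gcongr
        _ < ε * (K + 1) := by gcongr; linarith
        _ = 1 := by rw [hε]; field_simp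
    · exact (lipschitzWith_smul c).comp hK

end EuclideanDiffeomorphisms

section BundleCharts

variable {EM EG EP M G P : Type*}
  [NormedAddCommGroup EM] [NormedSpace ℝ EM] [NormedAddCommGroup EG] [NormedSpace ℝ EG]
  [NormedAddCommGroup EP] [NormedSpace ℝ EP]
  [TopologicalSpace M] [ChartedSpace EM M] [TopologicalSpace G] [ChartedSpace EG G] [Group G]
  [TopologicalSpace P] [ChartedSpace EP P]

/-- A local trivialization of a principal bundle over a coordinate domain of the base: the
`G`-invariant open set `dom` is identified with `W × G`, `W` open in the model space, through the
coordinates `coord` of the base point and the group component `comp`; `sec` is the section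
`comp = 1`.  The field `isClosed_preimage` allows data with compact support in `W` to be extended to
all of `P`; it holds because the base is Hausdorff. -/
structure BundleChart (B : PrincipalBundle EM EG EP M G P) where
  dom : Set P
  W : Set EM
  coord : P → EM
  comp : P → G
  sec : EM → P
  isOpen_dom : IsOpen dom
  isOpen_W : IsOpen W
  mapsTo_coord : ∀ p ∈ dom, coord p ∈ W
  mapsTo_sec : ∀ y ∈ W, sec y ∈ dom
  coord_sec : ∀ y ∈ W, coord (sec y) = y
  comp_sec : ∀ y ∈ W, comp (sec y) = 1
  act_mem : ∀ p ∈ dom, ∀ g, B.act p g ∈ dom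
  coord_act : ∀ p ∈ dom, ∀ g, coord (B.act p g) = coord p
  comp_act : ∀ p ∈ dom, ∀ g, comp (B.act p g) = comp p * g
  act_sec : ∀ p ∈ dom, B.act (sec (coord p)) (comp p) = p
  smooth_coord : ContMDiffOn 𝓘(ℝ, EP) 𝓘(ℝ, EM) ∞ coord dom
  smooth_comp : ContMDiffOn 𝓘(ℝ, EP) 𝓘(ℝ, EG) ∞ comp dom
  smooth_sec : ContMDiffOn 𝓘(ℝ, EM) 𝓘(ℝ, EP) ∞ sec W
  isClosed_preimage : ∀ K ⊆ W, IsCompact K → IsClosed (dom ∩ coord ⁻¹' K)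
  isVertical_of_coord : ∀ p ∈ dom, ∀ v, tanMap (EP := EP) (EN := EM) coord p v = 0 →
    B.IsVertical p v

/-- Every point of the bundle lies on the section of some bundle chart. -/
theorem exists_bundleChart [T2Space M] [IsManifold 𝓘(ℝ, EM) ∞ M] [LieGroup 𝓘(ℝ, EG) ∞ G]
    (B : PrincipalBundle EM EG EP M G P) (p₀ : P) :
    ∃ C : BundleChart B, p₀ ∈ C.dom ∧ C.sec (C.coord p₀) = p₀ := by
  obtain ⟨U, σ, τ, hU, hxU, hσ, hτ, hστ, hτg, hact⟩ := B.exists_trivialization (B.proj p₀)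
  let φ := extChartAt 𝓘(ℝ, EM) (B.proj p₀)
  let g₀ := τ p₀
  have hπ : Continuous B.proj := B.contMDiff_proj.continuous
  let O : Set M := (chartAt EM (B.proj p₀)).source ∩ U
  have hO : IsOpen O := (chartAt EM (B.proj p₀)).open_source.inter hU
  have hleft : ∀ x ∈ O, φ.symm (φ x) = x := fun x hx => extChartAt_symm_apply_apply hx.1
  have hW : IsOpen (φ.target ∩ φ.symm ⁻¹' U) :=
    (continuousOn_extChartAt_symm (B.proj p₀)).isOpen_inter_preimage (isOpen_extChartAt_target _) hU
  have hmem : ∀ y ∈ φ.target ∩ φ.symm ⁻¹' U, φ.symm y ∈ O :=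
    fun y hy => ⟨extChartAt_symm_mem_source hy.1, hy.2⟩
  have hproj : ∀ y ∈ φ.target ∩ φ.symm ⁻¹' U, B.proj (B.act (σ (φ.symm y)) g₀) = φ.symm y :=
    fun y hy => by rw [B.proj_act, (hστ _ hy.2).1]
  refine ⟨{
    dom := B.proj ⁻¹' O
    W := φ.target ∩ φ.symm ⁻¹' U
    coord := fun p => φ (B.proj p)
    comp := fun p => g₀⁻¹ * τ p
    sec := fun y => B.act (σ (φ.symm y)) g₀
    isOpen_dom := hO.preimage hπ
    isOpen_W := hW
    mapsTo_coord := fun p hp => ⟨extChartAt_mem_target hp.1, by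
      change φ.symm (φ (B.proj p)) ∈ U
      rw [hleft _ hp]
      exact hp.2⟩
    mapsTo_sec := fun y hy => by
      change B.proj (B.act (σ (φ.symm y)) g₀) ∈ O
      rw [hproj y hy]
      exact hmem y hy
    coord_sec := fun y hy => by
      rw [hproj y hy]
      exact φ.right_inv hy.1
    comp_sec := fun y hy => by
      have h1 : σ (φ.symm y) ∈ B.proj ⁻¹' U := by
        change B.proj _ ∈ U
        rw [(hστ _ hy.2).1]
        exact hy.2
      change g₀⁻¹ * τ (B.act (σ (φ.symm y)) g₀) = 1
      rw [hτg _ h1, (hστ _ hy.2).2]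
      group
    act_mem := fun p hp g => by
      change B.proj (B.act p g) ∈ O
      rw [B.proj_act]
      exact hp
    coord_act := fun p hp g => by
      rw [B.proj_act]
    comp_act := fun p hp g => by
      rw [hτg p hp.2, mul_assoc]
    act_sec := fun p hp => by
      rw [hleft _ hp, ← B.act_mul, mul_inv_cancel_left, hact p hp.2]
    smooth_coord := (contMDiffOn_extChartAt (n := ∞)).comp B.contMDiff_proj.contMDiffOn
      fun p hp => hp.1
    smooth_comp := contMDiffOn_const.mul (hτ.mono fun p hp => hp.2)
    smooth_sec := (B.contMDiff_act_right g₀).comp_contMDiffOn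
      (hσ.comp ((contMDiffOn_extChartAt_symm _).mono fun y hy => hy.1) fun y hy => hy.2)
    isClosed_preimage := fun K hK hKc => by
      have h1 : B.proj ⁻¹' O ∩ (fun p => φ (B.proj p)) ⁻¹' K = B.proj ⁻¹' (φ.symm '' K) := by
        ext p
        constructor
        · rintro ⟨hp, hpK⟩
          exact ⟨_, hpK, hleft _ hp⟩
        · rintro ⟨y, hy, hyp⟩
          have hpO : B.proj p ∈ O := by
            rw [← hyp]
            exact hmem y (hK hy)
          refine ⟨hpO, ?_⟩
          change φ (B.proj p) ∈ K
          rw [← hyp]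
          rwa [φ.right_inv (hK hy).1]
      rw [h1]
      refine IsClosed.preimage hπ (IsCompact.isClosed (hKc.image_of_continuousOn ?_))
      exact (continuousOn_extChartAt_symm (B.proj p₀)).mono fun y hy => (hK hy).1
    isVertical_of_coord := fun p hp v hv => by
      have h1 := tanMap_comp_apply (p := p) (g := φ) (f := B.proj)
        (mdifferentiableAt_extChartAt' hp.1) (B.mdifferentiableAt_proj p) v
      have h2 := tanMap_extChartAt_symm_comp hp.1 (tanMap (EP := EP) (EN := EM) B.proj p v)
      rw [← h1] at h2
      rw [show tanMap (EP := EP) (EN := EM) (fun q => φ (B.proj q)) p v = 0 from hv,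
        _root_.map_zero] at h2
      exact h2.symm }, ⟨mem_chart_source EM _, hxU⟩, ?_⟩
  change B.act (σ (φ.symm (φ (B.proj p₀)))) g₀ = p₀
  rw [hleft _ ⟨mem_chart_source EM _, hxU⟩]
  exact hact p₀ hxU

end BundleCharts

/-! ### Automorphisms supported in a bundle chart -/

section LocalAutomorphisms

variable {EM EG EP M G P : Type*}
  [NormedAddCommGroup EM] [NormedSpace ℝ EM] [NormedAddCommGroup EG] [NormedSpace ℝ EG]
  [NormedAddCommGroup EP] [NormedSpace ℝ EP]
  [TopologicalSpace M] [ChartedSpace EM M] [TopologicalSpace G] [ChartedSpace EG G] [Group G]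
  [TopologicalSpace P] [ChartedSpace EP P]
  {B : PrincipalBundle EM EG EP M G P}

namespace BundleChart

variable (C : BundleChart B)

open Classical in
/-- The bundle map given by `(y, g) ↦ (b y, c y * g)` in a bundle chart, extended by the identity
outside of the chart domain. -/
def gaugeMap (b : EM → EM) (c : EM → G) (p : P) : P :=
  if p ∈ C.dom then B.act (C.sec (b (C.coord p))) (c (C.coord p) * C.comp p) else p

variable {C} {b b' : EM → EM} {c c' : EM → G}

theorem gaugeMap_of_mem {p : P} (hp : p ∈ C.dom) :
    C.gaugeMap b c p = B.act (C.sec (b (C.coord p))) (c (C.coord p) * C.comp p) := if_pos hp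

theorem act_mem_iff {p : P} {g : G} : B.act p g ∈ C.dom ↔ p ∈ C.dom :=
  ⟨fun h => by simpa [B.act_act_inv] using C.act_mem _ h g⁻¹, fun h => C.act_mem _ h g⟩

theorem gaugeMap_act (p : P) (g : G) : C.gaugeMap b c (B.act p g) = B.act (C.gaugeMap b c p) g := by
  by_cases hp : p ∈ C.dom
  · rw [gaugeMap_of_mem hp, gaugeMap_of_mem (C.act_mem p hp g), C.coord_act p hp, C.comp_act p hp,
      ← B.act_mul, mul_assoc]
  · simp [gaugeMap, hp, act_mem_iff]

theorem gaugeMap_gaugeMap (hb : Set.MapsTo b C.W C.W) (hbb : ∀ y ∈ C.W, b' (b y) = y)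
    (hcc : ∀ y ∈ C.W, c' (b y) * c y = 1) (p : P) :
    C.gaugeMap b' c' (C.gaugeMap b c p) = p := by
  by_cases hp : p ∈ C.dom
  · have hy := C.mapsTo_coord p hp
    have hs := C.mapsTo_sec _ (hb hy)
    rw [gaugeMap_of_mem hp, gaugeMap_of_mem (C.act_mem _ hs _), C.coord_act _ hs, C.comp_act _ hs,
      C.coord_sec _ (hb hy), C.comp_sec _ (hb hy), hbb _ hy, one_mul, ← mul_assoc, hcc _ hy,
      one_mul, C.act_sec p hp]
  · simp [gaugeMap, hp]

theorem gaugeMap_eq_self {p : P} (hb : b (C.coord p) = C.coord p) (hc : c (C.coord p) = 1) :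
    C.gaugeMap b c p = p := by
  by_cases hp : p ∈ C.dom
  · rw [gaugeMap_of_mem hp, hb, hc, one_mul, C.act_sec p hp]
  · exact if_neg hp

/-- Bundle maps given in a bundle chart by smooth data of compact support are smooth, jointly
with respect to parameters. -/
theorem contMDiff_gaugeMap [LieGroup 𝓘(ℝ, EG) ∞ G] {b : ℝ × EM → EM} {c : ℝ × EM → G} {K : Set EM}
    (hK : IsCompact K) (hKW : K ⊆ C.W) (hb : ContDiff ℝ ∞ b)
    (hc : ∀ t, ∀ y ∈ C.W, ContMDiffAt 𝓘(ℝ, ℝ × EM) 𝓘(ℝ, EG) ∞ c (t, y))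
    (hbW : ∀ t, Set.MapsTo (fun y => b (t, y)) C.W C.W)
    (hbK : ∀ t, ∀ y ∉ K, b (t, y) = y) (hcK : ∀ t, ∀ y ∉ K, c (t, y) = 1) :
    ContMDiff (𝓘(ℝ, ℝ).prod 𝓘(ℝ, EP)) 𝓘(ℝ, EP) ∞
      (fun q : ℝ × P => C.gaugeMap (fun y => b (q.1, y)) (fun y => c (q.1, y)) q.2) := by
  rintro ⟨t, p⟩
  by_cases hp : p ∈ C.dom
  · have hev : ∀ᶠ q in 𝓝 (t, p), q.2 ∈ C.dom :=
      continuousAt_snd.preimage_mem_nhds (C.isOpen_dom.mem_nhds hp)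
    have hy := C.mapsTo_coord p hp
    have hcoord : ContMDiffAt (𝓘(ℝ, ℝ).prod 𝓘(ℝ, EP)) 𝓘(ℝ, EM) ∞
        (fun q : ℝ × P => C.coord q.2) (t, p) :=
      ContMDiffAt.comp (I' := 𝓘(ℝ, EP)) (t, p) (g := C.coord)
        (C.smooth_coord.contMDiffAt (C.isOpen_dom.mem_nhds hp)) contMDiffAt_snd
    have hcomp : ContMDiffAt (𝓘(ℝ, ℝ).prod 𝓘(ℝ, EP)) 𝓘(ℝ, EG) ∞
        (fun q : ℝ × P => C.comp q.2) (t, p) :=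
      ContMDiffAt.comp (I' := 𝓘(ℝ, EP)) (t, p) (g := C.comp)
        (C.smooth_comp.contMDiffAt (C.isOpen_dom.mem_nhds hp)) contMDiffAt_snd
    have hpair : ContMDiffAt (𝓘(ℝ, ℝ).prod 𝓘(ℝ, EP)) 𝓘(ℝ, ℝ × EM) ∞
        (fun q : ℝ × P => (q.1, C.coord q.2)) (t, p) :=
      contMDiffAt_fst.prodMk_space hcoord
    have hbc : ContMDiffAt (𝓘(ℝ, ℝ).prod 𝓘(ℝ, EP)) 𝓘(ℝ, EM) ∞
        (fun q : ℝ × P => b (q.1, C.coord q.2)) (t, p) :=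
      ContMDiffAt.comp (I' := 𝓘(ℝ, ℝ × EM)) (t, p) (g := b) hb.contDiffAt.contMDiffAt hpair
    have hcc : ContMDiffAt (𝓘(ℝ, ℝ).prod 𝓘(ℝ, EP)) 𝓘(ℝ, EG) ∞
        (fun q : ℝ × P => c (q.1, C.coord q.2)) (t, p) :=
      ContMDiffAt.comp (I' := 𝓘(ℝ, ℝ × EM)) (t, p) (g := c) (hc t _ hy) hpair
    have hsec : ContMDiffAt (𝓘(ℝ, ℝ).prod 𝓘(ℝ, EP)) 𝓘(ℝ, EP) ∞
        (fun q : ℝ × P => C.sec (b (q.1, C.coord q.2))) (t, p) :=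
      ContMDiffAt.comp (I' := 𝓘(ℝ, EM)) (t, p) (g := C.sec)
        (C.smooth_sec.contMDiffAt (C.isOpen_W.mem_nhds (hbW t hy))) hbc
    have h1 := ContMDiffAt.comp (I' := 𝓘(ℝ, EP).prod 𝓘(ℝ, EG)) (t, p)
      (g := fun q : P × G => B.act q.1 q.2) (B.contMDiff_act _) (hsec.prodMk (hcc.mul hcomp))
    refine h1.congr_of_eventuallyEq ?_
    filter_upwards [hev] with q hq
    exact gaugeMap_of_mem hq
  · have hcl := C.isClosed_preimage K hKW hK
    have hev : ∀ᶠ q in 𝓝 (t, p), q.2 ∉ C.dom ∩ C.coord ⁻¹' K :=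
      continuousAt_snd.preimage_mem_nhds (hcl.isOpen_compl.mem_nhds fun h => hp h.1)
    refine contMDiffAt_snd.congr_of_eventuallyEq ?_
    filter_upwards [hev] with q hq
    by_cases hqd : q.2 ∈ C.dom
    · have hqK : C.coord q.2 ∉ K := fun h => hq ⟨hqd, h⟩
      exact gaugeMap_eq_self (hbK _ _ hqK) (hcK _ _ hqK)
    · exact if_neg hqd

theorem eq_self_of_inverse {K : Set EM} (hbK : ∀ y ∉ K, b y = y) (hbb : ∀ y, b' (b y) = y) :
    ∀ y ∉ K, b' y = y := fun y hy => by
  conv_lhs => rw [← hbK y hy]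
  exact hbb y

theorem mapsTo_of_support {W K : Set EM} (hKW : K ⊆ W) (hbK : ∀ y ∉ K, b y = y)
    (hbb : ∀ y, b' (b y) = y) : Set.MapsTo b W W := fun y hy => by
  by_contra h
  have h1 : b (b y) = b y := hbK _ fun hK => h (hKW hK)
  have h2 := hbb (b y)
  rw [h1, hbb] at h2
  exact h (h2 ▸ hy)

open Classical in
variable (C) in
/-- The vector field `X` multiplied by the function `h` of the base coordinates, and extended by
zero outside of the chart domain. -/
def localize (h : EM → ℝ) (X : P → EP) (p : P) : EP :=
  if p ∈ C.dom then h (C.coord p) • X p else 0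

theorem tanMap_coord_sec {y : EM} (hy : y ∈ C.W) (v : EM) :
    tanMap (EP := EP) (EN := EM) C.coord (C.sec y)
      (tanMap (EP := EM) (EN := EP) C.sec y v) = v := by
  have hs := C.mapsTo_sec y hy
  rw [← tanMap_comp_apply
    ((C.smooth_coord.contMDiffAt (C.isOpen_dom.mem_nhds hs)).mdifferentiableAt (by simp))
    ((C.smooth_sec.contMDiffAt (C.isOpen_W.mem_nhds hy)).mdifferentiableAt (by simp))]
  have h1 : (fun z => C.coord (C.sec z)) =ᶠ[𝓝 y] fun z => z := by
    filter_upwards [C.isOpen_W.mem_nhds hy] with z hz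
    exact C.coord_sec z hz
  rw [tanMap_congr h1, tanMap_id]
  rfl

/-- On the section, a tangent vector is the sum of the lift of its projection and of the
fundamental vector given by the group component. -/
theorem tanMap_sec_add_fundamental {y : EM} (hy : y ∈ C.W) (v : EP) :
    tanMap (EP := EM) (EN := EP) C.sec y (tanMap (EP := EP) (EN := EM) C.coord (C.sec y) v) +
      B.fundamental (tanMap (EP := EP) (EN := EG) C.comp (C.sec y) v) (C.sec y) = v := by
  have hs := C.mapsTo_sec y hy
  have hcd : MDifferentiableAt 𝓘(ℝ, EP) 𝓘(ℝ, EM) C.coord (C.sec y) :=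
    (C.smooth_coord.contMDiffAt (C.isOpen_dom.mem_nhds hs)).mdifferentiableAt (by simp)
  have hsd : MDifferentiableAt 𝓘(ℝ, EM) 𝓘(ℝ, EP) C.sec (C.coord (C.sec y)) := by
    rw [C.coord_sec y hy]
    exact (C.smooth_sec.contMDiffAt (C.isOpen_W.mem_nhds hy)).mdifferentiableAt (by simp)
  have h1 := B.tanMap_act (q := C.sec y) (s := fun p => C.sec (C.coord p)) (τ := C.comp)
    (MDifferentiableAt.comp (I' := 𝓘(ℝ, EM)) _ hsd hcd)
    ((C.smooth_comp.contMDiffAt (C.isOpen_dom.mem_nhds hs)).mdifferentiableAt (by simp)) v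
  have h2 : (fun p => B.act (C.sec (C.coord p)) (C.comp p)) =ᶠ[𝓝 (C.sec y)] fun p => p := by
    filter_upwards [C.isOpen_dom.mem_nhds hs] with p hp
    exact C.act_sec p hp
  rw [tanMap_congr h2, tanMap_id, tanMap_comp_apply (g := C.sec) hsd hcd, C.coord_sec y hy,
    C.comp_sec y hy] at h1
  simp only [B.act_one] at h1
  rw [tanMap_id] at h1
  exact h1.symm

variable [IsManifold 𝓘(ℝ, EP) ∞ P] [LieGroup 𝓘(ℝ, EG) ∞ G]
  [FiniteDimensional ℝ EM] [FiniteDimensional ℝ EG]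

theorem contDiff_smul_of_tsupport {E : Type*} [NormedAddCommGroup E] [NormedSpace ℝ E] {W : Set EM}
    {h : EM → ℝ} (hh : ContDiff ℝ ∞ h) (hhW : tsupport h ⊆ W) {u : EM → E}
    (hu : ∀ y ∈ W, ContDiffAt ℝ ∞ u y) : ContDiff ℝ ∞ fun y => h y • u y := by
  rw [contDiff_iff_contDiffAt]
  intro y
  by_cases hy : y ∈ W
  · exact hh.contDiffAt.smul (hu y hy)
  · have h1 : (fun y => h y • u y) =ᶠ[𝓝 y] fun _ => 0 := by
      filter_upwards [(isClosed_tsupport h).isOpen_compl.mem_nhds fun hy' => hy (hhW hy')] with z hz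
      rw [image_eq_zero_of_notMem_tsupport hz, zero_smul]
    exact contDiffAt_const.congr_of_eventuallyEq h1

/-- An infinitesimal automorphism cut off in a bundle chart is generated by automorphisms: move
the base point along the cut off base component and multiply by a curve in `G` tangent to the cut
off vertical component. -/
theorem exists_isGenerator {X : P → EP} (hX : B.IsInfAutomorphism X) {h : EM → ℝ}
    (hh : ContDiff ℝ ∞ h) (hhc : HasCompactSupport h) (hhW : tsupport h ⊆ C.W) :
    ∃ f, IsGenerator B f (C.localize h X) := by
  have hXs := isSmoothVec_of_contMDiff hX.smooth
  have hsecs : ∀ y ∈ C.W, ContMDiffAt 𝓘(ℝ, EM) 𝓘(ℝ, EP) ∞ C.sec y :=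
    fun y hy => C.smooth_sec.contMDiffAt (C.isOpen_W.mem_nhds hy)
  let w : EM → EM := fun y => h y • tanMap (EP := EP) (EN := EM) C.coord (C.sec y) (X (C.sec y))
  let ξ : EM → EG := fun y => h y • tanMap (EP := EP) (EN := EG) C.comp (C.sec y) (X (C.sec y))
  have hw : ContDiff ℝ ∞ w := contDiff_smul_of_tsupport hh hhW fun y hy =>
    contDiffAt_tanMap_vec hXs (hsecs y hy)
      (C.smooth_coord.contMDiffAt (C.isOpen_dom.mem_nhds (C.mapsTo_sec y hy)))
  have hξ : ContDiff ℝ ∞ ξ := by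
    refine contDiff_smul_of_tsupport hh hhW fun y hy => ?_
    have hcs := C.smooth_comp.contMDiffAt (C.isOpen_dom.mem_nhds (C.mapsTo_sec y hy))
    -- the chart of `G` at `1` has tangent map the identity at `1`
    have h1 : ContMDiffAt 𝓘(ℝ, EP) 𝓘(ℝ, EG) ∞
        (fun p => extChartAt 𝓘(ℝ, EG) (1 : G) (C.comp p)) (C.sec y) := by
      refine ContMDiffAt.comp (I' := 𝓘(ℝ, EG)) _ ?_ hcs
      rw [C.comp_sec y hy]
      exact contMDiffAt_extChartAt
    refine (contDiffAt_tanMap_vec hXs (hsecs y hy) h1).congr_of_eventuallyEq ?_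
    filter_upwards [C.isOpen_W.mem_nhds hy] with z hz
    have hcz := C.smooth_comp.contMDiffAt (C.isOpen_dom.mem_nhds (C.mapsTo_sec z hz))
    rw [tanMap_comp_apply (g := extChartAt 𝓘(ℝ, EG) (1 : G)) (by
      rw [C.comp_sec z hz]
      exact mdifferentiableAt_extChartAt' (mem_chart_source EG 1))
      (hcz.mdifferentiableAt (by simp)), C.comp_sec z hz, tanMap_extChartAt_self]
    rfl
  have hwK : ∀ y ∉ tsupport h, w y = 0 := fun y hy => by
    simp [w, image_eq_zero_of_notMem_tsupport hy]
  have hξK : ∀ y ∉ tsupport h, ξ y = 0 := fun y hy => by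
    simp [ξ, image_eq_zero_of_notMem_tsupport hy]
  obtain ⟨s, hs, hs0, hsd, hinv⟩ := exists_reparametrization hw
    (HasCompactSupport.intro hhc hwK)
  choose b' hb's hb'l hb'r using hinv
  obtain ⟨a, ha, ha0, had⟩ := exists_localExp EG G
  let b : ℝ × EM → EM := fun q => q.2 + s q.1 • w q.2
  let c : ℝ × EM → G := fun q => a (s q.1 • ξ q.2)
  have hb : ContDiff ℝ ∞ b :=
    contDiff_snd.add ((hs.comp contDiff_fst).smul (hw.comp contDiff_snd))
  have hc : ContMDiff 𝓘(ℝ, ℝ × EM) 𝓘(ℝ, EG) ∞ c :=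
    ha.comp ((hs.comp contDiff_fst).smul (hξ.comp contDiff_snd)).contMDiff
  have hbK : ∀ t, ∀ y ∉ tsupport h, b (t, y) = y := fun t y hy => by simp [b, hwK y hy]
  have hcK : ∀ t, ∀ y ∉ tsupport h, c (t, y) = 1 := fun t y hy => by simp [c, hξK y hy, ha0]
  have hb'K : ∀ t, ∀ y ∉ tsupport h, b' t y = y :=
    fun t => eq_self_of_inverse (hbK t) (hb'l t)
  have hbW : ∀ t, Set.MapsTo (fun y => b (t, y)) C.W C.W :=
    fun t => mapsTo_of_support hhW (hbK t) (hb'l t)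
  have hb'W : ∀ t, Set.MapsTo (b' t) C.W C.W :=
    fun t => mapsTo_of_support hhW (hb'K t) (b' := fun y => b (t, y)) (hb'r t)
  have hc'K : ∀ t, ∀ y ∉ tsupport h, (c (t, b' t y))⁻¹ = 1 := fun t y hy => by
    rw [hb'K t y hy, hcK t y hy, inv_one]
  have hΦ := contMDiff_gaugeMap hhc hhW hb (fun t y _ => hc (t, y)) hbW hbK hcK
  have hΦ' : ∀ t, ContMDiff 𝓘(ℝ, EP) 𝓘(ℝ, EP) ∞
      (C.gaugeMap (b' t) fun y => (c (t, b' t y))⁻¹) := by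
    intro t
    have h1 := contMDiff_gaugeMap (C := C) (b := fun q : ℝ × EM => b' t q.2)
      (c := fun q : ℝ × EM => (c (t, b' t q.2))⁻¹) hhc hhW ((hb's t).comp contDiff_snd)
      (fun r y _ => ContMDiff.contMDiffAt (ContMDiff.inv (hc.comp
        (contDiff_const.prodMk ((hb's t).comp contDiff_snd)).contMDiff)))
      (fun _ => hb'W t) (fun _ => hb'K t) (fun _ => hc'K t)
    exact h1.comp (contMDiff_const (c := (0 : ℝ)) |>.prodMk contMDiff_id)
  let f : ℝ → P ≃ₘ⟮𝓘(ℝ, EP), 𝓘(ℝ, EP)⟯ P := fun t =>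
    { toFun := C.gaugeMap (fun y => b (t, y)) fun y => c (t, y)
      invFun := C.gaugeMap (b' t) fun y => (c (t, b' t y))⁻¹
      left_inv := gaugeMap_gaugeMap (hbW t) (fun y _ => hb'l t y) fun y _ => by
        have : b' t (b (t, y)) = y := hb'l t y
        simp [this]
      right_inv := gaugeMap_gaugeMap (hb'W t) (fun y _ => hb'r t y) fun y _ => by simp
      contMDiff_toFun := hΦ.comp (contMDiff_const.prodMk contMDiff_id)
      contMDiff_invFun := hΦ' t }
  refine ⟨f, fun t p g =>
    gaugeMap_act (b := fun y => b (t, y)) (c := fun y => c (t, y)) p g,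
    ⟨hΦ, fun p => ?_, fun p => ?_⟩⟩
  · exact gaugeMap_eq_self (b := fun y => b (0, y)) (c := fun y => c (0, y))
      (by simp [b, hs0]) (by simp [c, hs0, ha0])
  · change tanMap (EP := ℝ) (EN := EP)
      (fun t : ℝ => C.gaugeMap (fun y => b (t, y)) (fun y => c (t, y)) p) 0 1 = _
    by_cases hp : p ∈ C.dom
    · simp only [gaugeMap_of_mem hp, localize, if_pos hp]
      set y := C.coord p with hy
      have hyW : y ∈ C.W := C.mapsTo_coord p hp
      set g := C.comp p with hg
      have hpy : B.act (C.sec y) g = p := C.act_sec p hp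
      have hbd : HasDerivAt (fun t => b (t, y)) (w y) 0 := by
        simpa [b] using (hsd.smul_const (w y)).const_add y
      have hζ : HasDerivAt (fun t => s t • ξ y) (ξ y) 0 := by
        simpa using hsd.smul_const (ξ y)
      have hb0 : b (0, y) = y := by simp [b, hs0]
      have hc0 : c (0, y) = 1 := by simp [c, hs0, ha0]
      have hcv : tanMap (EP := ℝ) (EN := EG) (fun t : ℝ => c (t, y)) 0 1 = ξ y :=
        tanMap_comp_localExp ha had hζ (by simp [hs0])
      have hcd : MDifferentiableAt 𝓘(ℝ, ℝ) 𝓘(ℝ, EG) (fun t : ℝ => c (t, y)) 0 := by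
        have h1 : ContMDiff 𝓘(ℝ, ℝ) 𝓘(ℝ, EG) ∞ (fun t : ℝ => c (t, y)) :=
          hc.comp (contDiff_id.prodMk contDiff_const).contMDiff
        exact h1.mdifferentiableAt (by simp)
      have hsd' : MDifferentiableAt 𝓘(ℝ, EM) 𝓘(ℝ, EP) C.sec (b (0, y)) := by
        rw [hb0]
        exact (hsecs y hyW).mdifferentiableAt (by simp)
      have hbm : MDifferentiableAt 𝓘(ℝ, ℝ) 𝓘(ℝ, EM) (fun t : ℝ => b (t, y)) 0 :=
        hbd.differentiableAt.mdifferentiableAt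
      have hsm : MDifferentiableAt 𝓘(ℝ, ℝ) 𝓘(ℝ, EP) (fun t : ℝ => C.sec (b (t, y))) 0 :=
        MDifferentiableAt.comp (I' := 𝓘(ℝ, EM)) (0 : ℝ) hsd' hbm
      have hsv : tanMap (EP := ℝ) (EN := EP) (fun t : ℝ => C.sec (b (t, y))) 0 1 =
          tanMap (EP := EM) (EN := EP) C.sec y (w y) := by
        rw [tanMap_comp_apply (g := C.sec) (f := fun t : ℝ => b (t, y)) (p := (0 : ℝ)) hsd' hbm,
          hb0, tanMap_eq_fderiv, fderiv_apply_one_eq_deriv, hbd.deriv]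
      -- the velocity on the section
      have h1 : tanMap (EP := ℝ) (EN := EP) (fun t : ℝ => B.act (C.sec (b (t, y))) (c (t, y))) 0 1 =
          h y • X (C.sec y) := by
        rw [B.tanMap_act hsm hcd, hsv, hcv, hc0, hb0]
        simp only [B.act_one]
        rw [tanMap_id]
        have h2 := congrArg (fun v => h y • v) (tanMap_sec_add_fundamental hyW (X (C.sec y)))
        simp only [smul_add] at h2
        rw [← h2]
        exact congrArg₂ (fun u v : EP => u + v)
          (_root_.map_smul (tanMap (EP := EM) (EN := EP) C.sec y) (h y) _)
          (_root_.map_smul (tanMap (EP := EG) (EN := EP) (fun g : G => B.act (C.sec y) g) 1)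
            (h y) _)
      -- right translation carries it to the fibre
      simp only [B.act_mul]
      rw [tanMap_comp_apply (g := fun q => B.act q g)
        (f := fun t : ℝ => B.act (C.sec (b (t, y))) (c (t, y))) (p := (0 : ℝ))
        (B.mdifferentiableAt_act_right g _)
        (B.mdifferentiableAt_act hsm hcd), h1, map_smul, hb0, hc0, B.act_one, hX.invariant, hpy]
    · simp only [gaugeMap, localize, if_neg hp]
      rw [tanMap_const]
      rfl

end BundleChart

end LocalAutomorphisms

/-! ### Locality and the Bianchi identities -/

section Locality

variable {EM EG EP M G P : Type*}
  [NormedAddCommGroup EM] [NormedSpace ℝ EM] [NormedAddCommGroup EG] [NormedSpace ℝ EG]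
  [NormedAddCommGroup EP] [NormedSpace ℝ EP] [FiniteDimensional ℝ EP]
  [TopologicalSpace M] [ChartedSpace EM M] [TopologicalSpace G] [ChartedSpace EG G] [Group G]
  [TopologicalSpace P] [ChartedSpace EP P] [IsManifold 𝓘(ℝ, EP) ∞ P]
  {F : Type*} [NormedAddCommGroup F] [NormedSpace ℝ F]
  {V : Type*} [NormedAddCommGroup V] [NormedSpace ℝ V] {n : ℕ}

theorem iprod_congr {k : ℕ} (α : Form EP P F (k + 1)) {X Y : P → EP} {p : P} (h : X =ᶠ[𝓝 p] Y) :
    iprod X α =ᶠ[𝓝 p] iprod Y α := by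
  filter_upwards [h] with q hq
  simp only [iprod, hq]

theorem lieD_congr {k : ℕ} (α : Form EP P F (k + 1)) {X Y : P → EP} {p : P} (h : X =ᶠ[𝓝 p] Y) :
    lieD X α =ᶠ[𝓝 p] lieD Y α := by
  filter_upwards [h.eventually_nhds] with q hq
  exact congrArg₂ (fun u v : EP [⋀^Fin (k + 1)]→L[ℝ] F => u + v) (iprod_congr _ hq).self_of_nhds
    (extD_congr (iprod_congr _ hq))

theorem Fields.sameJet_lie (ψ : Fields EG EP P V n) {X Y : P → EP} {p : P} (h : X =ᶠ[𝓝 p] Y)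
    (r : ℕ) : Fields.SameJet r p (ψ.lie X) (ψ.lie Y) :=
  ⟨sameFormJet_of_eventuallyEq (lieD_congr _ h) r, sameFormJet_of_eventuallyEq (lieD_congr _ h) r,
    sameFormJet_of_eventuallyEq (iprod_congr _ h) r⟩

theorem iprod_zero {k : ℕ} (α : Form EP P F (k + 1)) : iprod (0 : P → EP) α = 0 := by
  ext p v
  exact (α p).map_coord_zero 0 rfl

theorem wedgeZero_zero {k : ℕ} (α : Form EP P (F →L[ℝ] ℝ) k) : wedgeZero α 0 = 0 := by
  ext p v
  simp [wedgeZero]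

/-- The variation along the zero field, as the trivial linear combination to which the linearity of
a symplectic potential applies. -/
theorem Fields.lie_zero (ψ : Fields EG EP P V n) :
    ψ.lie (0 : P → EP) = Fields.comb 0 (ψ.lie 0) 0 (ψ.lie 0) := by
  simp [Fields.lie, Fields.comb, lieD, lieDZero, iprod_zero, extD_zero]

variable {B : PrincipalBundle EM EG EP M G P} {R : FieldReps EG G V n}

section Pointwise

variable {X Y : P → EP} {p : P} {c : ℝ}

theorem iprod_of_eq_smul {k : ℕ} (α : Form EP P F (k + 1)) (h : Y p = c • X p) :
    iprod Y α p = c • iprod X α p := by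
  ext v
  simp [iprod, h]

theorem wedgeOne_of_eq_smul {k : ℕ} (α : Form EP P (F →L[ℝ] ℝ) k) {μ ν : Form EP P F 1}
    (h : ν p = c • μ p) : wedgeOne α ν p = c • wedgeOne α μ p := by
  ext v
  rw [ContinuousAlternatingMap.smul_apply, wedgeOne_apply, wedgeOne_apply, Finset.smul_sum]
  refine Finset.sum_congr rfl fun i _ => ?_
  rw [h, ContinuousAlternatingMap.smul_apply, _root_.map_smul, smul_eq_mul, smul_eq_mul]
  ring

theorem wedgeZero_of_eq_smul {k : ℕ} (α : Form EP P (F →L[ℝ] ℝ) k) {f g : Form EP P F 0}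
    (h : g p = c • f p) : wedgeZero α g p = c • wedgeZero α f p := by
  ext v
  simp [wedgeZero, h]

/-- The left-hand side of the Bianchi identities is linear in the vector field, pointwise. -/
theorem bianchi_of_eq_smul (E : DualFields EG EP P V n) (ψ : Fields EG EP P V n)
    (h : Y p = c • X p) : bianchi E ψ Y p = c • bianchi E ψ X p := by
  simp only [bianchi, Pi.add_apply, Pi.neg_apply, Pi.smul_apply,
    wedgeOne_of_eq_smul _ (iprod_of_eq_smul _ h), wedgeZero_of_eq_smul _ (iprod_of_eq_smul _ h)]
  module

end Pointwise

variable [LieGroup 𝓘(ℝ, EG) ∞ G]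

theorem isGenerator_zero (B : PrincipalBundle EM EG EP M G P) :
    IsGenerator B (fun _ => Diffeomorph.refl 𝓘(ℝ, EP) P ∞) (0 : P → EP) where
  automorphism _ _ _ := rfl
  deformation := ⟨contMDiff_snd, fun _ => rfl, fun p => by
    change tanMap (EP := ℝ) (EN := EP) (fun _ : ℝ => p) 0 1 = 0
    rw [tanMap_const]
    rfl⟩

variable {L : Fields EG EP P V n → Form EP P ℝ (n + 1)}
  {E : Fields EG EP P V n → DualFields EG EP P V n}
  {θ : Fields EG EP P V n → Fields EG EP P V n → Form EP P ℝ n}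
  {ψ : Fields EG EP P V n} {X Y : P → EP}

/-- The difference of the Noether current and the constraints depends only on the germ of the
vector field. -/
theorem IsSymplecticPotential.noetherCurrent_sub_congr (hθ : IsSymplecticPotential B R L E θ)
    (hψ : ψ.IsDynamical B R) (hX : (ψ.lie X).IsVariation B R) (hY : (ψ.lie Y).IsVariation B R)
    {p : P} (h : X =ᶠ[𝓝 p] Y) :
    (noetherCurrent L θ ψ X - constraints (E ψ) ψ X) p =
      (noetherCurrent L θ ψ Y - constraints (E ψ) ψ Y) p := by
  obtain ⟨r, hr⟩ := hθ.finite_order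
  have h1 : θ ψ (ψ.lie X) p = θ ψ (ψ.lie Y) p :=
    hr ψ ψ _ _ hψ hψ hX hY p ⟨fun _ _ => rfl, fun _ _ => rfl, fun _ _ => rfl⟩
      (ψ.sameJet_lie h r)
  simp only [noetherCurrent, constraints, wedgeZero, Pi.sub_apply, Pi.smul_apply, Pi.add_apply,
    h1, h.self_of_nhds, iprod]

/-- The difference of the Noether current and the constraints vanishes where the germ of the vector
field does. -/
theorem IsSymplecticPotential.noetherCurrent_sub_eq_zero [FiniteDimensional ℝ EG]
    [FiniteDimensional ℝ V] (hθ : IsSymplecticPotential B R L E θ)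
    (hψ : ψ.IsDynamical B R) (hX : (ψ.lie X).IsVariation B R) {p : P} (h : X =ᶠ[𝓝 p] 0) :
    (noetherCurrent L θ ψ X - constraints (E ψ) ψ X) p = 0 := by
  have h0 := (isGenerator_zero B).isVariation_lie hψ
  have h1 : θ ψ (ψ.lie 0) = 0 := by
    rw [ψ.lie_zero, hθ.linear ψ _ _ hψ h0 h0]
    simp
  rw [hθ.noetherCurrent_sub_congr hψ hX h0 h]
  simp [noetherCurrent, constraints, h1, iprod_zero, wedgeZero_zero]

theorem IsSymplecticPotential.isSmoothForm_noetherCurrent_sub [FiniteDimensional ℝ EG]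
    [FiniteDimensional ℝ V] (hL : IsLagrangian B R L)
    (hE : ∀ ψ, ψ.IsDynamical B R → (E ψ).IsTensorial B R) (hθ : IsSymplecticPotential B R L E θ)
    (hψ : ψ.IsDynamical B R) (hX : IsSmoothVec X) (hlie : (ψ.lie X).IsVariation B R) :
    IsSmoothForm (noetherCurrent L θ ψ X - constraints (E ψ) ψ X) :=
  ((hθ.smooth ψ _ hψ hlie).sub ((hL.isTensorial hψ).smooth.iprod hX)).sub
    (constraints_smooth (hE ψ hψ) hψ hX)

namespace BundleChart

variable {C : BundleChart B} {h : EM → ℝ}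

theorem continuousAt_coord {p : P} (hp : p ∈ C.dom) : ContinuousAt C.coord p :=
  (C.smooth_coord.contMDiffAt (C.isOpen_dom.mem_nhds hp)).continuousAt

theorem localize_eventuallyEq {p : P} (hp : p ∈ C.dom) (hh : h =ᶠ[𝓝 (C.coord p)] 1) :
    C.localize h X =ᶠ[𝓝 p] X := by
  filter_upwards [C.isOpen_dom.mem_nhds hp, (continuousAt_coord hp).eventually hh] with q hq hq1
  simp [localize, hq, hq1]

theorem localize_eventuallyEq_zero {p : P} (hp : p ∈ C.dom) (hh : C.coord p ∉ tsupport h) :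
    C.localize h X =ᶠ[𝓝 p] 0 := by
  filter_upwards [C.isOpen_dom.mem_nhds hp, (continuousAt_coord hp).eventually
    ((isClosed_tsupport h).isOpen_compl.mem_nhds hh)] with q hq hq1
  simp [localize, image_eq_zero_of_notMem_tsupport hq1]

end BundleChart

variable [FiniteDimensional ℝ EM] [FiniteDimensional ℝ EG] [FiniteDimensional ℝ V]
  [T2Space M] [IsManifold 𝓘(ℝ, EM) ∞ M]

/-- Near each fibre, an infinitesimal automorphism agrees with one which is generated by
automorphisms. -/
theorem PrincipalBundle.IsInfAutomorphism.exists_isGenerator_eventuallyEq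
    (hX : B.IsInfAutomorphism X) (p : P) :
    ∃ f Y, IsGenerator B f Y ∧ ∀ g, Y =ᶠ[𝓝 (B.act p g)] X := by
  obtain ⟨C, hp, -⟩ := exists_bundleChart B p
  obtain ⟨ε, hε, hεW⟩ := Metric.nhds_basis_closedBall.mem_iff.1
    (C.isOpen_W.mem_nhds (C.mapsTo_coord p hp))
  let h : ContDiffBump (C.coord p) := ⟨ε / 2, ε, half_pos hε, half_lt_self hε⟩
  obtain ⟨f, hf⟩ := C.exists_isGenerator hX (h := h) h.contDiff h.hasCompactSupport
    (by rw [h.tsupport_eq]; exact hεW)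
  refine ⟨f, _, hf, fun g => BundleChart.localize_eventuallyEq (C.act_mem p hp g) ?_⟩
  rw [C.coord_act p hp]
  exact h.eventuallyEq_one

/-- Being tensorial can be checked fibre by fibre. -/
theorem PrincipalBundle.isTensorial_of_forall_fibre {k : ℕ} {ρ : G → F →L[ℝ] F} {α : Form EP P F k}
    (hα : IsSmoothForm α)
    (h : ∀ p, ∃ β, B.IsTensorial ρ β ∧ ∀ g, α (B.act p g) = β (B.act p g)) :
    B.IsTensorial ρ α := by
  refine ⟨hα, fun p v hv => ?_, fun g => funext fun p => ?_⟩
  all_goals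
    obtain ⟨β, hβ, hαβ⟩ := h p
    have h1 := hαβ 1
    rw [B.act_one] at h1
  · rw [h1, hβ.horizontal p v hv]
  · have h2 := congrFun (hβ.equivariant g) p
    simpa only [pullForm, mapForm, h1, hαβ g] using h2

/-- The Lie derivative of dynamical fields along an infinitesimal automorphism is a variation. -/
theorem PrincipalBundle.IsInfAutomorphism.isVariation_lie (hX : B.IsInfAutomorphism X)
    (hψ : ψ.IsDynamical B R) : (ψ.lie X).IsVariation B R := by
  have hXs := isSmoothVec_of_contMDiff hX.smooth
  refine ⟨PrincipalBundle.isTensorial_of_forall_fibre (hψ.coframe.smooth.lieD hXs) fun p => ?_,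
    PrincipalBundle.isTensorial_of_forall_fibre (hψ.connection.smooth.lieD hXs) fun p => ?_,
    PrincipalBundle.isTensorial_of_forall_fibre (hψ.charged.smooth.lieDZero hXs) fun p => ?_⟩
  all_goals
    obtain ⟨f, Y, hf, hY⟩ := hX.exists_isGenerator_eventuallyEq p
    have hv := hf.isVariation_lie hψ
  · exact ⟨_, hv.coframe, fun g => (lieD_congr _ (hY g).symm).self_of_nhds⟩
  · exact ⟨_, hv.connection, fun g => (lieD_congr _ (hY g).symm).self_of_nhds⟩
  · exact ⟨_, hv.charged, fun g => (iprod_congr _ (hY g).symm).self_of_nhds⟩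

/-- **Noether identity**: off shell, `d (J_X - C(X)) = B(X)`. -/
theorem IsSymplecticPotential.extD_noetherCurrent_sub (hdim : Module.finrank ℝ EM = n + 1)
    (hL : IsLagrangian B R L) (hE : ∀ ψ, ψ.IsDynamical B R → (E ψ).IsTensorial B R)
    (hθ : IsSymplecticPotential B R L E θ) (hψ : ψ.IsDynamical B R)
    (hX : B.IsInfAutomorphism X) :
    extD (noetherCurrent L θ ψ X - constraints (E ψ) ψ X) = bianchi (E ψ) ψ X := by
  funext p
  obtain ⟨f, Y, hf, hY⟩ := hX.exists_isGenerator_eventuallyEq p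
  have hYp : X =ᶠ[𝓝 p] Y := by
    have h1 := hY 1
    rw [B.act_one] at h1
    exact h1.symm
  have h2 : noetherCurrent L θ ψ X - constraints (E ψ) ψ X =ᶠ[𝓝 p]
      noetherCurrent L θ ψ Y - constraints (E ψ) ψ Y := by
    filter_upwards [hYp.eventually_nhds] with q hq
    exact hθ.noetherCurrent_sub_congr hψ (hX.isVariation_lie hψ) (hf.isVariation_lie hψ) hq
  rw [extD_congr h2, hf.extD_noetherCurrent_sub hdim hL hE hθ hψ,
    bianchi_of_eq_smul (c := 1) (X := X) _ _ (by rw [one_smul, hYp.self_of_nhds]), one_smul]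

/-- **Bianchi identities in integrated form**: on a local section, the integral of `B(X)` against
a test function vanishes, since it is the integral of `B` on the cut off vector field, an exact
form of compact support. -/
theorem IsSymplecticPotential.integral_smul_bianchi [MeasurableSpace EM] [BorelSpace EM]
    (hdim : Module.finrank ℝ EM = n + 1)
    (hL : IsLagrangian B R L) (hE : ∀ ψ, ψ.IsDynamical B R → (E ψ).IsTensorial B R)
    (hθ : IsSymplecticPotential B R L E θ) (hψ : ψ.IsDynamical B R)
    (hX : B.IsInfAutomorphism X) (C : BundleChart B) {h : EM → ℝ} (hh : ContDiff ℝ ∞ h)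
    (hhc : HasCompactSupport h) (hhW : tsupport h ⊆ C.W) (v : Fin (n + 1) → EM) :
    ∫ y, h y • pullE C.sec (bianchi (E ψ) ψ X) y v ∂(Measure.addHaar : Measure EM) = 0 := by
  classical
  obtain ⟨f, hf⟩ := C.exists_isGenerator hX hh hhc hhW
  have hlie := hf.isVariation_lie hψ
  set η := noetherCurrent L θ ψ (C.localize h X) - constraints (E ψ) ψ (C.localize h X)
  have hηs : IsSmoothForm η :=
    hθ.isSmoothForm_noetherCurrent_sub hL hE hψ hf.deformation.isSmoothVec hlie
  have hsec : ∀ y ∈ C.W, ContMDiffAt 𝓘(ℝ, EM) 𝓘(ℝ, EP) ∞ C.sec y :=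
    fun y hy => C.smooth_sec.contMDiffAt (C.isOpen_W.mem_nhds hy)
  let β : EM → EM [⋀^Fin n]→L[ℝ] ℝ := fun y => if y ∈ C.W then pullE C.sec η y else 0
  have hβW : ∀ y ∈ C.W, β =ᶠ[𝓝 y] pullE C.sec η := fun y hy => by
    filter_upwards [C.isOpen_W.mem_nhds hy] with z hz
    exact if_pos hz
  -- the current vanishes where the vector field does
  have hβ0 : ∀ y ∉ tsupport h, β y = 0 := by
    intro y hy
    by_cases hyW : y ∈ C.W
    · have hη0 : η (C.sec y) = 0 := hθ.noetherCurrent_sub_eq_zero hψ hlie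
        (BundleChart.localize_eventuallyEq_zero (C.mapsTo_sec y hyW) (by rwa [C.coord_sec y hyW]))
      rw [(hβW y hyW).self_of_nhds]
      ext v
      rw [pullE_apply, hη0]
      rfl
    · exact if_neg hyW
  have hβ0' : ∀ y ∉ tsupport h, β =ᶠ[𝓝 y] fun _ => 0 := fun y hy => by
    filter_upwards [(isClosed_tsupport h).isOpen_compl.mem_nhds hy] with z hz
    exact hβ0 z hz
  have hβs : ContDiff ℝ ∞ β := by
    rw [contDiff_iff_contDiffAt]
    intro y
    by_cases hy : y ∈ C.W
    · exact (contDiffAt_pullE hηs (hsec y hy)).congr_of_eventuallyEq (hβW y hy)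
    · exact contDiffAt_const.congr_of_eventuallyEq (hβ0' y fun h' => hy (hhW h'))
  rw [← integral_extDeriv_eq_zero (μ := Measure.addHaar) hβs (HasCompactSupport.intro hhc hβ0) v]
  congr 1
  funext y
  by_cases hy : y ∈ C.W
  · have hs := C.mapsTo_sec y hy
    have hb : bianchi (E ψ) ψ (C.localize h X) (C.sec y) = h y • bianchi (E ψ) ψ X (C.sec y) :=
      bianchi_of_eq_smul _ _ (by simp [BundleChart.localize, hs, C.coord_sec y hy])
    rw [(hβW y hy).extDeriv_eq, extDeriv_pullE hηs (hsec y hy),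
      hf.extD_noetherCurrent_sub hdim hL hE hθ hψ, pullE_apply, pullE_apply, hb]
    rfl
  · have hy' : y ∉ tsupport h := fun h' => hy (hhW h')
    rw [(hβ0' y hy').extDeriv_eq, image_eq_zero_of_notMem_tsupport hy', zero_smul]
    simp [extDeriv, alternatizeUncurryFin_apply]

/-- **Bianchi identities**: `B(X) = 0`, since its integral against every test function on a local
section vanishes. -/
theorem IsSymplecticPotential.bianchi_eq_zero (hdim : Module.finrank ℝ EM = n + 1)
    (hL : IsLagrangian B R L) (hE : ∀ ψ, ψ.IsDynamical B R → (E ψ).IsTensorial B R)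
    (hθ : IsSymplecticPotential B R L E θ) (hψ : ψ.IsDynamical B R)
    (hX : B.IsInfAutomorphism X) : bianchi (E ψ) ψ X = 0 := by
  borelize EM
  have hlie := hX.isVariation_lie hψ
  have hs : IsSmoothForm (bianchi (E ψ) ψ X) := by
    rw [← hθ.extD_noetherCurrent_sub hdim hL hE hψ hX]
    exact (hθ.isSmoothForm_noetherCurrent_sub hL hE hψ
      (isSmoothVec_of_contMDiff hX.smooth) hlie).extD
  ext p v
  obtain ⟨C, hp, hCp⟩ := exists_bundleChart B p
  have hpW := C.mapsTo_coord p hp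
  -- a horizontal form is determined by its pullback to the section
  let w : Fin (n + 1) → EM := fun i => tanMap (EP := EP) (EN := EM) C.coord p (v i)
  have hv : bianchi (E ψ) ψ X p v = pullE C.sec (bianchi (E ψ) ψ X) (C.coord p) w := by
    rw [pullE_apply, hCp]
    refine (isHorizontal_bianchi (hE ψ hψ) hψ hX hlie).apply_congr fun i =>
      C.isVertical_of_coord p hp _ ?_
    have h1 := BundleChart.tanMap_coord_sec hpW (w i)
    rw [hCp] at h1
    rw [_root_.map_sub, h1, sub_self]
  have hcont : ContinuousOn (fun y => pullE C.sec (bianchi (E ψ) ψ X) y w) C.W := fun y hy => by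
    have h1 := (contDiffAt_pullE hs
      (C.smooth_sec.contMDiffAt (C.isOpen_W.mem_nhds hy))).continuousAt
    exact (((ContinuousAlternatingMap.apply ℝ EM ℝ w).continuous.continuousAt.comp
      h1).continuousWithinAt)
  have hae := IsOpen.ae_eq_zero_of_integral_contDiff_smul_eq_zero (μ := Measure.addHaar) C.isOpen_W
    (hcont.locallyIntegrableOn C.isOpen_W.measurableSet)
    fun h hh hhc hhW => hθ.integral_smul_bianchi hdim hL hE hψ hX C hh hhc hhW w
  have hzero := Measure.eqOn_open_of_ae_eq (μ := Measure.addHaar) (g := fun _ => 0)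
    ((ae_restrict_iff' C.isOpen_W.measurableSet).2 hae) C.isOpen_W hcont continuousOn_const
  rw [hv]
  exact hzero hpW

end Locality

end GaugeBianchi

end

theorem mainTheorem8
    {EM EG EP M G P V : Type*}
    [NormedAddCommGroup EM] [NormedSpace ℝ EM] [FiniteDimensional ℝ EM]
    [NormedAddCommGroup EG] [NormedSpace ℝ EG] [FiniteDimensional ℝ EG]
    [NormedAddCommGroup EP] [NormedSpace ℝ EP] [FiniteDimensional ℝ EP]
    [NormedAddCommGroup V] [NormedSpace ℝ V] [FiniteDimensional ℝ V]
    [TopologicalSpace M] [T2Space M] [SecondCountableTopology M]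
    [ChartedSpace EM M] [IsManifold 𝓘(ℝ, EM) ∞ M]
    [TopologicalSpace G] [T2Space G] [SecondCountableTopology G]
    [ChartedSpace EG G] [Group G] [LieGroup 𝓘(ℝ, EG) ∞ G]
    [TopologicalSpace P] [T2Space P] [SecondCountableTopology P]
    [ChartedSpace EP P] [IsManifold 𝓘(ℝ, EP) ∞ P]
    {n : ℕ} (hdim : Module.finrank ℝ EM = n + 1)
    (B : GaugeBianchi.PrincipalBundle EM EG EP M G P)
    (R : GaugeBianchi.FieldReps EG G V n)
    (L : GaugeBianchi.Fields EG EP P V n → GaugeBianchi.Form EP P ℝ (n + 1))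
    (hL : GaugeBianchi.IsLagrangian B R L)
    (E : GaugeBianchi.Fields EG EP P V n → GaugeBianchi.DualFields EG EP P V n)
    (hE : GaugeBianchi.IsEquationsOfMotion B R L E)
    (ψ : GaugeBianchi.Fields EG EP P V n) (hψ : ψ.IsDynamical B R)
    (X : P → EP) (hX : B.IsInfAutomorphism X) :
    GaugeBianchi.bianchi (E ψ) ψ X = 0 ∧
      ∀ θ, GaugeBianchi.IsSymplecticPotential B R L E θ →
        GaugeBianchi.extD
          (GaugeBianchi.noetherCurrent L θ ψ X - GaugeBianchi.constraints (E ψ) ψ X) = 0 := by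
  obtain ⟨θ, hθ⟩ := hE.variational
  have h := hθ.bianchi_eq_zero hdim hL hE.tensorial hψ hX
  exact ⟨h, fun θ' hθ' => (hθ'.extD_noetherCurrent_sub hdim hL hE.tensorial hψ hX).trans h⟩
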